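/- Let $\mathcal{S}_{\mathrm{per}}$ be the space of smooth functions $f:\mathbb{R}^2\to\mathbb{C}$, $(t,x)\mapsto f(t,x)$, that are $2\pi$-periodic in $x$ and Schwartz in $t$, i.e. all partial derivatives of $f$ decay faster than any power of $|t|$, uniformly in $x$. Write $\langle y\rangle=(1+|y|^2)^{1/2}$ and, for $\tau\in\mathbb{R}$, $\xi\in\mathbb{Z}$, $$\mathcal{F}f(\tau,\xi)=\frac{1}{2\pi}\int_{\mathbb{R}}e^{-it\tau}\int_0^{2\pi}e^{-ix\xi}f(t,x)\,dx\,dt .$$ For $s,b\in\mathbb{R}$ put $$\|f\|_{X_{s,b}}^2=\sum_{\xi\in\mathbb{Z}}\int_{\mathbb{R}}\langle\xi\rangle^{2s}\langle\tau+\xi^2\rangle^{2b}|\mathcal{F}f(\tau,\xi)|^2\,d\tau,\qquad \|f\|_{X^-_{s,b}}^2=\sum_{\xi\in\mathbb{Z}}\int_{\mathbb{R}}\langle\xi\rangle^{2s}\langle\tau-\xi^2\rangle^{2b}|\mathcal{F}f(\tau,\xi)|^2\,d\tau,$$ $$\|f\|_{Y_{s,b}}^2=\sum_{\xi\in\mathbb{Z}}\Big(\int_{\mathbb{R}}\langle\tau+\xi^2\rangle^{b}\langle\xi\rangle^{s}|\mathcal{F}f(\tau,\xi)|\,d\tau\Big)^2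 .$$ Theorem. There exist $c,\varepsilon>0$ such that for all $T\in(0,1]$ and all $u_1,u_2,u_3\in\mathcal{S}_{\mathrm{per}}$ with $\operatorname{supp}(u_j)\subset\{(t,x)\mid |t|\le T\}$, $j=1,2,3$, $$\|u_1u_2\,\partial_xu_3\|_{Y_{\frac12,-1}}\le c\,T^{\varepsilon}\,\|u_1\|_{X_{\frac12,\frac12}}\|u_2\|_{X_{\frac12,\frac12}}\|u_3\|_{X^-_{\frac12,\frac12}} .$$ -/

import Mathlib

noncomputable section

namespace PeriodicBourgain

/-- Functions `f (t, x)` on `ℝ × ℝ` that are smooth, `2π`-periodic in `x` and Schwartz in `t`: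
every derivative decays faster than any power of `|t|`, uniformly in `x`. Equivalently,
`x ↦ f (·, x)` is a smooth `2π`-periodic map into the Schwartz space `𝓢(ℝ)`. -/
structure IsSper (f : ℝ × ℝ → ℂ) : Prop where
  smooth : ContDiff ℝ (⊤ : ℕ∞) f
  periodic : ∀ t x : ℝ, f (t, x + 2 * Real.pi) = f (t, x)
  decay : ∀ k n : ℕ, ∃ C : ℝ, ∀ t x : ℝ, |t| ^ k * ‖iteratedFDeriv ℝ n f (t, x)‖ ≤ C

/-- The bracket `⟨y⟩ = (1 + |y|²)^{1/2}`. -/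
def bracket (y : ℝ) : ℝ := Real.sqrt (1 + y ^ 2)

/-- The spatial Fourier coefficient `(2π)^{-1/2} ∫_0^{2π} e^{-ixξ} g(x) dx`. -/
def fourierX (g : ℝ → ℂ) (ξ : ℤ) : ℂ :=
  (((2 * Real.pi) ^ (-(1 / 2) : ℝ) : ℝ) : ℂ) *
    ∫ x in (0 : ℝ)..(2 * Real.pi), Complex.exp (-(Complex.I * x * ξ)) * g x

/-- The temporal Fourier transform `(2π)^{-1/2} ∫ e^{-itτ} g(t) dt`. -/
def fourierT (g : ℝ → ℂ) (τ : ℝ) : ℂ :=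
  (((2 * Real.pi) ^ (-(1 / 2) : ℝ) : ℝ) : ℂ) *
    ∫ t : ℝ, Complex.exp (-(Complex.I * t * τ)) * g t

/-- The space-time Fourier transform `ℱ = ℱ_t ℱ_x`. -/
def fourierTX (f : ℝ × ℝ → ℂ) (τ : ℝ) (ξ : ℤ) : ℂ :=
  fourierT (fun t => fourierX (fun x => f (t, x)) ξ) τ

/-- The norm of `X_{s,b}`, with values in `[0, ∞]`. -/
def normX (s b : ℝ) (f : ℝ × ℝ → ℂ) : ENNReal :=
  (∑' ξ : ℤ, ∫⁻ τ : ℝ, ENNReal.ofReal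
    (bracket ξ ^ (2 * s) * bracket (τ + (ξ : ℝ) ^ 2) ^ (2 * b) * ‖fourierTX f τ ξ‖ ^ 2))
    ^ (1 / 2 : ℝ)

/-- The norm of `X^-_{s,b}`, with values in `[0, ∞]`. -/
def normXminus (s b : ℝ) (f : ℝ × ℝ → ℂ) : ENNReal :=
  (∑' ξ : ℤ, ∫⁻ τ : ℝ, ENNReal.ofReal
    (bracket ξ ^ (2 * s) * bracket (τ - (ξ : ℝ) ^ 2) ^ (2 * b) * ‖fourierTX f τ ξ‖ ^ 2))
    ^ (1 / 2 : ℝ)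

/-- The norm of `Y_{s,b}`, with values in `[0, ∞]`. -/
def normY (s b : ℝ) (f : ℝ × ℝ → ℂ) : ENNReal :=
  (∑' ξ : ℤ, (∫⁻ τ : ℝ, ENNReal.ofReal
    (bracket (τ + (ξ : ℝ) ^ 2) ^ b * bracket ξ ^ s * ‖fourierTX f τ ξ‖)) ^ 2)
    ^ (1 / 2 : ℝ)

/-- The partial derivative `∂_x f`. -/
def partialX (f : ℝ × ℝ → ℂ) : ℝ × ℝ → ℂ :=
  fun p => deriv (fun x => f (p.1, x)) p.2

end PeriodicBourgain

end

open MeasureTheory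
open scoped ENNReal NNReal

namespace PeriodicBourgain

/-! On the Fourier side a product becomes a convolution, so after taking absolute values the claim
is a weighted trilinear convolution inequality on `ℝ × ℤ`. Write k for the output frequency, m, n, l
= k - m - n for the input frequencies, and σ₀, σ₁, σ₂, σ₃ for the four modulations. Apart from
modulations, the multiplier is (⟨k⟩⟨l⟩)^{1/2} / (⟨m⟩⟨n⟩)^{1/2}. Two identities control it: σ₀ - σ₁ -
σ₂ - σ₃ = 2(k - m)(k - n) (`modulation_identity`) and kl = (k - m)(k - n) - mn. Hence either ⟨k⟩⟨l⟩
≲ ⟨m⟩⟨n⟩ and the multiplier is bounded, or ⟨k⟩⟨l⟩ is bounded by the largest modulation, whose power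
1/2 pays for the derivative.

`multiplier_le` makes this precise: the multiplier is dominated by a sum of kernels, one for each
choice of dominant modulation, with separate treatment of the range where m and n are tiny compared
with k (`IsSmallPair`). Outside that range ⟨k⟩⟨l⟩ is polynomially bounded in ⟨m⟩⟨n⟩, so a small
power of it can be exchanged for decay in m and n. Each kernel is bounded on L² by Cauchy–Schwarz,
with the variable to be frozen chosen according to the dominant modulation; this reduces to
integrals of brackets and to sums over lattice points of ⟨μ + 2(k - m)(k - n)⟩^{-5/8}.

The L¹ norm in τ inside `normY` is turned into L² by Cauchy–Schwarz against ⟨σ₀⟩^{-33/64}. When σ₀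
dominates and m, n are tiny there is no power to spare for this, but then |σ₀| ≳ ⟨k⟩², and
`farWeight` has an L² norm in τ independent of k.

The power of T arises because every term needs exponent 1/2 on only one input modulation and 31/64
on the other two. A function supported in [-T, T] has at least half of its Fourier mass at distance
more than 1/(2T) from any given point, so each lowered exponent gains T^{1/64} in norm. Two of them
give ε = 1/32. -/

/-! ### Brackets and power weights. -/

theorem one_le_bracket (y : ℝ) : 1 ≤ bracket y := by
  unfold bracket
  rw [Real.one_le_sqrt]
  nlinarith [sq_nonneg y]

theorem bracket_pos (y : ℝ) : 0 < bracket y := lt_of_lt_of_le one_pos (one_le_bracket y)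

theorem bracket_sq (y : ℝ) : bracket y ^ 2 = 1 + y ^ 2 := by
  unfold bracket
  exact Real.sq_sqrt (by positivity)

theorem bracket_neg (y : ℝ) : bracket (-y) = bracket y := by simp [bracket]

theorem abs_le_bracket (y : ℝ) : |y| ≤ bracket y := by
  refine le_of_sq_le_sq ?_ (bracket_pos y).le
  rw [bracket_sq, sq_abs]; linarith

theorem bracket_le_one_add_abs (y : ℝ) : bracket y ≤ 1 + |y| := by
  refine le_of_sq_le_sq ?_ (by positivity)
  rw [bracket_sq]
  nlinarith [abs_nonneg y, sq_abs y]

theorem bracket_le_bracket {x y : ℝ} (h : |x| ≤ |y|) : bracket x ≤ bracket y := by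
  unfold bracket
  exact Real.sqrt_le_sqrt (by have := sq_le_sq.mpr h; linarith)

theorem bracket_add_le (x y : ℝ) : bracket (x + y) ≤ bracket x + bracket y := by
  refine le_of_sq_le_sq ?_ (by have := bracket_pos x; have := bracket_pos y; positivity)
  have h : x * y ≤ bracket x * bracket y :=
    (le_abs_self _).trans (by
      rw [abs_mul]
      exact mul_le_mul (abs_le_bracket x) (abs_le_bracket y) (abs_nonneg _) (bracket_pos x).le)
  have := bracket_sq x
  have := bracket_sq y
  rw [bracket_sq]
  nlinarith

theorem continuous_bracket : Continuous bracket := by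
  unfold bracket
  fun_prop

/-- The weight `⟨y⟩^{-p}` with values in `[0, ∞]`. -/
noncomputable def decay (p y : ℝ) : ℝ≥0∞ := ENNReal.ofReal (bracket y ^ (-p))

theorem measurable_decay (p : ℝ) : Measurable (decay p) :=
  ENNReal.measurable_ofReal.comp (continuous_bracket.measurable.pow_const _)

theorem decay_neg (p y : ℝ) : decay p (-y) = decay p y := by simp [decay, bracket_neg]

theorem decay_sub_comm (p x y : ℝ) : decay p (x - y) = decay p (y - x) := by
  rw [← decay_neg, neg_sub]

theorem decay_mul_decay (p q y : ℝ) : decay p y * decay q y = decay (p + q) y := by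
  unfold decay
  rw [← ENNReal.ofReal_mul (Real.rpow_nonneg (bracket_pos y).le _), ← Real.rpow_add (bracket_pos y)]
  congr 2; ring

theorem decay_le_one {p : ℝ} (hp : 0 ≤ p) (y : ℝ) : decay p y ≤ 1 := by
  unfold decay
  rw [ENNReal.ofReal_le_one]
  exact Real.rpow_le_one_of_one_le_of_nonpos (one_le_bracket y) (by linarith)

theorem decay_le_decay_exponent {p q : ℝ} (h : p ≤ q) (y : ℝ) : decay q y ≤ decay p y :=
  ENNReal.ofReal_le_ofReal (Real.rpow_le_rpow_of_exponent_le (one_le_bracket y) (by linarith))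

theorem decay_le_of_bracket_le {p : ℝ} (hp : 0 ≤ p) {x y : ℝ} (h : bracket x ≤ bracket y) :
    decay p y ≤ decay p x :=
  ENNReal.ofReal_le_ofReal
    (Real.rpow_le_rpow_of_nonpos (bracket_pos x) h (by linarith))

theorem decay_le_of_abs_le {p : ℝ} (hp : 0 ≤ p) {x y : ℝ} (h : |x| ≤ |y|) :
    decay p y ≤ decay p x :=
  decay_le_of_bracket_le hp (bracket_le_bracket h)

theorem decay_mul_le_add {p q : ℝ} (hp : 0 ≤ p) (hq : 0 ≤ q) (x y : ℝ) :
    decay p x * decay q y ≤ decay (p + q) x + decay (p + q) y := by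
  rcases le_total (bracket x) (bracket y) with h | h
  · refine le_trans ?_ le_self_add
    rw [← decay_mul_decay]
    gcongr
    exact decay_le_of_bracket_le hq h
  · refine le_trans ?_ le_add_self
    rw [← decay_mul_decay]
    gcongr
    exact decay_le_of_bracket_le hp h

theorem decay_le_mul_of_bracket_le {p : ℝ} (hp : 0 ≤ p) {c : ℝ} (hc : 0 < c) {x y : ℝ}
    (h : bracket x ≤ c * bracket y) : decay p y ≤ ENNReal.ofReal (c ^ p) * decay p x := by
  unfold decay
  rw [← ENNReal.ofReal_mul (by positivity)]
  refine ENNReal.ofReal_le_ofReal ?_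
  have hx := bracket_pos x
  have hy := bracket_pos y
  rw [Real.rpow_neg hy.le, Real.rpow_neg hx.le, ← div_eq_mul_inv, le_div_iff₀ (by positivity),
    ← div_eq_inv_mul, div_le_iff₀ (by positivity), ← Real.mul_rpow hc.le hy.le]
  exact Real.rpow_le_rpow hx.le h hp

/-! ### Uniform bounds for lattice sums and integrals of power weights. -/

theorem exists_tsum_decay_le {p : ℝ} (hp : 1 < p) :
    ∃ C : ℝ≥0, ∀ y : ℝ, ∑' n : ℤ, decay p (n - y) ≤ C := by
  have hs : ∑' n : ℤ, decay p n ≠ ∞ := by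
    have h1 : Summable fun n : ℤ => bracket (n : ℝ) ^ (-p) := by
      have := (Real.summable_abs_int_rpow hp)
      have h2 : Summable fun n : ℤ => |(n : ℝ)| ^ (-p) + if n = 0 then (1 : ℝ) else 0 :=
        this.add (summable_of_ne_finset_zero (s := {0}) (by intro b hb; simp at hb; simp [hb]))
      refine h2.of_nonneg_of_le (fun n => Real.rpow_nonneg (bracket_pos _).le _) fun n => ?_
      by_cases hn : n = 0
      · subst hn
        have : bracket ((0 : ℤ) : ℝ) = 1 := by simp [bracket]
        rw [this]
        have : 0 ≤ |((0 : ℤ) : ℝ)| ^ (-p) := by positivity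
        simp only [Real.one_rpow, if_true]
        linarith
      · simp only [hn, if_false, add_zero]
        exact Real.rpow_le_rpow_of_nonpos (by positivity) (abs_le_bracket _) (by linarith)
    unfold decay
    rw [← ENNReal.ofReal_tsum_of_nonneg (fun n => Real.rpow_nonneg (bracket_pos _).le _) h1]
    exact ENNReal.ofReal_ne_top
  refine ⟨(ENNReal.ofReal (2 ^ p) * ∑' n : ℤ, decay p n).toNNReal, fun y => ?_⟩
  rw [ENNReal.coe_toNNReal (ENNReal.mul_ne_top ENNReal.ofReal_ne_top hs)]
  -- Recentring at ⌊y⌋ leaves a shift by a fractional part, which changes brackets by a factor at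
  -- most 2.
  rw [← (Equiv.addRight ⌊y⌋).tsum_eq, ← ENNReal.tsum_mul_left]
  refine ENNReal.tsum_le_tsum fun n => ?_
  refine decay_le_mul_of_bracket_le (by linarith) two_pos ?_
  have h1 : bracket (Int.fract y) ≤ 2 :=
    (bracket_le_one_add_abs _).trans (by
      rw [abs_of_nonneg (Int.fract_nonneg y)]; linarith [Int.fract_lt_one y])
  set z : ℝ := (((Equiv.addRight ⌊y⌋) n : ℤ) : ℝ) - y with hz
  have h2 : (n : ℝ) = z + Int.fract y := by
    rw [hz, Equiv.coe_addRight, Int.cast_add]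
    linarith [Int.floor_add_fract y]
  have h3 : |(n : ℝ)| ≤ |z| + 1 := by
    rw [h2]
    refine (abs_add_le _ _).trans ?_
    rw [abs_of_nonneg (Int.fract_nonneg y)]; linarith [Int.fract_lt_one y]
  refine le_of_sq_le_sq ?_ (by have := bracket_pos z; positivity)
  rw [mul_pow, bracket_sq, bracket_sq]
  nlinarith [sq_abs z, sq_abs (n : ℝ), abs_nonneg z, abs_nonneg (n : ℝ), sq_nonneg (|z| - 1)]

theorem exists_tsum_decay_linear_le {p : ℝ} (hp : 1 < p) :
    ∃ C : ℝ≥0, ∀ c d : ℝ, 1 ≤ |c| → ∑' n : ℤ, decay p (c * n + d) ≤ C := by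
  obtain ⟨C, hC⟩ := exists_tsum_decay_le hp
  refine ⟨C, fun c d hc => le_trans (ENNReal.tsum_le_tsum fun n => ?_) (hC (-(d / c)))⟩
  refine decay_le_of_abs_le (by linarith) ?_
  have hc0 : c ≠ 0 := by rintro rfl; norm_num at hc
  have : c * n + d = c * (n - -(d / c)) := by field_simp; ring
  rw [this, abs_mul]
  nlinarith [abs_nonneg ((n : ℝ) - -(d / c))]

/-- The smaller of |z|, |w| has its square bounded by |zw|, so a product decays like twice the
exponent in one of its factors. -/
theorem decay_mul_le_add_decay_two_mul {p : ℝ} (hp : 0 ≤ p) (z w : ℝ) :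
    decay p (z * w) ≤ ENNReal.ofReal (2 ^ (2 * p)) * (decay (2 * p) z + decay (2 * p) w) := by
  wlog h : |z| ≤ |w| generalizing z w
  · rw [mul_comm, add_comm]
    exact this w z (le_of_not_ge h)
  have h1 : bracket z ^ 2 ≤ 2 ^ 2 * bracket (z * w) := by
    have h2 : z ^ 2 ≤ |z * w| := by
      rw [abs_mul, ← sq_abs]; nlinarith [abs_nonneg z]
    have := abs_le_bracket (z * w)
    have := one_le_bracket (z * w)
    rw [bracket_sq]; linarith
  have h2 : decay p (z * w) ≤ ENNReal.ofReal (2 ^ (2 * p)) * decay (2 * p) z := by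
    unfold decay
    rw [← ENNReal.ofReal_mul (by positivity)]
    refine ENNReal.ofReal_le_ofReal ?_
    have hx := bracket_pos z
    have hy := bracket_pos (z * w)
    rw [Real.rpow_neg hy.le, Real.rpow_neg hx.le, ← div_eq_mul_inv, le_div_iff₀ (by positivity),
      ← div_eq_inv_mul, div_le_iff₀ (by positivity), Real.rpow_mul hx.le, Real.rpow_mul two_pos.le,
      ← Real.mul_rpow (by positivity) hy.le]
    refine Real.rpow_le_rpow (by positivity) ?_ hp
    exact_mod_cast h1
  refine h2.trans ?_
  gcongr
  exact le_self_add

/-- With real roots the quadratic factors, and the product bound yields two linear sums with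
exponent 2p > 1. With negative discriminant it is at least (n + b/2)², a double root. -/
theorem exists_tsum_decay_quadratic_le {p : ℝ} (hp : 1 / 2 < p) :
    ∃ C : ℝ≥0, ∀ b c : ℝ, ∑' n : ℤ, decay p ((n : ℝ) ^ 2 + b * n + c) ≤ C := by
  obtain ⟨C, hC⟩ := exists_tsum_decay_le (p := 2 * p) (by linarith)
  refine ⟨((2 : ℝ) ^ (2 * p)).toNNReal * (C + C), fun b c => ?_⟩
  have key : ∀ y₁ y₂ : ℝ, (∀ n : ℤ, decay p ((n : ℝ) ^ 2 + b * n + c)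
      ≤ decay p ((n - y₁) * (n - y₂))) →
      ∑' n : ℤ, decay p ((n : ℝ) ^ 2 + b * n + c) ≤
        (((2 : ℝ) ^ (2 * p)).toNNReal * (C + C) : ℝ≥0) := by
    intro y₁ y₂ h
    calc ∑' n : ℤ, decay p ((n : ℝ) ^ 2 + b * n + c)
        ≤ ∑' n : ℤ, ENNReal.ofReal (2 ^ (2 * p)) *
            (decay (2 * p) (n - y₁) + decay (2 * p) (n - y₂)) :=
          ENNReal.tsum_le_tsum fun n =>
            (h n).trans (decay_mul_le_add_decay_two_mul (by linarith) _ _)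
      _ = ENNReal.ofReal (2 ^ (2 * p)) *
            (∑' n : ℤ, decay (2 * p) (n - y₁) + ∑' n : ℤ, decay (2 * p) (n - y₂)) := by
          rw [ENNReal.tsum_mul_left, ENNReal.tsum_add]
      _ ≤ ENNReal.ofReal (2 ^ (2 * p)) * (C + C) := by
          gcongr
          · exact hC _
          · exact hC _
      _ = _ := by push_cast; rfl
  have hid : ∀ n : ℤ, (n : ℝ) ^ 2 + b * n + c = (n + b / 2) ^ 2 - (b ^ 2 / 4 - c) := by
    intro n; ring
  rcases le_total 0 (b ^ 2 / 4 - c) with h | h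
  · refine key (-(b / 2) + Real.sqrt (b ^ 2 / 4 - c)) (-(b / 2) - Real.sqrt (b ^ 2 / 4 - c))
      fun n => le_of_eq ?_
    congr 1
    rw [hid]
    nth_rewrite 1 [← Real.sq_sqrt h]
    ring
  · refine key (-(b / 2)) (-(b / 2)) fun n => decay_le_of_abs_le (by linarith) ?_
    rw [hid, abs_of_nonneg (by nlinarith [sq_nonneg ((n : ℝ) + b / 2)]),
      abs_of_nonneg (by nlinarith [sq_nonneg ((n : ℝ) + b / 2)])]
    nlinarith

theorem exists_lintegral_decay_le {p : ℝ} (hp : 1 < p) :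
    ∃ C : ℝ≥0, ∀ y : ℝ, ∫⁻ x, decay p (x - y) ≤ C := by
  have h : ∫⁻ x, decay p x ≠ ∞ := by
    have h1 : Integrable fun x : ℝ => bracket x ^ (-p) := by
      have := integrable_rpow_neg_one_add_norm_sq (E := ℝ) (μ := volume) (r := p) (by simpa using hp)
      refine this.congr (Filter.Eventually.of_forall fun x => ?_)
      simp only [bracket]
      rw [Real.sqrt_eq_rpow, ← Real.rpow_mul (by positivity)]
      simp only [Real.norm_eq_abs, sq_abs]
      congr 1; ring
    have := h1.lintegral_lt_top
    exact this.ne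
  refine ⟨(∫⁻ x, decay p x).toNNReal, fun y => ?_⟩
  rw [ENNReal.coe_toNNReal h]
  exact (lintegral_sub_right_eq_self (decay p) y).le

/-- The larger of ⟨x - a⟩ and ⟨x - b⟩ is at least ⟨a - b⟩/2. Spending γ powers of it leaves total
exponent α + β - γ > 1 for the integration. -/
theorem exists_lintegral_decay_mul_decay_le {α β γ : ℝ} (hγ : 0 ≤ γ) (hα : γ ≤ α) (hβ : γ ≤ β)
    (h : 1 < α + β - γ) :
    ∃ C : ℝ≥0, ∀ a b : ℝ, ∫⁻ x, decay α (x - a) * decay β (x - b) ≤ C * decay γ (a - b) := by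
  obtain ⟨C, hC⟩ := exists_lintegral_decay_le h
  have key : ∀ {α β : ℝ}, γ ≤ α → γ ≤ β → ∀ u v : ℝ, bracket v ≤ bracket u →
      decay α u * decay β v ≤ ENNReal.ofReal (2 ^ γ) * decay γ (u - v) *
        (decay (α + β - γ) u + decay (α + β - γ) v) := by
    intro α β hα hβ u v huv
    have h1 : decay γ u ≤ ENNReal.ofReal (2 ^ γ) * decay γ (u - v) := by
      refine decay_le_mul_of_bracket_le hγ two_pos ?_
      have := bracket_add_le u (-v)
      rw [bracket_neg] at this
      rw [sub_eq_add_neg]; linarith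
    calc decay α u * decay β v = decay γ u * (decay (α - γ) u * decay β v) := by
          rw [← mul_assoc, decay_mul_decay]; congr 2; ring
      _ ≤ _ := by
          gcongr
          refine (decay_mul_le_add (by linarith) (by linarith) u v).trans (le_of_eq ?_)
          rw [show α - γ + β = α + β - γ by ring]
  have key2 : ∀ u v : ℝ, decay α u * decay β v ≤ ENNReal.ofReal (2 ^ γ) * decay γ (u - v) *
        (decay (α + β - γ) u + decay (α + β - γ) v) := by
    intro u v
    rcases le_total (bracket v) (bracket u) with huv | huv
    · exact key hα hβ u v huv
    · have := key hβ hα v u huv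
      rwa [mul_comm (decay α u), decay_sub_comm γ u v, add_comm (decay (α + β - γ) u),
        add_comm α β]
  refine ⟨((2 : ℝ) ^ γ).toNNReal * (C + C), fun a b => ?_⟩
  calc ∫⁻ x, decay α (x - a) * decay β (x - b)
      ≤ ∫⁻ x, ENNReal.ofReal (2 ^ γ) * decay γ (a - b) *
          (decay (α + β - γ) (x - a) + decay (α + β - γ) (x - b)) := by
        refine lintegral_mono fun x => (key2 _ _).trans (le_of_eq ?_)
        rw [show x - a - (x - b) = b - a by ring, decay_sub_comm]
    _ = ENNReal.ofReal (2 ^ γ) * decay γ (a - b) *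
          ((∫⁻ x, decay (α + β - γ) (x - a)) + ∫⁻ x, decay (α + β - γ) (x - b)) := by
        have hm : ∀ c : ℝ, Measurable fun x => decay (α + β - γ) (x - c) := fun c =>
          (measurable_decay _).comp (by fun_prop)
        rw [lintegral_const_mul _ (by exact (hm a).add (hm b)), lintegral_add_left (hm a)]
    _ ≤ ENNReal.ofReal (2 ^ γ) * decay γ (a - b) * (C + C) := by
        gcongr
        · exact hC _
        · exact hC _
    _ = _ := by
        push_cast
        rw [ENNReal.ofReal]
        ring

/-- Two successive convolutions, with exponents falling from 31/32 to 3/4 to 5/8. The final 5/8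
stays above the 1/2 needed for quadratic sums. -/
theorem exists_lintegral_lintegral_decay_le :
    ∃ C : ℝ≥0, ∀ a b c : ℝ,
      ∫⁻ x, ∫⁻ y, decay (31 / 32) (x - a) * decay (31 / 32) (y - b) * decay (31 / 32) (x + y - c)
        ≤ C * decay (5 / 8) (a + b - c) := by
  obtain ⟨C₁, h₁⟩ := exists_lintegral_decay_mul_decay_le (α := 31 / 32) (β := 31 / 32)
    (γ := 3 / 4) (by norm_num) (by norm_num) (by norm_num) (by norm_num)
  obtain ⟨C₂, h₂⟩ := exists_lintegral_decay_mul_decay_le (α := 31 / 32) (β := 3 / 4)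
    (γ := 5 / 8) (by norm_num) (by norm_num) (by norm_num) (by norm_num)
  have hm : ∀ c : ℝ, Measurable fun y => decay (31 / 32) (y - c) := fun c =>
    (measurable_decay _).comp (by fun_prop)
  refine ⟨C₁ * C₂, fun a b c => ?_⟩
  calc _ = ∫⁻ x, decay (31 / 32) (x - a) *
          ∫⁻ y, decay (31 / 32) (y - b) * decay (31 / 32) (y - (c - x)) := by
        refine lintegral_congr fun x => ?_
        rw [← lintegral_const_mul]
        · refine lintegral_congr fun y => ?_
          rw [mul_assoc, show x + y - c = y - (c - x) by ring]
        · exact (hm _).mul (hm _)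
    _ ≤ ∫⁻ x, decay (31 / 32) (x - a) * (C₁ * decay (3 / 4) (x - (c - b))) := by
        refine lintegral_mono fun x => ?_
        gcongr
        refine (h₁ _ _).trans (le_of_eq ?_)
        rw [show b - (c - x) = x - (c - b) by ring]
    _ = C₁ * ∫⁻ x, decay (31 / 32) (x - a) * decay (3 / 4) (x - (c - b)) := by
        rw [← lintegral_const_mul]
        · refine lintegral_congr fun y => ?_
          ring
        · exact (hm _).mul ((measurable_decay _).comp (by fun_prop))
    _ ≤ C₁ * (C₂ * decay (5 / 8) (a - (c - b))) := by gcongr; exact h₂ _ _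
    _ = _ := by
        rw [show a - (c - b) = a + b - c by ring]
        push_cast; ring

/-! ### Cauchy–Schwarz criteria for L² boundedness of trilinear convolutions. -/

theorem lintegral_mul_sq_le {X : Type*} [MeasurableSpace X] {μ : Measure X} {f g : X → ℝ≥0∞}
    (hf : Measurable f) (hg : Measurable g) :
    (∫⁻ x, f x * g x ∂μ) ^ 2 ≤ (∫⁻ x, f x ^ 2 ∂μ) * ∫⁻ x, g x ^ 2 ∂μ := by
  have h := ENNReal.lintegral_mul_le_Lp_mul_Lq μ Real.HolderConjugate.two_two
    hf.aemeasurable hg.aemeasurable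
  have h2 : ∀ a : ℝ≥0∞, (a ^ (1 / 2 : ℝ)) ^ 2 = a := fun a => by
    rw [← ENNReal.rpow_natCast, ← ENNReal.rpow_mul]; norm_num
  calc (∫⁻ x, f x * g x ∂μ) ^ 2
      ≤ ((∫⁻ x, f x ^ (2 : ℝ) ∂μ) ^ (1 / 2 : ℝ) * (∫⁻ x, g x ^ (2 : ℝ) ∂μ) ^ (1 / 2 : ℝ)) ^ 2 := by
        gcongr; exact h
    _ = _ := by
        rw [mul_pow, h2, h2]
        simp only [ENNReal.rpow_two]

theorem lintegral_lintegral_mul_eq {X : Type*} [MeasurableSpace X] {μ : Measure X}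
    {f₁ f₂ : X → ℝ≥0∞} (h₁ : Measurable f₁) (h₂ : Measurable f₂) :
    ∫⁻ q₁, ∫⁻ q₂, (f₁ q₁ * f₂ q₂) ^ 2 ∂μ ∂μ = (∫⁻ q, f₁ q ^ 2 ∂μ) * ∫⁻ q, f₂ q ^ 2 ∂μ := by
  simp_rw [mul_pow]
  rw [← lintegral_mul_const _ (h₁.pow_const 2)]
  refine lintegral_congr fun q₁ => ?_
  rw [lintegral_const_mul _ (h₂.pow_const 2)]

theorem lintegral_lintegral_mul_sq_le {G : Type*} [MeasurableSpace G] {μ : Measure G} [SFinite μ]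
    {f g : G → G → ℝ≥0∞}
    (hf : Measurable (Function.uncurry f)) (hg : Measurable (Function.uncurry g)) :
    (∫⁻ x, ∫⁻ y, f x y * g x y ∂μ ∂μ) ^ 2 ≤
      (∫⁻ x, ∫⁻ y, f x y ^ 2 ∂μ ∂μ) * ∫⁻ x, ∫⁻ y, g x y ^ 2 ∂μ ∂μ := by
  have h := lintegral_mul_sq_le (μ := μ.prod μ) hf hg
  rw [lintegral_prod _ (by exact (hf.mul hg).aemeasurable), lintegral_prod _ (hf.pow_const 2).aemeasurable,
    lintegral_prod _ (hg.pow_const 2).aemeasurable] at h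
  exact h

theorem lintegral_lintegral_lintegral_rotate {G : Type*} [MeasurableSpace G] {μ : Measure G}
    [SFinite μ] {H : G → G → G → ℝ≥0∞}
    (hH : Measurable fun z : G × G × G => H z.1 z.2.1 z.2.2) :
    ∫⁻ p, ∫⁻ q₁, ∫⁻ q₂, H p q₁ q₂ ∂μ ∂μ ∂μ = ∫⁻ q₁, ∫⁻ q₂, ∫⁻ p, H p q₁ q₂ ∂μ ∂μ ∂μ := by
  rw [lintegral_lintegral_swap]
  · refine lintegral_congr fun q₁ => ?_
    rw [lintegral_lintegral_swap]
    exact (hH.comp (f := fun z : G × G => (z.1, q₁, z.2)) (by fun_prop)).aemeasurable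
  · have : Measurable fun z : (G × G) × G => H z.1.1 z.1.2 z.2 :=
      hH.comp (f := fun z : (G × G) × G => (z.1.1, z.1.2, z.2)) (by fun_prop)
    exact this.lintegral_prod_right'.aemeasurable

section Trilinear

variable {G : Type*} [AddCommGroup G] [MeasurableSpace G] [MeasurableAdd₂ G] [MeasurableNeg G]
  {μ : Measure G} [SFinite μ]

/-- The trilinear convolution with kernel `K`, evaluated at `p`. -/
noncomputable def trilin (μ : Measure G) (K : G → G → G → ℝ≥0∞) (f₁ f₂ f₃ : G → ℝ≥0∞) (p : G) :
    ℝ≥0∞ :=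
  ∫⁻ q₁, ∫⁻ q₂, K p q₁ q₂ * (f₁ q₁ * f₂ q₂ * f₃ (p - q₁ - q₂)) ∂μ ∂μ

variable {K : G → G → G → ℝ≥0∞} {f₁ f₂ f₃ : G → ℝ≥0∞}

theorem measurable_trilin (hK : Measurable fun z : G × G × G => K z.1 z.2.1 z.2.2)
    (h₁ : Measurable f₁) (h₂ : Measurable f₂) (h₃ : Measurable f₃) :
    Measurable (trilin μ K f₁ f₂ f₃) := by
  unfold trilin
  have hm : Measurable fun z : (G × G) × G =>
      K z.1.1 z.1.2 z.2 * (f₁ z.1.2 * f₂ z.2 * f₃ (z.1.1 - z.1.2 - z.2)) := by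
    refine (hK.comp (f := fun z : (G × G) × G => (z.1.1, z.1.2, z.2)) (by fun_prop)).mul
      (Measurable.mul (by fun_prop) (h₃.comp (by fun_prop)))
  exact (hm.lintegral_prod_right').lintegral_prod_right'

theorem trilin_swap (hK : Measurable fun z : G × G × G => K z.1 z.2.1 z.2.2)
    (h₁ : Measurable f₁) (h₂ : Measurable f₂) (h₃ : Measurable f₃) (p : G) :
    trilin μ K f₁ f₂ f₃ p = trilin μ (fun p q₁ q₂ => K p q₂ q₁) f₂ f₁ f₃ p := by
  unfold trilin
  rw [lintegral_lintegral_swap]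
  · refine lintegral_congr fun q₂ => lintegral_congr fun q₁ => ?_
    rw [mul_comm (f₁ q₁), sub_right_comm]
  · exact ((hK.comp (f := fun z : G × G => (p, z.1, z.2)) (by fun_prop)).mul
      (Measurable.mul (by fun_prop) (h₃.comp (by fun_prop)))).aemeasurable

variable [μ.IsAddLeftInvariant]

/-- Cauchy–Schwarz at fixed output, separating the kernel from all three functions. Integrating over
p first then removes f₃ by translation invariance. -/
theorem lintegral_trilin_sq_le_of_output {C : ℝ≥0∞}
    (hK : Measurable fun z : G × G × G => K z.1 z.2.1 z.2.2)
    (h₁ : Measurable f₁) (h₂ : Measurable f₂) (h₃ : Measurable f₃)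
    (hC : ∀ p, ∫⁻ q₁, ∫⁻ q₂, K p q₁ q₂ ^ 2 ∂μ ∂μ ≤ C) :
    ∫⁻ p, trilin μ K f₁ f₂ f₃ p ^ 2 ∂μ ≤
      C * ((∫⁻ q, f₁ q ^ 2 ∂μ) * (∫⁻ q, f₂ q ^ 2 ∂μ) * ∫⁻ q, f₃ q ^ 2 ∂μ) := by
  have hm : Measurable fun z : G × G × G => f₁ z.2.1 * f₂ z.2.2 * f₃ (z.1 - z.2.1 - z.2.2) :=
    Measurable.mul (by fun_prop) (h₃.comp (by fun_prop))
  calc ∫⁻ p, trilin μ K f₁ f₂ f₃ p ^ 2 ∂μ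
      ≤ ∫⁻ p, C * ∫⁻ q₁, ∫⁻ q₂, (f₁ q₁ * f₂ q₂ * f₃ (p - q₁ - q₂)) ^ 2 ∂μ ∂μ ∂μ := by
        refine lintegral_mono fun p => ?_
        refine (lintegral_lintegral_mul_sq_le (μ := μ) (f := K p)
          (g := fun q₁ q₂ => f₁ q₁ * f₂ q₂ * f₃ (p - q₁ - q₂))
          (hK.comp (f := fun z : G × G => (p, z.1, z.2)) (by fun_prop))
          (hm.comp (f := fun z : G × G => (p, z.1, z.2)) (by fun_prop))).trans ?_
        gcongr
        exact hC p
    _ = C * ∫⁻ q₁, ∫⁻ q₂, ∫⁻ p, (f₁ q₁ * f₂ q₂ * f₃ (p - q₁ - q₂)) ^ 2 ∂μ ∂μ ∂μ := by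
        rw [lintegral_const_mul, lintegral_lintegral_lintegral_rotate (hm.pow_const 2)]
        have : Measurable fun z : (G × G) × G =>
            (f₁ z.1.2 * f₂ z.2 * f₃ (z.1.1 - z.1.2 - z.2)) ^ 2 :=
          (hm.pow_const 2).comp (f := fun z : (G × G) × G => (z.1.1, z.1.2, z.2)) (by fun_prop)
        exact this.lintegral_prod_right'.lintegral_prod_right'
    _ = C * ∫⁻ q₁, ∫⁻ q₂, (f₁ q₁ * f₂ q₂) ^ 2 * ∫⁻ q, f₃ q ^ 2 ∂μ ∂μ ∂μ := by
        congr 1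
        refine lintegral_congr fun q₁ => lintegral_congr fun q₂ => ?_
        simp_rw [mul_pow _ (f₃ _)]
        rw [lintegral_const_mul _ (by exact (h₃.comp (by fun_prop)).pow_const 2)]
        congr 1
        have := lintegral_sub_right_eq_self (μ := μ) (fun q => f₃ q ^ 2) (q₁ + q₂)
        simpa only [sub_sub] using this
    _ = _ := by
        congr 1
        rw [← lintegral_lintegral_mul_eq h₁ h₂, ← lintegral_mul_const]
        · refine lintegral_congr fun q₁ => ?_
          rw [lintegral_mul_const]
          exact (h₂.const_mul _).pow_const 2
        · have : Measurable fun z : G × G => (f₁ z.1 * f₂ z.2) ^ 2 := by fun_prop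
          exact this.lintegral_prod_right'

/-- Here the kernel is grouped with f₃ against f₁f₂, and p is replaced by q₃ + q₁ + q₂. This suits
kernels without decay in the third modulation. -/
theorem lintegral_trilin_sq_le_of_third {C : ℝ≥0∞}
    (hK : Measurable fun z : G × G × G => K z.1 z.2.1 z.2.2)
    (h₁ : Measurable f₁) (h₂ : Measurable f₂) (h₃ : Measurable f₃)
    (hC : ∀ q₃, ∫⁻ q₁, ∫⁻ q₂, K (q₃ + (q₁ + q₂)) q₁ q₂ ^ 2 ∂μ ∂μ ≤ C) :
    ∫⁻ p, trilin μ K f₁ f₂ f₃ p ^ 2 ∂μ ≤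
      C * ((∫⁻ q, f₁ q ^ 2 ∂μ) * (∫⁻ q, f₂ q ^ 2 ∂μ) * ∫⁻ q, f₃ q ^ 2 ∂μ) := by
  have hm : Measurable fun z : G × G × G => K z.1 z.2.1 z.2.2 * f₃ (z.1 - z.2.1 - z.2.2) :=
    hK.mul (h₃.comp (by fun_prop))
  have hm2 : Measurable fun z : (G × G) × G =>
      (K z.1.1 z.1.2 z.2 * f₃ (z.1.1 - z.1.2 - z.2)) ^ 2 :=
    (hm.pow_const 2).comp (f := fun z : (G × G) × G => (z.1.1, z.1.2, z.2)) (by fun_prop)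
  have hm3 : Measurable fun z : G × G × G => (K (z.1 + (z.2.1 + z.2.2)) z.2.1 z.2.2) ^ 2 :=
    (hK.pow_const 2).comp (f := fun z : G × G × G => (z.1 + (z.2.1 + z.2.2), z.2.1, z.2.2))
      (by fun_prop)
  have hm4 : Measurable fun z : G × G × G =>
      (K (z.1 + (z.2.1 + z.2.2)) z.2.1 z.2.2) ^ 2 * f₃ z.1 ^ 2 :=
    hm3.mul (by fun_prop)
  calc ∫⁻ p, trilin μ K f₁ f₂ f₃ p ^ 2 ∂μ
      ≤ ∫⁻ p, ((∫⁻ q, f₁ q ^ 2 ∂μ) * ∫⁻ q, f₂ q ^ 2 ∂μ) *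
          ∫⁻ q₁, ∫⁻ q₂, (K p q₁ q₂ * f₃ (p - q₁ - q₂)) ^ 2 ∂μ ∂μ ∂μ := by
        refine lintegral_mono fun p => ?_
        rw [← lintegral_lintegral_mul_eq h₁ h₂]
        refine le_trans (le_of_eq ?_) (lintegral_lintegral_mul_sq_le (μ := μ)
          (f := fun q₁ q₂ => f₁ q₁ * f₂ q₂) (g := fun q₁ q₂ => K p q₁ q₂ * f₃ (p - q₁ - q₂))
          (by unfold Function.uncurry; fun_prop)
          (hm.comp (f := fun z : G × G => (p, z.1, z.2)) (by fun_prop)))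
        unfold trilin
        congr 1
        refine lintegral_congr fun q₁ => lintegral_congr fun q₂ => ?_
        ring
    _ = ((∫⁻ q, f₁ q ^ 2 ∂μ) * ∫⁻ q, f₂ q ^ 2 ∂μ) *
          ∫⁻ q₁, ∫⁻ q₂, ∫⁻ p, (K p q₁ q₂ * f₃ (p - q₁ - q₂)) ^ 2 ∂μ ∂μ ∂μ := by
        rw [lintegral_const_mul, lintegral_lintegral_lintegral_rotate (hm.pow_const 2)]
        exact hm2.lintegral_prod_right'.lintegral_prod_right'
    _ = ((∫⁻ q, f₁ q ^ 2 ∂μ) * ∫⁻ q, f₂ q ^ 2 ∂μ) *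
          ∫⁻ q₁, ∫⁻ q₂, ∫⁻ q₃, (K (q₃ + (q₁ + q₂)) q₁ q₂) ^ 2 * f₃ q₃ ^ 2 ∂μ ∂μ ∂μ := by
        congr 1
        refine lintegral_congr fun q₁ => lintegral_congr fun q₂ => ?_
        rw [← lintegral_add_right_eq_self _ (q₁ + q₂)]
        refine lintegral_congr fun q₃ => ?_
        rw [mul_pow, sub_sub, add_sub_cancel_right]
    _ = ((∫⁻ q, f₁ q ^ 2 ∂μ) * ∫⁻ q, f₂ q ^ 2 ∂μ) *
          ∫⁻ q₃, (∫⁻ q₁, ∫⁻ q₂, (K (q₃ + (q₁ + q₂)) q₁ q₂) ^ 2 ∂μ ∂μ) * f₃ q₃ ^ 2 ∂μ := by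
        rw [← lintegral_lintegral_lintegral_rotate
          (H := fun q₃ q₁ q₂ => (K (q₃ + (q₁ + q₂)) q₁ q₂) ^ 2 * f₃ q₃ ^ 2) hm4]
        congr 1
        refine lintegral_congr fun q₃ => ?_
        rw [← lintegral_mul_const]
        · refine lintegral_congr fun q₁ => ?_
          rw [lintegral_mul_const]
          exact hm3.comp (f := fun z : G => (q₃, q₁, z)) (by fun_prop)
        · have : Measurable fun z : G × G => (K (q₃ + (z.1 + z.2)) z.1 z.2) ^ 2 :=
            hm3.comp (f := fun z : G × G => (q₃, z.1, z.2)) (by fun_prop)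
          exact this.lintegral_prod_right'
    _ ≤ ((∫⁻ q, f₁ q ^ 2 ∂μ) * ∫⁻ q, f₂ q ^ 2 ∂μ) * ∫⁻ q₃, C * f₃ q₃ ^ 2 ∂μ := by
        gcongr with q₃
        exact hC q₃
    _ = _ := by
        rw [lintegral_const_mul _ (h₃.pow_const 2)]
        ring

variable [μ.IsNegInvariant]

/-- The kernel is grouped with f₁ against f₂f₃. Reflection invariance is needed because q₁ is
integrated inside f₃(p - q₁ - q₂). -/
theorem lintegral_trilin_sq_le_of_first {C : ℝ≥0∞}
    (hK : Measurable fun z : G × G × G => K z.1 z.2.1 z.2.2)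
    (h₁ : Measurable f₁) (h₂ : Measurable f₂) (h₃ : Measurable f₃)
    (hC : ∀ q₁, ∫⁻ p, ∫⁻ q₂, K p q₁ q₂ ^ 2 ∂μ ∂μ ≤ C) :
    ∫⁻ p, trilin μ K f₁ f₂ f₃ p ^ 2 ∂μ ≤
      C * ((∫⁻ q, f₁ q ^ 2 ∂μ) * (∫⁻ q, f₂ q ^ 2 ∂μ) * ∫⁻ q, f₃ q ^ 2 ∂μ) := by
  have hm : Measurable fun z : G × G × G => f₂ z.2.2 * f₃ (z.1 - z.2.1 - z.2.2) :=
    Measurable.mul (by fun_prop) (h₃.comp (by fun_prop))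
  have hm1 : Measurable fun z : G × G × G => K z.1 z.2.1 z.2.2 * f₁ z.2.1 :=
    hK.mul (by fun_prop)
  have hm2 : Measurable fun z : (G × G) × G => (K z.1.1 z.1.2 z.2 * f₁ z.1.2) ^ 2 :=
    (hm1.pow_const 2).comp (f := fun z : (G × G) × G => (z.1.1, z.1.2, z.2)) (by fun_prop)
  have hfirst : ∀ p, ∫⁻ q₁, ∫⁻ q₂, (f₂ q₂ * f₃ (p - q₁ - q₂)) ^ 2 ∂μ ∂μ =
      (∫⁻ q, f₂ q ^ 2 ∂μ) * ∫⁻ q, f₃ q ^ 2 ∂μ := by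
    intro p
    rw [lintegral_lintegral_swap]
    · rw [← lintegral_mul_const _ (h₂.pow_const 2)]
      refine lintegral_congr fun q₂ => ?_
      simp_rw [mul_pow]
      rw [lintegral_const_mul _ (by exact (h₃.comp (by fun_prop)).pow_const 2)]
      congr 1
      have := lintegral_sub_left_eq_self (μ := μ) (fun q => f₃ q ^ 2) (p - q₂)
      simpa only [sub_right_comm] using this
    · exact ((hm.pow_const 2).comp (f := fun z : G × G => (p, z.1, z.2))
        (by fun_prop)).aemeasurable
  calc ∫⁻ p, trilin μ K f₁ f₂ f₃ p ^ 2 ∂μ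
      ≤ ∫⁻ p, ((∫⁻ q, f₂ q ^ 2 ∂μ) * ∫⁻ q, f₃ q ^ 2 ∂μ) *
          ∫⁻ q₁, ∫⁻ q₂, (K p q₁ q₂ * f₁ q₁) ^ 2 ∂μ ∂μ ∂μ := by
        refine lintegral_mono fun p => ?_
        rw [← hfirst p]
        refine le_trans (le_of_eq ?_) (lintegral_lintegral_mul_sq_le (μ := μ)
          (f := fun q₁ q₂ => f₂ q₂ * f₃ (p - q₁ - q₂)) (g := fun q₁ q₂ => K p q₁ q₂ * f₁ q₁)
          (hm.comp (f := fun z : G × G => (p, z.1, z.2)) (by fun_prop))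
          (hm1.comp (f := fun z : G × G => (p, z.1, z.2)) (by fun_prop)))
        unfold trilin
        congr 1
        refine lintegral_congr fun q₁ => lintegral_congr fun q₂ => ?_
        ring
    _ = ((∫⁻ q, f₂ q ^ 2 ∂μ) * ∫⁻ q, f₃ q ^ 2 ∂μ) *
          ∫⁻ q₁, ∫⁻ p, ∫⁻ q₂, (K p q₁ q₂ * f₁ q₁) ^ 2 ∂μ ∂μ ∂μ := by
        rw [lintegral_const_mul, lintegral_lintegral_swap]
        · exact hm2.lintegral_prod_right'.aemeasurable
        · exact hm2.lintegral_prod_right'.lintegral_prod_right'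
    _ = ((∫⁻ q, f₂ q ^ 2 ∂μ) * ∫⁻ q, f₃ q ^ 2 ∂μ) *
          ∫⁻ q₁, (∫⁻ p, ∫⁻ q₂, K p q₁ q₂ ^ 2 ∂μ ∂μ) * f₁ q₁ ^ 2 ∂μ := by
        congr 1
        refine lintegral_congr fun q₁ => ?_
        have hk : Measurable fun z : G × G => K z.1 q₁ z.2 ^ 2 :=
          (hK.pow_const 2).comp (f := fun z : G × G => (z.1, q₁, z.2)) (by fun_prop)
        rw [← lintegral_mul_const _ hk.lintegral_prod_right']
        refine lintegral_congr fun p => ?_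
        simp_rw [mul_pow]
        rw [lintegral_mul_const]
        exact hk.comp (f := fun z : G => (p, z)) (by fun_prop)
    _ ≤ ((∫⁻ q, f₂ q ^ 2 ∂μ) * ∫⁻ q, f₃ q ^ 2 ∂μ) * ∫⁻ q₁, C * f₁ q₁ ^ 2 ∂μ := by
        gcongr with q₁
        exact hC q₁
    _ = _ := by
        rw [lintegral_const_mul _ (h₁.pow_const 2)]
        ring

/-- Grouping A with f₁f₂ and B with f₃ decouples the two factors: A² is integrated at fixed q₁ + q₂,
and B² at fixed p - q₃. It replaces a pair of bilinear L² estimates. -/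
theorem lintegral_trilin_sq_le_of_pairs {A B : G → G → ℝ≥0∞} {C D : ℝ≥0∞}
    (hA : Measurable (Function.uncurry A)) (hB : Measurable (Function.uncurry B))
    (h₁ : Measurable f₁) (h₂ : Measurable f₂) (h₃ : Measurable f₃)
    (hC : ∀ r, ∫⁻ p, A p (p - r) ^ 2 ∂μ ≤ C) (hD : ∀ r, ∫⁻ q, B q (r - q) ^ 2 ∂μ ≤ D) :
    ∫⁻ p, trilin μ (fun p q₁ q₂ => A p (p - q₁ - q₂) * B q₁ q₂) f₁ f₂ f₃ p ^ 2 ∂μ ≤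
      C * D * ((∫⁻ q, f₁ q ^ 2 ∂μ) * (∫⁻ q, f₂ q ^ 2 ∂μ) * ∫⁻ q, f₃ q ^ 2 ∂μ) := by
  have hm : Measurable fun z : G × G × G =>
      A z.1 (z.1 - z.2.1 - z.2.2) * (f₁ z.2.1 * f₂ z.2.2) :=
    (hA.comp (f := fun z : G × G × G => (z.1, z.1 - z.2.1 - z.2.2)) (by fun_prop)).mul
      (by fun_prop)
  have hm1 : Measurable fun z : G × G × G => B z.2.1 z.2.2 * f₃ (z.1 - z.2.1 - z.2.2) :=
    (hB.comp (f := fun z : G × G × G => (z.2.1, z.2.2)) (by fun_prop)).mul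
      (h₃.comp (by fun_prop))
  have hm2 : Measurable fun z : (G × G) × G =>
      (A z.1.1 (z.1.1 - z.1.2 - z.2) * (f₁ z.1.2 * f₂ z.2)) ^ 2 :=
    (hm.pow_const 2).comp (f := fun z : (G × G) × G => (z.1.1, z.1.2, z.2)) (by fun_prop)
  have hsecond : ∀ p, ∫⁻ q₁, ∫⁻ q₂, (B q₁ q₂ * f₃ (p - q₁ - q₂)) ^ 2 ∂μ ∂μ ≤
      D * ∫⁻ q, f₃ q ^ 2 ∂μ := by
    intro p
    calc ∫⁻ q₁, ∫⁻ q₂, (B q₁ q₂ * f₃ (p - q₁ - q₂)) ^ 2 ∂μ ∂μ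
        = ∫⁻ q₁, ∫⁻ q₃, (B q₁ (p - q₃ - q₁) * f₃ q₃) ^ 2 ∂μ ∂μ := by
          refine lintegral_congr fun q₁ => ?_
          rw [← lintegral_sub_left_eq_self _ (p - q₁)]
          refine lintegral_congr fun q₃ => ?_
          rw [sub_sub_cancel, sub_right_comm]
      _ = ∫⁻ q₃, (∫⁻ q₁, B q₁ (p - q₃ - q₁) ^ 2 ∂μ) * f₃ q₃ ^ 2 ∂μ := by
          rw [lintegral_lintegral_swap]
          · refine lintegral_congr fun q₃ => ?_
            simp_rw [mul_pow]
            rw [lintegral_mul_const]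
            exact (hB.comp (f := fun q => (q, p - q₃ - q)) (by fun_prop)).pow_const 2
          · exact (((hB.comp (f := fun z : G × G => (z.1, p - z.2 - z.1)) (by fun_prop)).mul
              (h₃.comp measurable_snd)).pow_const 2).aemeasurable
      _ ≤ ∫⁻ q₃, D * f₃ q₃ ^ 2 ∂μ := by
          gcongr with q₃
          exact hD _
      _ = _ := lintegral_const_mul _ (h₃.pow_const 2)
  calc ∫⁻ p, trilin μ (fun p q₁ q₂ => A p (p - q₁ - q₂) * B q₁ q₂) f₁ f₂ f₃ p ^ 2 ∂μ
      ≤ ∫⁻ p, (∫⁻ q₁, ∫⁻ q₂, (A p (p - q₁ - q₂) * (f₁ q₁ * f₂ q₂)) ^ 2 ∂μ ∂μ) *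
          (D * ∫⁻ q, f₃ q ^ 2 ∂μ) ∂μ := by
        refine lintegral_mono fun p => ?_
        refine le_trans (le_of_eq ?_) ((lintegral_lintegral_mul_sq_le (μ := μ)
          (f := fun q₁ q₂ => A p (p - q₁ - q₂) * (f₁ q₁ * f₂ q₂))
          (g := fun q₁ q₂ => B q₁ q₂ * f₃ (p - q₁ - q₂))
          (hm.comp (f := fun z : G × G => (p, z.1, z.2)) (by fun_prop))
          (hm1.comp (f := fun z : G × G => (p, z.1, z.2)) (by fun_prop))).trans
            (mul_le_mul_right (hsecond p) _))
        unfold trilin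
        congr 1
        refine lintegral_congr fun q₁ => lintegral_congr fun q₂ => ?_
        ring
    _ = (∫⁻ q₁, ∫⁻ q₂, ∫⁻ p, (A p (p - q₁ - q₂) * (f₁ q₁ * f₂ q₂)) ^ 2 ∂μ ∂μ ∂μ) *
          (D * ∫⁻ q, f₃ q ^ 2 ∂μ) := by
        rw [lintegral_mul_const, lintegral_lintegral_lintegral_rotate (hm.pow_const 2)]
        exact hm2.lintegral_prod_right'.lintegral_prod_right'
    _ ≤ (∫⁻ q₁, ∫⁻ q₂, C * (f₁ q₁ * f₂ q₂) ^ 2 ∂μ ∂μ) * (D * ∫⁻ q, f₃ q ^ 2 ∂μ) := by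
        gcongr with q₁ q₂
        simp_rw [mul_pow (A _ _)]
        rw [lintegral_mul_const]
        · gcongr
          simpa only [sub_sub] using hC (q₁ + q₂)
        · exact (hA.comp (f := fun p => (p, p - q₁ - q₂)) (by fun_prop)).pow_const 2
    _ = _ := by
        have : ∫⁻ q₁, ∫⁻ q₂, C * (f₁ q₁ * f₂ q₂) ^ 2 ∂μ ∂μ =
            C * ∫⁻ q₁, ∫⁻ q₂, (f₁ q₁ * f₂ q₂) ^ 2 ∂μ ∂μ := by
          have hf : Measurable fun z : G × G => (f₁ z.1 * f₂ z.2) ^ 2 := by fun_prop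
          rw [← lintegral_const_mul _ hf.lintegral_prod_right']
          refine lintegral_congr fun q₁ => ?_
          rw [lintegral_const_mul]
          exact (h₂.const_mul _).pow_const 2
        rw [this, lintegral_lintegral_mul_eq h₁ h₂]
        ring

end Trilinear

/-! ### Integration over frequency space. -/

/-- The measure on frequency space `ℝ × ℤ`. -/
noncomputable abbrev freqMeasure : Measure (ℝ × ℤ) := (volume : Measure ℝ).prod Measure.count

instance : freqMeasure.IsNegInvariant where
  neg_eq_self := by
    have h := Measure.map_prod_map (volume : Measure ℝ) (Measure.count : Measure ℤ)
      measurable_neg measurable_neg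
    rw [Measure.map_neg_eq_self, Measure.map_neg_eq_self] at h
    exact h.symm

theorem lintegral_freqMeasure {f : ℝ × ℤ → ℝ≥0∞} (hf : Measurable f) :
    ∫⁻ q, f q ∂freqMeasure = ∑' ξ : ℤ, ∫⁻ τ : ℝ, f (τ, ξ) := by
  rw [lintegral_prod_symm _ hf.aemeasurable, lintegral_count]

theorem decay_sq (p y : ℝ) : decay p y ^ 2 = decay (2 * p) y := by
  rw [sq, decay_mul_decay, two_mul]

theorem lintegral_lintegral_freqMeasure {H : ℝ × ℤ → ℝ × ℤ → ℝ≥0∞}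
    (hH : Measurable (Function.uncurry H)) :
    ∫⁻ p, ∫⁻ q, H p q ∂freqMeasure ∂freqMeasure =
      ∑' ξ : ℤ, ∑' η : ℤ, ∫⁻ τ : ℝ, ∫⁻ σ : ℝ, H (τ, ξ) (σ, η) := by
  have h1 : Measurable fun p => ∫⁻ q, H p q ∂freqMeasure := hH.lintegral_prod_right'
  rw [lintegral_freqMeasure h1]
  refine tsum_congr fun ξ => ?_
  have h2 : ∀ τ : ℝ, ∫⁻ q, H (τ, ξ) q ∂freqMeasure = ∑' η : ℤ, ∫⁻ σ : ℝ, H (τ, ξ) (σ, η) :=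
    fun τ => lintegral_freqMeasure (hH.comp (f := fun q => ((τ, ξ), q)) (by fun_prop))
  simp_rw [h2]
  rw [lintegral_tsum]
  intro η
  have h3 : Measurable fun z : ℝ × ℝ => H (z.1, ξ) (z.2, η) :=
    hH.comp (f := fun z : ℝ × ℝ => ((z.1, ξ), (z.2, η))) (by fun_prop)
  exact h3.lintegral_prod_right'.aemeasurable

theorem exists_lintegral_lintegral_decay_sub_le :
    ∃ C : ℝ≥0, ∀ a b c : ℝ,
      ∫⁻ x, ∫⁻ y, decay (31 / 32) (x - a) * decay (31 / 32) (y - b) * decay (31 / 32) (x - y - c)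
        ≤ C * decay (5 / 8) (a - b - c) := by
  obtain ⟨C, hC⟩ := exists_lintegral_lintegral_decay_le
  refine ⟨C, fun a b c => ?_⟩
  refine le_trans (le_of_eq ?_) ((hC a (-b) c).trans (le_of_eq ?_))
  · refine lintegral_congr fun x => ?_
    rw [← lintegral_neg_eq_self]
    refine lintegral_congr fun y => ?_
    rw [← decay_neg _ (-y - b)]
    congr 2
    · congr 1; ring
    · congr 1; ring
  · rw [← sub_eq_add_neg]

/-! ### Lattice sums over the resonance function 2(k - m)(k - n). -/

/-- Moving a power 9/32 from the larger of ⟨m⟩, ⟨n⟩ to the smaller gives exponents 9/8 and 9/16. For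
fixed m ≠ k the resonance is linear in n with slope at least 2 in size, so 9/16 + 5/8 > 1 sums n,
and 9/8 > 1 sums m. -/
theorem exists_tsum_tsum_decay_product_le :
    ∃ C : ℝ≥0, ∀ (μ : ℝ) (k : ℤ), ∑' m : ℤ, ∑' n : ℤ,
      (if k ≠ m ∧ k ≠ n then decay (27 / 32) m * decay (27 / 32) n *
        decay (5 / 8) (μ + 2 * (k - m) * (k - n)) else 0) ≤ C := by
  obtain ⟨C₁, h₁⟩ := exists_tsum_decay_linear_le (p := 19 / 16) (by norm_num)
  obtain ⟨C₂, h₂⟩ := exists_tsum_decay_le (p := 9 / 8) (by norm_num)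
  have hlin : ∀ (μ : ℝ) (k m : ℤ), k ≠ m →
      ∑' n : ℤ, decay (9 / 16) n * decay (5 / 8) (μ + 2 * (k - m) * (k - n)) ≤ C₁ + C₁ := by
    intro μ k m hkm
    calc ∑' n : ℤ, decay (9 / 16) n * decay (5 / 8) (μ + 2 * (k - m) * (k - n))
        ≤ ∑' n : ℤ, (decay (19 / 16) (1 * n + 0) +
            decay (19 / 16) ((-(2 * ((k : ℝ) - m))) * n + (μ + 2 * (k - m) * k))) := by
          refine ENNReal.tsum_le_tsum fun n => ?_
          refine (decay_mul_le_add (by norm_num) (by norm_num) _ _).trans (le_of_eq ?_)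
          congr 2
          · norm_num
          · ring
          · norm_num
          · ring
      _ ≤ C₁ + C₁ := by
          rw [ENNReal.tsum_add]
          gcongr
          · exact h₁ _ _ (by norm_num)
          · refine h₁ _ _ ?_
            rw [abs_neg, abs_mul, ← Int.cast_sub, ← Int.cast_abs]
            have : (1 : ℝ) ≤ ((|k - m| : ℤ) : ℝ) := by
              exact_mod_cast Int.one_le_abs (sub_ne_zero.mpr hkm)
            rw [abs_of_pos two_pos]
            linarith
  have hhalf : ∀ (μ : ℝ) (k : ℤ), ∑' m : ℤ, ∑' n : ℤ,
      (if k ≠ m then decay (9 / 8) m * (decay (9 / 16) n *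
        decay (5 / 8) (μ + 2 * (k - m) * (k - n))) else 0) ≤ C₂ * (C₁ + C₁) := by
    intro μ k
    calc _ ≤ ∑' m : ℤ, decay (9 / 8) (m - 0) * (C₁ + C₁) := by
          refine ENNReal.tsum_le_tsum fun m => ?_
          by_cases h : k = m
          · simp [h]
          · simp only [ne_eq, h, not_false_eq_true, if_true, ENNReal.tsum_mul_left, sub_zero]
            gcongr
            exact hlin μ k m h
      _ ≤ _ := by
          rw [ENNReal.tsum_mul_right]
          gcongr
          exact h₂ 0
  have hsplit : ∀ x y : ℝ, decay (27 / 32) x * decay (27 / 32) y ≤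
      decay (9 / 8) x * decay (9 / 16) y + decay (9 / 8) y * decay (9 / 16) x := by
    have : ∀ x y : ℝ, bracket x ≤ bracket y → decay (27 / 32) x * decay (27 / 32) y ≤
        decay (9 / 8) x * decay (9 / 16) y := by
      intro x y h
      calc decay (27 / 32) x * decay (27 / 32) y
          = decay (27 / 32) x * (decay (9 / 32) y * decay (9 / 16) y) := by
            rw [decay_mul_decay]; norm_num
        _ ≤ decay (27 / 32) x * (decay (9 / 32) x * decay (9 / 16) y) := by
            gcongr; exact decay_le_of_bracket_le (by norm_num) h
        _ = _ := by rw [← mul_assoc, decay_mul_decay]; norm_num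
    intro x y
    rcases le_total (bracket x) (bracket y) with h | h
    · exact (this x y h).trans le_self_add
    · rw [mul_comm]
      exact (this y x h).trans le_add_self
  refine ⟨C₂ * (C₁ + C₁) + C₂ * (C₁ + C₁), fun μ k => ?_⟩
  calc _ ≤ ∑' m : ℤ, ∑' n : ℤ,
      ((if k ≠ m then decay (9 / 8) m * (decay (9 / 16) n *
        decay (5 / 8) (μ + 2 * (k - m) * (k - n))) else 0) +
      (if k ≠ n then decay (9 / 8) n * (decay (9 / 16) m *
        decay (5 / 8) (μ + 2 * (k - n) * (k - m))) else 0)) := by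
        refine ENNReal.tsum_le_tsum fun m => ENNReal.tsum_le_tsum fun n => ?_
        by_cases h : k ≠ m ∧ k ≠ n
        · rw [if_pos h, if_pos h.1, if_pos h.2, ← mul_assoc, ← mul_assoc,
            show μ + 2 * ((k : ℝ) - n) * (k - m) = μ + 2 * (k - m) * (k - n) by ring, ← add_mul]
          gcongr
          exact hsplit _ _
        · rw [if_neg h]; exact zero_le
    _ ≤ _ := by
        simp_rw [ENNReal.tsum_add]
        push_cast
        gcongr
        · exact_mod_cast hhalf μ k
        · rw [ENNReal.tsum_comm]
          exact_mod_cast hhalf μ k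

/-- The condition forces |m| to lie within 1 of √ν (read as 0 for negative ν), so boundedly many m
qualify. They are counted with ⟨·⟩^{-2}, which is at least 1/2 on [-1, 1]. -/
theorem exists_tsum_indicator_sq_sub_le :
    ∃ C : ℝ≥0, ∀ ν : ℝ, ∑' m : ℤ, (if |(m : ℝ) ^ 2 - ν| ≤ |(m : ℝ)| then (1 : ℝ≥0∞) else 0) ≤ C := by
  obtain ⟨C, hC⟩ := exists_tsum_decay_le (p := 2) (by norm_num)
  refine ⟨2 * (C + C), fun ν => ?_⟩
  calc ∑' m : ℤ, (if |(m : ℝ) ^ 2 - ν| ≤ |(m : ℝ)| then (1 : ℝ≥0∞) else 0)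
      ≤ ∑' m : ℤ, 2 * (decay 2 (m - Real.sqrt ν) + decay 2 (m - -Real.sqrt ν)) := by
        refine ENNReal.tsum_le_tsum fun m => ?_
        split_ifs with h
        swap
        · exact zero_le
        have hone : ∀ y : ℝ, |y| ≤ 1 → 1 ≤ 2 * decay 2 y := by
          intro y hy
          have h1 : bracket y ^ (-2 : ℝ) = (1 + y ^ 2)⁻¹ := by
            rw [Real.rpow_neg (bracket_pos y).le, ← bracket_sq]; norm_cast
          have h2 : y ^ 2 ≤ 1 := by rw [← sq_abs]; nlinarith [abs_nonneg y]
          unfold decay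
          rw [h1, show (2 : ℝ≥0∞) = ENNReal.ofReal 2 by simp, ← ENNReal.ofReal_mul two_pos.le,
            ENNReal.one_le_ofReal, ← div_eq_mul_inv, le_div_iff₀ (by positivity)]
          linarith
        have habs : |(|(m : ℝ)| - Real.sqrt ν)| ≤ 1 := by
          rcases le_total 0 ν with hν | hν
          · have h3 : (m : ℝ) ^ 2 - ν = (|(m : ℝ)| - Real.sqrt ν) * (|(m : ℝ)| + Real.sqrt ν) := by
              nth_rewrite 1 [← Real.sq_sqrt hν]; rw [← sq_abs]; ring
            have h4 := Real.sqrt_nonneg ν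
            rw [h3, abs_mul, abs_of_nonneg (a := |(m : ℝ)| + Real.sqrt ν) (by positivity)] at h
            by_contra hlt
            push Not at hlt
            rcases (abs_nonneg (m : ℝ)).eq_or_lt with h0 | h0
            · rw [← h0] at h hlt
              simp only [zero_sub, abs_neg, zero_add] at h hlt
              rw [abs_of_nonneg h4] at h hlt
              nlinarith
            · nlinarith [mul_lt_mul_of_pos_right hlt h0, abs_nonneg (|(m : ℝ)| - Real.sqrt ν)]
          · rw [Real.sqrt_eq_zero_of_nonpos hν, sub_zero, abs_abs]
            rw [abs_of_nonneg (by nlinarith [sq_nonneg (m : ℝ)]), ← sq_abs] at h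
            by_contra hlt
            push Not at hlt
            nlinarith
        rw [mul_add]
        rcases le_total 0 (m : ℝ) with hm | hm
        · rw [abs_of_nonneg hm] at habs
          exact (hone _ habs).trans le_self_add
        · rw [abs_of_nonpos hm] at habs
          refine (hone (m - -Real.sqrt ν) ?_).trans le_add_self
          rw [← abs_neg]
          convert habs using 2; ring
    _ = 2 * (∑' m : ℤ, decay 2 (m - Real.sqrt ν) + ∑' m : ℤ, decay 2 (m - -Real.sqrt ν)) := by
        rw [ENNReal.tsum_mul_left, ENNReal.tsum_add]
    _ ≤ _ := by
        push_cast
        gcongr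
        · exact hC _
        · exact hC _

/-- Comparatively small input frequencies `m`, `n` for the output frequency `k`. -/
def IsSmallPair (k m n : ℤ) : Prop := 16 * (bracket m * bracket n) ^ 2 ≤ bracket k

/-- The square in `IsSmallPair` makes ⟨k⟩ large enough to absorb (m - n)² and not only m and n. This
is what confines 2k - m - n in the near-resonant case of the next sum. -/
theorem IsSmallPair.sq_sub_le {k m n : ℤ} (h : IsSmallPair k m n) :
    ((m : ℝ) - n) ^ 2 + 2 * bracket n ≤ |2 * (k : ℝ) - m - n| := by
  unfold IsSmallPair at h
  have hm := one_le_bracket m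
  have hn := one_le_bracket n
  have hmm := abs_le_bracket (m : ℝ)
  have hnn := abs_le_bracket (n : ℝ)
  have hk := bracket_le_one_add_abs (k : ℝ)
  have e1 : bracket m ≤ bracket m * bracket n := le_mul_of_one_le_right (by linarith) hn
  have e2 : bracket n ≤ bracket m * bracket n := le_mul_of_one_le_left (by linarith) hm
  set x := bracket m * bracket n
  have hx : 1 ≤ x := by linarith
  have e3 : ((m : ℝ) - n) ^ 2 ≤ 4 * x ^ 2 := by
    rw [← sq_abs, show 4 * x ^ 2 = (2 * x) ^ 2 by ring]
    exact pow_le_pow_left₀ (abs_nonneg _) (by linarith [abs_sub (m : ℝ) n]) 2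
  have e4 : |2 * (k : ℝ)| ≤ |2 * (k : ℝ) - m - n| + (|(m : ℝ)| + |(n : ℝ)|) := by
    calc |2 * (k : ℝ)| = |(2 * (k : ℝ) - m - n) + (m + n)| := by congr 1; ring
      _ ≤ _ := (abs_add_le _ _).trans (by gcongr; exact abs_add_le _ _)
  rw [abs_mul, abs_of_pos (two_pos : (0 : ℝ) < 2)] at e4
  nlinarith

-- The weight ⟨n⟩^{-1} just fails to be summable. If the resonant factor is at least ⟨n⟩, a power
-- 1/16 of it repairs the sum over n, and k is summed through a quadratic. Otherwise put j = 2k - m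
-- - n; since 4(k - m)(k - n) = j² - (m - n)², the value j² is so close to -2μ that boundedly many j
-- remain, and n is summed through a quadratic.
open Classical in
theorem exists_tsum_tsum_smallPair_le :
    ∃ C : ℝ≥0, ∀ (μ : ℝ) (m : ℤ), ∑' k : ℤ, ∑' n : ℤ,
      (if IsSmallPair k m n then decay 1 n * decay (5 / 8) (μ + 2 * (k - m) * (k - n)) else 0)
        ≤ C := by
  obtain ⟨C₁, h₁⟩ := exists_tsum_decay_quadratic_le (p := 9 / 16) (by norm_num)
  obtain ⟨C₂, h₂⟩ := exists_tsum_decay_le (p := 17 / 16) (by norm_num)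
  obtain ⟨C₃, h₃⟩ := exists_tsum_indicator_sq_sub_le
  refine ⟨C₂ * (2 * C₁) + C₃ * (2 * C₁), fun μ m => ?_⟩
  have hdouble : ∀ y : ℝ, decay (9 / 16) (2 * y) ≤ decay (9 / 16) y := fun y =>
    decay_le_of_abs_le (by norm_num) (by
      rw [abs_mul, abs_of_pos (two_pos : (0 : ℝ) < 2)]; linarith [abs_nonneg y])
  have hhalf : ∀ y : ℝ, decay (9 / 16) (y / 2) ≤ 2 * decay (9 / 16) y := fun y => by
    refine (decay_le_mul_of_bracket_le (p := 9 / 16) (by norm_num) two_pos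
      (x := y) (y := y / 2) ?_).trans ?_
    · have := bracket_add_le (y / 2) (y / 2)
      rw [add_halves] at this; linarith
    · gcongr
      rw [show (2 : ℝ≥0∞) = ENNReal.ofReal (2 ^ (1 : ℝ)) by simp]
      exact ENNReal.ofReal_le_ofReal
        (Real.rpow_le_rpow_of_exponent_le (by norm_num) (by norm_num))
  -- The two summands correspond to the two alternatives; the exponent 5/8 = 1/16 + 9/16 leaves 9/16
  -- > 1/2 for the quadratic sums.
  have hpt : ∀ k n : ℤ,
      (if IsSmallPair k m n then decay 1 n * decay (5 / 8) (μ + 2 * (k - m) * (k - n)) else 0) ≤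
        decay (17 / 16) (n - 0) * decay (9 / 16) (μ + 2 * (k - m) * (k - n)) +
        (if |((2 * k - m - n : ℤ) : ℝ) ^ 2 - (-(2 * μ))| ≤ |((2 * k - m - n : ℤ) : ℝ)|
          then (1 : ℝ≥0∞) else 0) *
          decay (9 / 16) ((2 * μ + ((2 * k - m - n : ℤ) : ℝ) ^ 2 - (m - n) ^ 2) / 2) := by
    intro k n
    split_ifs with hS hind hind
    · have : (2 * μ + ((2 * k - m - n : ℤ) : ℝ) ^ 2 - (m - n) ^ 2) / 2 =
          μ + 2 * (k - m) * (k - n) := by push_cast; ring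
      rw [this, one_mul]
      refine le_trans ?_ le_add_self
      calc _ ≤ 1 * decay (9 / 16) (μ + 2 * (k - m) * (k - n)) := by
            gcongr
            · exact decay_le_one zero_le_one _
            · exact decay_le_decay_exponent (by norm_num) _
        _ = _ := one_mul _
    · refine le_trans ?_ le_self_add
      have hbig : bracket n ≤ bracket (μ + 2 * (k - m) * (k - n)) := by
        refine le_trans ?_ (abs_le_bracket _)
        by_contra hlt
        push Not at hlt
        refine hind ?_
        have e := hS.sq_sub_le
        have e2 : ((2 * k - m - n : ℤ) : ℝ) ^ 2 - (-(2 * μ)) =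
            2 * (μ + 2 * (k - m) * (k - n)) + (m - n) ^ 2 := by push_cast; ring
        rw [e2]
        refine (abs_add_le _ _).trans ?_
        rw [abs_mul, abs_of_pos (two_pos : (0 : ℝ) < 2), abs_of_nonneg (sq_nonneg ((m : ℝ) - n))]
        push_cast
        linarith
      rw [sub_zero]
      calc decay 1 n * decay (5 / 8) (μ + 2 * (k - m) * (k - n))
          = decay 1 n * (decay (1 / 16) (μ + 2 * (k - m) * (k - n)) *
              decay (9 / 16) (μ + 2 * (k - m) * (k - n))) := by
            rw [decay_mul_decay]; norm_num
        _ ≤ decay 1 n * (decay (1 / 16) n * decay (9 / 16) (μ + 2 * (k - m) * (k - n))) := by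
            gcongr; exact decay_le_of_bracket_le (by norm_num) hbig
        _ = _ := by rw [← mul_assoc, decay_mul_decay]; norm_num
    · exact zero_le
    · exact zero_le
  refine (ENNReal.tsum_le_tsum fun k => ENNReal.tsum_le_tsum fun n => hpt k n).trans ?_
  simp_rw [ENNReal.tsum_add]
  simp only [ENNReal.coe_add, ENNReal.coe_mul, ENNReal.coe_ofNat]
  gcongr
  · rw [ENNReal.tsum_comm]
    simp_rw [ENNReal.tsum_mul_left]
    calc _ ≤ ∑' n : ℤ, decay (17 / 16) (n - 0) * (2 * C₁) := by
          gcongr with n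
          calc ∑' k : ℤ, decay (9 / 16) (μ + 2 * (k - m) * (k - n))
              ≤ ∑' k : ℤ, 2 * decay (9 / 16)
                  ((k : ℝ) ^ 2 + (-(m + n)) * k + (m * n + μ / 2)) := by
                refine ENNReal.tsum_le_tsum fun k => ?_
                refine le_trans (le_of_eq ?_) ((hdouble _).trans le_self_add |>.trans
                  (le_of_eq (two_mul _).symm))
                congr 1; ring
            _ ≤ 2 * C₁ := by
                rw [ENNReal.tsum_mul_left]
                gcongr
                exact h₁ _ _
      _ ≤ _ := by
          rw [ENNReal.tsum_mul_right]
          gcongr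
          exact h₂ 0
  · rw [ENNReal.tsum_comm]
    calc _ ≤ ∑' n : ℤ, ∑' l : ℤ,
          (if |((l : ℤ) : ℝ) ^ 2 - (-(2 * μ))| ≤ |((l : ℤ) : ℝ)| then (1 : ℝ≥0∞) else 0) *
          decay (9 / 16) ((2 * μ + (l : ℝ) ^ 2 - (m - n) ^ 2) / 2) := by
          refine ENNReal.tsum_le_tsum fun n => ?_
          -- For fixed n the new variable determines k, so the parity constraint may be dropped and
          -- the sum taken over all integers.
          have hinj : Function.Injective fun k : ℤ => 2 * k - m - n := fun a b hab => by
            simp only at hab; omega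
          exact ENNReal.tsum_comp_le_tsum_of_injective hinj fun l : ℤ =>
            (if |((l : ℤ) : ℝ) ^ 2 - (-(2 * μ))| ≤ |((l : ℤ) : ℝ)| then (1 : ℝ≥0∞) else 0) *
            decay (9 / 16) ((2 * μ + (l : ℝ) ^ 2 - (m - n) ^ 2) / 2)
      _ = ∑' l : ℤ,
          (if |((l : ℤ) : ℝ) ^ 2 - (-(2 * μ))| ≤ |((l : ℤ) : ℝ)| then (1 : ℝ≥0∞) else 0) *
          ∑' n : ℤ, decay (9 / 16) ((2 * μ + (l : ℝ) ^ 2 - (m - n) ^ 2) / 2) := by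
          rw [ENNReal.tsum_comm]
          simp_rw [ENNReal.tsum_mul_left]
      _ ≤ ∑' l : ℤ,
          (if |((l : ℤ) : ℝ) ^ 2 - (-(2 * μ))| ≤ |((l : ℤ) : ℝ)| then (1 : ℝ≥0∞) else 0) *
          (2 * C₁) := by
          gcongr with l
          calc _ ≤ ∑' n : ℤ, 2 * decay (9 / 16)
                ((n : ℝ) ^ 2 + (-2 * m) * n + (m ^ 2 - 2 * μ - l ^ 2)) := by
                refine ENNReal.tsum_le_tsum fun n => (hhalf _).trans (le_of_eq ?_)
                rw [← decay_neg]
                congr 2; ring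
            _ ≤ _ := by
                rw [ENNReal.tsum_mul_left]
                gcongr
                exact h₁ _ _
      _ ≤ _ := by
          rw [ENNReal.tsum_mul_right]
          gcongr
          exact h₃ _

/-! ### Modulations and the L² bounds for the five kernels. -/

/-- The modulation `τ + ξ²`. -/
def modP (q : ℝ × ℤ) : ℝ := q.1 + (q.2 : ℝ) ^ 2

/-- The modulation `τ - ξ²`. -/
def modM (q : ℝ × ℤ) : ℝ := q.1 - (q.2 : ℝ) ^ 2

theorem measurable_freq : Measurable fun q : ℝ × ℤ => (q.2 : ℝ) :=
  (measurable_of_countable fun n : ℤ => (n : ℝ)).comp measurable_snd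

theorem measurable_modP : Measurable modP := measurable_fst.add (measurable_freq.pow_const 2)

theorem measurable_modM : Measurable modM := measurable_fst.sub (measurable_freq.pow_const 2)

theorem measurable_decay_modP (p : ℝ) : Measurable fun q => decay p (modP q) :=
  (measurable_decay p).comp measurable_modP

theorem measurable_decay_modM (p : ℝ) : Measurable fun q => decay p (modM q) :=
  (measurable_decay p).comp measurable_modM

theorem measurable_decay_freq (p : ℝ) : Measurable fun q : ℝ × ℤ => decay p q.2 :=
  (measurable_decay p).comp measurable_freq

/-- The kernel `K` defines a bounded trilinear operator on `L²`. -/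
def IsL2Kernel (K : ℝ × ℤ → ℝ × ℤ → ℝ × ℤ → ℝ≥0∞) : Prop :=
  (Measurable fun z : (ℝ × ℤ) × (ℝ × ℤ) × (ℝ × ℤ) => K z.1 z.2.1 z.2.2) ∧
  ∃ C : ℝ≥0, ∀ f₁ f₂ f₃ : ℝ × ℤ → ℝ≥0∞, Measurable f₁ → Measurable f₂ → Measurable f₃ →
    ∫⁻ p, trilin freqMeasure K f₁ f₂ f₃ p ^ 2 ∂freqMeasure ≤
      C * ((∫⁻ q, f₁ q ^ 2 ∂freqMeasure) * (∫⁻ q, f₂ q ^ 2 ∂freqMeasure) *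
        ∫⁻ q, f₃ q ^ 2 ∂freqMeasure)

theorem IsL2Kernel.swap {K : ℝ × ℤ → ℝ × ℤ → ℝ × ℤ → ℝ≥0∞} (h : IsL2Kernel K) :
    IsL2Kernel fun p q₁ q₂ => K p q₂ q₁ := by
  obtain ⟨hK, C, hC⟩ := h
  have hK' : Measurable fun z : (ℝ × ℤ) × (ℝ × ℤ) × (ℝ × ℤ) => K z.1 z.2.2 z.2.1 :=
    hK.comp (f := fun z : (ℝ × ℤ) × (ℝ × ℤ) × (ℝ × ℤ) => (z.1, z.2.2, z.2.1)) (by fun_prop)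
  refine ⟨hK', C, fun f₁ f₂ f₃ h₁ h₂ h₃ => ?_⟩
  refine le_trans (le_of_eq ?_) ((hC f₂ f₁ f₃ h₂ h₁ h₃).trans (le_of_eq ?_))
  · refine lintegral_congr fun p => ?_
    rw [trilin_swap hK' h₁ h₂ h₃]
  · ring

/-- The factor of a kernel coupling the output with the third input. -/
noncomputable def outThird (p q₃ : ℝ × ℤ) : ℝ≥0∞ :=
  decay (31 / 64) (modP p) * decay (31 / 64) (modM q₃)

theorem measurable_outThird : Measurable (Function.uncurry outThird) :=
  ((measurable_decay_modP _).comp measurable_fst).mul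
    ((measurable_decay_modM _).comp measurable_snd)

/-- Integrating out x leaves ⟨2Q(n)⟩^{-5/8} with Q a monic quadratic, and 5/8 > 1/2. This is the
counting behind the periodic L⁴ Strichartz estimate; it serves both the pair (output, third input)
and the pair (first input, second input). -/
theorem exists_lintegral_tsum_quadratic_le :
    ∃ C : ℝ≥0, ∀ (l : ℝ) (m : ℤ), ∑' n : ℤ, ∫⁻ x : ℝ,
      decay (31 / 32) (x - -(n : ℝ) ^ 2) * decay (31 / 32) (x - (l + ((m - n : ℤ) : ℝ) ^ 2)) ≤ C := by
  obtain ⟨C, hC⟩ := exists_lintegral_decay_mul_decay_le (α := 31 / 32) (β := 31 / 32)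
    (γ := 5 / 8) (by norm_num) (by norm_num) (by norm_num) (by norm_num)
  obtain ⟨D, hD⟩ := exists_tsum_decay_quadratic_le (p := 5 / 8) (by norm_num)
  refine ⟨C * D, fun l m => ?_⟩
  calc _ ≤ ∑' n : ℤ, C * decay (5 / 8) ((n : ℝ) ^ 2 + (-m) * n + (m ^ 2 + l) / 2) := by
        refine ENNReal.tsum_le_tsum fun n => (hC _ _).trans ?_
        gcongr
        refine decay_le_of_abs_le (by norm_num) ?_
        have : -(n : ℝ) ^ 2 - (l + ((m - n : ℤ) : ℝ) ^ 2) =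
            -(2 * ((n : ℝ) ^ 2 + (-m) * n + (m ^ 2 + l) / 2)) := by push_cast; ring
        rw [this, abs_neg, abs_mul, abs_of_pos (two_pos : (0 : ℝ) < 2)]
        linarith [abs_nonneg ((n : ℝ) ^ 2 + (-m) * n + (m ^ 2 + l) / 2)]
    _ ≤ _ := by
        rw [ENNReal.tsum_mul_left]
        push_cast
        gcongr
        exact hD _ _

theorem exists_lintegral_outThird_le :
    ∃ C : ℝ≥0, ∀ r : ℝ × ℤ, ∫⁻ p, outThird p (p - r) ^ 2 ∂freqMeasure ≤ C := by
  obtain ⟨C, hC⟩ := exists_lintegral_tsum_quadratic_le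
  refine ⟨C, fun r => ?_⟩
  rw [lintegral_freqMeasure (by
    exact (measurable_outThird.comp (f := fun p => (p, p - r)) (by fun_prop)).pow_const 2)]
  refine le_trans (le_of_eq ?_) (hC r.1 r.2)
  refine tsum_congr fun n => lintegral_congr fun x => ?_
  simp only [outThird, mul_pow, decay_sq, modP, modM, Prod.fst_sub, Prod.snd_sub]
  push_cast
  congr 2
  · norm_num
  · ring
  · norm_num
  · ring

/-- The kernel in the range where the derivative falls on comparatively low frequencies. -/
noncomputable def kerLow (p q₁ q₂ : ℝ × ℤ) : ℝ≥0∞ :=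
  outThird p (p - q₁ - q₂) * (decay (31 / 64) (modP q₁) * decay (31 / 64) (modP q₂))

theorem isL2Kernel_kerLow : IsL2Kernel kerLow := by
  obtain ⟨C, hC⟩ := exists_lintegral_outThird_le
  obtain ⟨D, hD⟩ := exists_lintegral_tsum_quadratic_le
  have hB : Measurable (Function.uncurry fun q₁ q₂ : ℝ × ℤ =>
      decay (31 / 64) (modP q₁) * decay (31 / 64) (modP q₂)) :=
    ((measurable_decay_modP _).comp measurable_fst).mul
      ((measurable_decay_modP _).comp measurable_snd)
  refine ⟨?_, C * D, fun f₁ f₂ f₃ h₁ h₂ h₃ => ?_⟩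
  · exact (measurable_outThird.comp
      (f := fun z : (ℝ × ℤ) × (ℝ × ℤ) × (ℝ × ℤ) => (z.1, z.1 - z.2.1 - z.2.2)) (by fun_prop)).mul
      (hB.comp (f := fun z : (ℝ × ℤ) × (ℝ × ℤ) × (ℝ × ℤ) => (z.2.1, z.2.2)) (by fun_prop))
  · rw [ENNReal.coe_mul]
    refine lintegral_trilin_sq_le_of_pairs measurable_outThird hB h₁ h₂ h₃ hC fun r => ?_
    rw [lintegral_freqMeasure (by
      exact (hB.comp (f := fun q => (q, r - q)) (by fun_prop)).pow_const 2)]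
    refine le_trans (le_of_eq ?_) (hD r.1 r.2)
    refine tsum_congr fun n => lintegral_congr fun x => ?_
    simp only [mul_pow, decay_sq, modP, Prod.fst_sub, Prod.snd_sub]
    rw [← decay_neg _ (r.1 - x + _)]
    congr 2
    · norm_num
    · ring
    · norm_num
    · push_cast; ring

/-- The kernel in the range where the first modulation dominates and the first two frequencies are
comparatively large. -/
noncomputable def kerFirst (p q₁ q₂ : ℝ × ℤ) : ℝ≥0∞ :=
  outThird p (p - q₁ - q₂) *
    (decay (11 / 32) q₁.2 * decay (11 / 32) q₂.2 * decay (33 / 64) (modP q₂))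

/-- At fixed q₁ + q₂ the modulation of q₂ alone gives an integrable 33/32 in time frequency, and the
space frequencies contribute 11/16 + 11/16 > 1. No decay in the first modulation is used. -/
theorem isL2Kernel_kerFirst : IsL2Kernel kerFirst := by
  obtain ⟨C, hC⟩ := exists_lintegral_outThird_le
  obtain ⟨D, hD⟩ := exists_lintegral_decay_le (p := 33 / 32) (by norm_num)
  obtain ⟨E, hE⟩ := exists_tsum_decay_le (p := 11 / 8) (by norm_num)
  have hB : Measurable (Function.uncurry fun q₁ q₂ : ℝ × ℤ =>
      decay (11 / 32) q₁.2 * decay (11 / 32) q₂.2 * decay (33 / 64) (modP q₂)) :=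
    (((measurable_decay_freq _).comp measurable_fst).mul
      ((measurable_decay_freq _).comp measurable_snd)).mul
      ((measurable_decay_modP _).comp measurable_snd)
  refine ⟨?_, C * ((E + E) * D), fun f₁ f₂ f₃ h₁ h₂ h₃ => ?_⟩
  · exact (measurable_outThird.comp
      (f := fun z : (ℝ × ℤ) × (ℝ × ℤ) × (ℝ × ℤ) => (z.1, z.1 - z.2.1 - z.2.2)) (by fun_prop)).mul
      (hB.comp (f := fun z : (ℝ × ℤ) × (ℝ × ℤ) × (ℝ × ℤ) => (z.2.1, z.2.2)) (by fun_prop))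
  · rw [ENNReal.coe_mul]
    refine lintegral_trilin_sq_le_of_pairs measurable_outThird hB h₁ h₂ h₃ hC fun r => ?_
    rw [lintegral_freqMeasure (by
      exact (hB.comp (f := fun q => (q, r - q)) (by fun_prop)).pow_const 2)]
    calc _ = ∑' n : ℤ, (decay (11 / 16) n * decay (11 / 16) ((r.2 - n : ℤ) : ℝ)) *
          ∫⁻ x : ℝ, decay (33 / 32) (x - (r.1 + ((r.2 - n : ℤ) : ℝ) ^ 2)) := by
          refine tsum_congr fun n => ?_
          rw [← lintegral_const_mul _ (by exact (measurable_decay _).comp (by fun_prop))]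
          refine lintegral_congr fun x => ?_
          simp only [mul_pow, decay_sq, modP, Prod.fst_sub, Prod.snd_sub]
          rw [← decay_neg _ (r.1 - x + _)]
          ring_nf
      _ ≤ ∑' n : ℤ, (decay (11 / 8) (n - 0) + decay (11 / 8) (n - (r.2 : ℝ))) * D := by
          refine ENNReal.tsum_le_tsum fun n => ?_
          gcongr
          · refine (decay_mul_le_add (by norm_num) (by norm_num) _ _).trans (le_of_eq ?_)
            rw [sub_zero, decay_sub_comm _ (n : ℝ)]
            push_cast
            norm_num
          · exact hD _
      _ ≤ _ := by
          rw [ENNReal.tsum_mul_right, ENNReal.tsum_add]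
          push_cast
          gcongr
          · exact hE _
          · exact hE _

theorem measurable_three_freq (χ : ℤ → ℤ → ℤ → Prop) [∀ k m n, Decidable (χ k m n)]
    {H : (ℝ × ℤ) × (ℝ × ℤ) × (ℝ × ℤ) → ℝ≥0∞} (hH : Measurable H) :
    Measurable fun z => if χ z.1.2 z.2.1.2 z.2.2.2 then H z else 0 := by
  refine Measurable.ite ?_ hH measurable_const
  have h : Measurable fun z : (ℝ × ℤ) × (ℝ × ℤ) × (ℝ × ℤ) => (z.1.2, z.2.1.2, z.2.2.2) := by
    fun_prop
  exact h (Set.to_countable {t : ℤ × ℤ × ℤ | χ t.1 t.2.1 t.2.2}).measurableSet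

/-- The kernel in the range where the output modulation dominates. -/
noncomputable def kerOut (p q₁ q₂ : ℝ × ℤ) : ℝ≥0∞ :=
  if p.2 ≠ q₁.2 ∧ p.2 ≠ q₂.2 then
    decay (27 / 64) q₁.2 * decay (27 / 64) q₂.2 *
      (decay (31 / 64) (modP q₁) * decay (31 / 64) (modP q₂) *
        decay (31 / 64) (modM (p - q₁ - q₂)))
  else 0

/-- With the output frozen, integrating the three input modulations leaves the resonance function
shifted by the output modulation. -/
theorem isL2Kernel_kerOut : IsL2Kernel kerOut := by
  obtain ⟨C, hC⟩ := exists_lintegral_lintegral_decay_le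
  obtain ⟨D, hD⟩ := exists_tsum_tsum_decay_product_le
  have hK : Measurable fun z : (ℝ × ℤ) × (ℝ × ℤ) × (ℝ × ℤ) => kerOut z.1 z.2.1 z.2.2 := by
    refine measurable_three_freq (fun k m n => k ≠ m ∧ k ≠ n) ?_
    exact (((measurable_decay_freq _).comp (by fun_prop)).mul
      ((measurable_decay_freq _).comp (by fun_prop))).mul
      ((((measurable_decay_modP _).comp (by fun_prop)).mul
      ((measurable_decay_modP _).comp (by fun_prop))).mul
      ((measurable_decay_modM _).comp (by fun_prop)))
  refine ⟨hK, C * D, fun f₁ f₂ f₃ h₁ h₂ h₃ => ?_⟩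
  refine lintegral_trilin_sq_le_of_output hK h₁ h₂ h₃ fun p => ?_
  rw [lintegral_lintegral_freqMeasure (H := fun q₁ q₂ => kerOut p q₁ q₂ ^ 2) ((hK.pow_const 2).comp
    (f := fun z : (ℝ × ℤ) × (ℝ × ℤ) => (p, z.1, z.2)) (by fun_prop))]
  calc _ ≤ ∑' m : ℤ, ∑' n : ℤ, C * (if p.2 ≠ m ∧ p.2 ≠ n then
        decay (27 / 32) m * decay (27 / 32) n *
        decay (5 / 8) (-(p.1 + (p.2 : ℝ) ^ 2) + 2 * (p.2 - m) * (p.2 - n)) else 0) := by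
        refine ENNReal.tsum_le_tsum fun m => ENNReal.tsum_le_tsum fun n => ?_
        simp only [kerOut]
        split_ifs with h
        swap
        · simp
        calc _ = (decay (27 / 32) m * decay (27 / 32) n) * ∫⁻ x, ∫⁻ y,
              decay (31 / 32) (x - -(m : ℝ) ^ 2) * decay (31 / 32) (y - -(n : ℝ) ^ 2) *
              decay (31 / 32) (x + y - (p.1 - ((p.2 : ℝ) - m - n) ^ 2)) := by
              have hm : Measurable fun z : ℝ × ℝ =>
                  decay (31 / 32) (z.1 - -(m : ℝ) ^ 2) * decay (31 / 32) (z.2 - -(n : ℝ) ^ 2) *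
                  decay (31 / 32) (z.1 + z.2 - (p.1 - ((p.2 : ℝ) - m - n) ^ 2)) :=
                (((measurable_decay _).comp (by fun_prop)).mul
                  ((measurable_decay _).comp (by fun_prop))).mul
                  ((measurable_decay _).comp (by fun_prop))
              rw [← lintegral_const_mul _ hm.lintegral_prod_right']
              refine lintegral_congr fun x => ?_
              rw [← lintegral_const_mul _ (by exact hm.comp (f := fun y => (x, y)) (by fun_prop))]
              refine lintegral_congr fun y => ?_
              simp only [mul_pow, decay_sq, modP, modM, Prod.fst_sub, Prod.snd_sub]
              rw [← decay_neg _ (p.1 - x - y - _)]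
              push_cast
              ring_nf
          _ ≤ (decay (27 / 32) m * decay (27 / 32) n) * (C * decay (5 / 8)
              (-(m : ℝ) ^ 2 + -(n : ℝ) ^ 2 - (p.1 - ((p.2 : ℝ) - m - n) ^ 2))) := by
              gcongr
              exact hC _ _ _
          _ = _ := by
              rw [show -(m : ℝ) ^ 2 + -(n : ℝ) ^ 2 - (p.1 - ((p.2 : ℝ) - m - n) ^ 2) =
                -(p.1 + (p.2 : ℝ) ^ 2) + 2 * (p.2 - m) * (p.2 - n) by ring]
              ring
    _ ≤ _ := by
        simp_rw [ENNReal.tsum_mul_left]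
        rw [ENNReal.coe_mul]
        gcongr
        exact hD _ _

/-- The kernel in the range where the third modulation dominates. -/
noncomputable def kerThird (p q₁ q₂ : ℝ × ℤ) : ℝ≥0∞ :=
  if p.2 ≠ q₁.2 ∧ p.2 ≠ q₂.2 then
    decay (27 / 64) q₁.2 * decay (27 / 64) q₂.2 *
      (decay (31 / 64) (modP q₁) * decay (31 / 64) (modP q₂) * decay (31 / 64) (modP p))
  else 0

/-- With the third input (τ₃, l) frozen, (k - m)(k - n) = (l + n)(l + m), so the same double sum
applies with -l in the role of k. -/
theorem isL2Kernel_kerThird : IsL2Kernel kerThird := by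
  obtain ⟨C, hC⟩ := exists_lintegral_lintegral_decay_le
  obtain ⟨D, hD⟩ := exists_tsum_tsum_decay_product_le
  have hK : Measurable fun z : (ℝ × ℤ) × (ℝ × ℤ) × (ℝ × ℤ) => kerThird z.1 z.2.1 z.2.2 := by
    refine measurable_three_freq (fun k m n => k ≠ m ∧ k ≠ n) ?_
    exact (((measurable_decay_freq _).comp (by fun_prop)).mul
      ((measurable_decay_freq _).comp (by fun_prop))).mul
      ((((measurable_decay_modP _).comp (by fun_prop)).mul
      ((measurable_decay_modP _).comp (by fun_prop))).mul
      ((measurable_decay_modP _).comp (by fun_prop)))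
  refine ⟨hK, C * D, fun f₁ f₂ f₃ h₁ h₂ h₃ => ?_⟩
  refine lintegral_trilin_sq_le_of_third hK h₁ h₂ h₃ fun q₃ => ?_
  rw [lintegral_lintegral_freqMeasure (H := fun q₁ q₂ => kerThird (q₃ + (q₁ + q₂)) q₁ q₂ ^ 2) ((hK.pow_const 2).comp
    (f := fun z : (ℝ × ℤ) × (ℝ × ℤ) => (q₃ + (z.1 + z.2), z.1, z.2)) (by fun_prop))]
  calc _ ≤ ∑' m : ℤ, ∑' n : ℤ, C * (if -q₃.2 ≠ m ∧ -q₃.2 ≠ n then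
        decay (27 / 32) m * decay (27 / 32) n *
        decay (5 / 8) ((q₃.1 - (q₃.2 : ℝ) ^ 2) +
          2 * (((-q₃.2 : ℤ) : ℝ) - m) * (((-q₃.2 : ℤ) : ℝ) - n)) else 0) := by
        refine ENNReal.tsum_le_tsum fun m => ENNReal.tsum_le_tsum fun n => ?_
        simp only [kerThird, Prod.snd_add]
        by_cases h : -q₃.2 ≠ m ∧ -q₃.2 ≠ n
        swap
        · have h' : ¬ (q₃.2 + (m + n) ≠ m ∧ q₃.2 + (m + n) ≠ n) := by omega
          simp [h']
        have h' : q₃.2 + (m + n) ≠ m ∧ q₃.2 + (m + n) ≠ n := by omega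
        rw [if_pos h]
        simp only [h', ne_eq, not_false_eq_true, and_self, if_true]
        calc _ = (decay (27 / 32) m * decay (27 / 32) n) * ∫⁻ x, ∫⁻ y,
              decay (31 / 32) (x - -(m : ℝ) ^ 2) * decay (31 / 32) (y - -(n : ℝ) ^ 2) *
              decay (31 / 32) (x + y - (-q₃.1 - ((q₃.2 : ℝ) + m + n) ^ 2)) := by
              have hm : Measurable fun z : ℝ × ℝ =>
                  decay (31 / 32) (z.1 - -(m : ℝ) ^ 2) * decay (31 / 32) (z.2 - -(n : ℝ) ^ 2) *
                  decay (31 / 32) (z.1 + z.2 - (-q₃.1 - ((q₃.2 : ℝ) + m + n) ^ 2)) :=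
                (((measurable_decay _).comp (by fun_prop)).mul
                  ((measurable_decay _).comp (by fun_prop))).mul
                  ((measurable_decay _).comp (by fun_prop))
              rw [← lintegral_const_mul _ hm.lintegral_prod_right']
              refine lintegral_congr fun x => ?_
              rw [← lintegral_const_mul _ (by exact hm.comp (f := fun y => (x, y)) (by fun_prop))]
              refine lintegral_congr fun y => ?_
              simp only [mul_pow, decay_sq, modP, Prod.fst_add, Prod.snd_add]
              push_cast
              ring_nf
          _ ≤ (decay (27 / 32) m * decay (27 / 32) n) * (C * decay (5 / 8)
              (-(m : ℝ) ^ 2 + -(n : ℝ) ^ 2 - (-q₃.1 - ((q₃.2 : ℝ) + m + n) ^ 2))) := by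
              gcongr
              exact hC _ _ _
          _ = _ := by
              rw [show -(m : ℝ) ^ 2 + -(n : ℝ) ^ 2 - (-q₃.1 - ((q₃.2 : ℝ) + m + n) ^ 2) =
                (q₃.1 - (q₃.2 : ℝ) ^ 2) +
                  2 * (((-q₃.2 : ℤ) : ℝ) - m) * (((-q₃.2 : ℤ) : ℝ) - n) by push_cast; ring]
              ring
    _ ≤ _ := by
        simp_rw [ENNReal.tsum_mul_left]
        rw [ENNReal.coe_mul]
        gcongr
        exact hD _ _

open Classical in
/-- The kernel in the range where the first modulation dominates and the first two frequencies are
comparatively small. -/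
noncomputable def kerSmall (p q₁ q₂ : ℝ × ℤ) : ℝ≥0∞ :=
  if IsSmallPair p.2 q₁.2 q₂.2 then
    decay (1 / 2) q₂.2 * (decay (31 / 64) (modP p) * decay (31 / 64) (modP q₂) *
      decay (31 / 64) (modM (p - q₁ - q₂)))
  else 0

-- With the first input frozen, the double integral runs over the output and the second input. The
-- remaining sum over k and n is `exists_tsum_tsum_smallPair_le`.
open Classical in
theorem isL2Kernel_kerSmall : IsL2Kernel kerSmall := by
  obtain ⟨C, hC⟩ := exists_lintegral_lintegral_decay_sub_le
  obtain ⟨D, hD⟩ := exists_tsum_tsum_smallPair_le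
  have hK : Measurable fun z : (ℝ × ℤ) × (ℝ × ℤ) × (ℝ × ℤ) => kerSmall z.1 z.2.1 z.2.2 := by
    refine measurable_three_freq IsSmallPair ?_
    exact ((measurable_decay_freq _).comp (by fun_prop)).mul
      ((((measurable_decay_modP _).comp (by fun_prop)).mul
      ((measurable_decay_modP _).comp (by fun_prop))).mul
      ((measurable_decay_modM _).comp (by fun_prop)))
  refine ⟨hK, C * D, fun f₁ f₂ f₃ h₁ h₂ h₃ => ?_⟩
  refine lintegral_trilin_sq_le_of_first hK h₁ h₂ h₃ fun q₁ => ?_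
  rw [lintegral_lintegral_freqMeasure (H := fun p q₂ => kerSmall p q₁ q₂ ^ 2) ((hK.pow_const 2).comp
    (f := fun z : (ℝ × ℤ) × (ℝ × ℤ) => (z.1, q₁, z.2)) (by fun_prop))]
  calc _ ≤ ∑' k : ℤ, ∑' n : ℤ, C * (if IsSmallPair k q₁.2 n then
        decay 1 n * decay (5 / 8) ((q₁.1 + (q₁.2 : ℝ) ^ 2) + 2 * (k - q₁.2) * (k - n)) else 0) := by
        refine ENNReal.tsum_le_tsum fun k => ENNReal.tsum_le_tsum fun n => ?_
        simp only [kerSmall]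
        split_ifs with h
        swap
        · simp
        calc _ = decay 1 n * ∫⁻ x, ∫⁻ y,
              decay (31 / 32) (x - -(k : ℝ) ^ 2) * decay (31 / 32) (y - -(n : ℝ) ^ 2) *
              decay (31 / 32) (x - y - (q₁.1 + ((k : ℝ) - q₁.2 - n) ^ 2)) := by
              have hm : Measurable fun z : ℝ × ℝ =>
                  decay (31 / 32) (z.1 - -(k : ℝ) ^ 2) * decay (31 / 32) (z.2 - -(n : ℝ) ^ 2) *
                  decay (31 / 32) (z.1 - z.2 - (q₁.1 + ((k : ℝ) - q₁.2 - n) ^ 2)) :=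
                (((measurable_decay _).comp (by fun_prop)).mul
                  ((measurable_decay _).comp (by fun_prop))).mul
                  ((measurable_decay _).comp (by fun_prop))
              rw [← lintegral_const_mul _ hm.lintegral_prod_right']
              refine lintegral_congr fun x => ?_
              rw [← lintegral_const_mul _ (by exact hm.comp (f := fun y => (x, y)) (by fun_prop))]
              refine lintegral_congr fun y => ?_
              simp only [mul_pow, decay_sq, modP, modM, Prod.fst_sub, Prod.snd_sub]
              push_cast
              ring_nf
          _ ≤ decay 1 n * (C * decay (5 / 8)
              (-(k : ℝ) ^ 2 - -(n : ℝ) ^ 2 - (q₁.1 + ((k : ℝ) - q₁.2 - n) ^ 2))) := by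
              gcongr
              exact hC _ _ _
          _ = _ := by
              rw [← decay_neg (5 / 8), show -(-(k : ℝ) ^ 2 - -(n : ℝ) ^ 2 -
                (q₁.1 + ((k : ℝ) - q₁.2 - n) ^ 2)) =
                (q₁.1 + (q₁.2 : ℝ) ^ 2) + 2 * (k - q₁.2) * (k - n) by ring]
              ring
    _ ≤ _ := by
        simp_rw [ENNReal.tsum_mul_left]
        rw [ENNReal.coe_mul]
        gcongr
        exact hD _ _

/-! ### The resonance identity and the pointwise multiplier bound. -/

/-- The exponential with values in `[0, ∞]`. -/
noncomputable def eexp (t : ℝ) : ℝ≥0∞ := ENNReal.ofReal (Real.exp t)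

theorem eexp_mul_eexp (s t : ℝ) : eexp s * eexp t = eexp (s + t) := by
  unfold eexp
  rw [← ENNReal.ofReal_mul (Real.exp_pos s).le, Real.exp_add]

theorem eexp_le_eexp {s t : ℝ} (h : s ≤ t) : eexp s ≤ eexp t :=
  ENNReal.ofReal_le_ofReal (Real.exp_le_exp.mpr h)

theorem eexp_log {x : ℝ} (hx : 0 < x) : eexp (Real.log x) = ENNReal.ofReal x := by
  rw [eexp, Real.exp_log hx]

/-- The logarithm of the bracket. -/
noncomputable def logBracket (y : ℝ) : ℝ := Real.log (bracket y)

theorem logBracket_nonneg (y : ℝ) : 0 ≤ logBracket y := Real.log_nonneg (one_le_bracket y)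

theorem decay_eq_eexp (p y : ℝ) : decay p y = eexp (-p * logBracket y) := by
  rw [decay, eexp, logBracket, Real.rpow_def_of_pos (bracket_pos y), mul_comm]

theorem ofReal_abs_le_eexp (y : ℝ) : ENNReal.ofReal |y| ≤ eexp (logBracket y) := by
  rw [logBracket, eexp_log (bracket_pos y)]
  exact ENNReal.ofReal_le_ofReal (abs_le_bracket y)

theorem bracket_int_le {n : ℤ} (hn : n ≠ 0) : bracket n ^ 2 ≤ 2 * |(n : ℝ)| ^ 2 := by
  rw [bracket_sq, sq_abs]
  have : (1 : ℝ) ≤ (n : ℝ) ^ 2 := by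
    have : 1 ≤ n ^ 2 := by nlinarith [Int.one_le_abs hn, sq_abs n]
    exact_mod_cast this
  linarith

theorem add_le_two_mul_mul {x y : ℝ} (hx : 1 ≤ x) (hy : 1 ≤ y) : x + y ≤ 2 * (x * y) := by
  nlinarith [mul_nonneg (sub_nonneg.mpr hx) (sub_nonneg.mpr hy)]

/-- This is kl = (k - m)(k - n) - mn with l = k - m - n. Zero frequencies are separate because ⟨0⟩ =
1 is not controlled by |0|; the other bracket is then at most ⟨m⟩ + ⟨n⟩ ≤ 2⟨m⟩⟨n⟩. -/
theorem bracket_mul_bracket_le (k m n : ℤ) :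
    bracket k * bracket ((k - m - n : ℤ) : ℝ) ≤
      2 * |((k : ℝ) - m) * (k - n)| + 2 * (bracket m * bracket n) := by
  have hm := one_le_bracket m
  have hn := one_le_bracket n
  have h0 := abs_nonneg (((k : ℝ) - m) * (k - n))
  by_cases hk : k = 0
  · subst hk
    have h1 : bracket ((0 : ℤ) : ℝ) = 1 := by simp [bracket]
    have h2 : bracket ((0 - m - n : ℤ) : ℝ) ≤ bracket m + bracket n := by
      rw [← bracket_neg]
      convert bracket_add_le (m : ℝ) n using 2
      push_cast; ring
    rw [h1, one_mul]
    linarith [add_le_two_mul_mul hm hn]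
  by_cases hl : k - m - n = 0
  · have h1 : bracket ((0 : ℤ) : ℝ) = 1 := by simp [bracket]
    have h2 : bracket (k : ℝ) ≤ bracket m + bracket n := by
      convert bracket_add_le (m : ℝ) n using 2
      have : k = m + n := by omega
      rw [this]; push_cast; ring
    rw [hl, h1, mul_one]
    linarith [add_le_two_mul_mul hm hn]
  · have h1 : bracket k * bracket ((k - m - n : ℤ) : ℝ) ≤ 2 * (|(k : ℝ)| * |((k - m - n : ℤ) : ℝ)|) := by
      refine le_of_sq_le_sq ?_ (by positivity)
      have e1 := bracket_int_le hk
      have e2 := bracket_int_le hl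
      calc (bracket k * bracket ((k - m - n : ℤ) : ℝ)) ^ 2
          = bracket k ^ 2 * bracket ((k - m - n : ℤ) : ℝ) ^ 2 := by ring
        _ ≤ (2 * |(k : ℝ)| ^ 2) * (2 * |((k - m - n : ℤ) : ℝ)| ^ 2) :=
            mul_le_mul e1 e2 (sq_nonneg _) (by positivity)
        _ = _ := by ring
    have h2 : |(k : ℝ)| * |((k - m - n : ℤ) : ℝ)| ≤
        |((k : ℝ) - m) * (k - n)| + |(m : ℝ)| * |(n : ℝ)| := by
      rw [← abs_mul, ← abs_mul]
      refine le_trans (le_of_eq ?_) (abs_sub (((k : ℝ) - m) * (k - n)) ((m : ℝ) * n))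
      congr 1
      push_cast; ring
    have h3 : |(m : ℝ)| * |(n : ℝ)| ≤ bracket m * bracket n :=
      mul_le_mul (abs_le_bracket _) (abs_le_bracket _) (abs_nonneg _) (by linarith)
    linarith

/-- The time frequencies cancel, and k² - m² - n² + l² factors because l = k - m - n. The sign of l²
comes from the reversed dispersion of the third factor. -/
theorem modulation_identity (p q₁ q₂ : ℝ × ℤ) :
    modP p - modP q₁ - modP q₂ - modM (p - q₁ - q₂) =
      2 * (((p.2 : ℝ) - q₁.2) * (p.2 - q₂.2)) := by
  simp only [modP, modM, Prod.fst_sub, Prod.snd_sub]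
  push_cast; ring

theorem IsSmallPair.bracket_le {k m n : ℤ} (h : IsSmallPair k m n) :
    bracket k ^ 2 ≤ 4 * |((k : ℝ) - m) * (k - n)| ∧
      bracket ((k - m - n : ℤ) : ℝ) ≤ 2 * bracket k := by
  unfold IsSmallPair at h
  have hm := one_le_bracket m
  have hn := one_le_bracket n
  have hmm := abs_le_bracket (m : ℝ)
  have hnn := abs_le_bracket (n : ℝ)
  have hk := bracket_le_one_add_abs (k : ℝ)
  have e1 : bracket m ≤ bracket m * bracket n := le_mul_of_one_le_right (by linarith) hn
  have e2 : bracket n ≤ bracket m * bracket n := le_mul_of_one_le_left (by linarith) hm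
  have e3 : bracket ((k - m - n : ℤ) : ℝ) ≤ bracket k + (bracket m + bracket n) := by
    have h1 := bracket_add_le (k : ℝ) (-(m + n))
    have h2 := bracket_add_le (m : ℝ) n
    rw [bracket_neg] at h1
    refine le_trans (le_of_eq ?_) (h1.trans (by linarith))
    congr 1; push_cast; ring
  set x := bracket m * bracket n
  have hx : 1 ≤ x := by linarith
  have hxx : x ≤ x ^ 2 := by nlinarith
  have ha : bracket k / 2 ≤ |(k : ℝ) - m| := by
    have := abs_sub_abs_le_abs_sub (k : ℝ) m
    linarith
  have hb : bracket k / 2 ≤ |(k : ℝ) - n| := by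
    have := abs_sub_abs_le_abs_sub (k : ℝ) n
    linarith
  constructor
  · rw [abs_mul]
    have := mul_le_mul ha hb (by have := bracket_pos (k : ℝ); positivity) (abs_nonneg _)
    linarith
  · linarith

/-- Allows a small power of ⟨k⟩⟨l⟩ to be paid for with five times that power of ⟨m⟩⟨n⟩. -/
theorem bracket_mul_bracket_le_of_not_isSmallPair {k m n : ℤ} (h : ¬ IsSmallPair k m n) :
    bracket k * bracket ((k - m - n : ℤ) : ℝ) ≤ 288 * (bracket m * bracket n) ^ 5 := by
  unfold IsSmallPair at h
  push Not at h
  have hm := one_le_bracket m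
  have hn := one_le_bracket n
  have e1 : bracket m ≤ bracket m * bracket n := le_mul_of_one_le_right (by linarith) hn
  have e2 : bracket n ≤ bracket m * bracket n := le_mul_of_one_le_left (by linarith) hm
  have e3 : bracket ((k - m - n : ℤ) : ℝ) ≤ bracket k + (bracket m + bracket n) := by
    have h1 := bracket_add_le (k : ℝ) (-(m + n))
    have h2 := bracket_add_le (m : ℝ) n
    rw [bracket_neg] at h1
    refine le_trans (le_of_eq ?_) (h1.trans (by linarith))
    congr 1; push_cast; ring
  set x := bracket m * bracket n
  have hx : 1 ≤ x := by linarith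
  have hxx : x ≤ x ^ 2 := by nlinarith
  have e4 : bracket ((k - m - n : ℤ) : ℝ) ≤ 18 * x ^ 2 := by linarith
  calc bracket k * bracket ((k - m - n : ℤ) : ℝ) ≤ (16 * x ^ 2) * (18 * x ^ 2) :=
        mul_le_mul h.le e4 (bracket_pos _).le (by positivity)
    _ = 288 * x ^ 4 := by ring
    _ ≤ 288 * x ^ 5 := by gcongr; norm_num

/-- The Cauchy–Schwarz weight adapted to outputs of modulation at least `⟨ξ⟩²`. -/
noncomputable def farWeight (p : ℝ × ℤ) : ℝ≥0∞ :=
  ENNReal.ofReal (bracket p.2 / Real.sqrt (bracket p.2 ^ 4 + modP p ^ 2))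

theorem measurable_farWeight : Measurable farWeight := by
  have h1 : Measurable fun p : ℝ × ℤ => bracket p.2 :=
    continuous_bracket.measurable.comp measurable_freq
  exact ENNReal.measurable_ofReal.comp
    (h1.div ((h1.pow_const 4).add (measurable_modP.pow_const 2)).sqrt)

theorem eexp_le_farWeight {p : ℝ × ℤ} (h : bracket p.2 ^ 2 ≤ 8 * bracket (modP p)) :
    eexp (logBracket p.2 - logBracket (modP p) - Real.log 9) ≤ farWeight p := by
  have hx := bracket_pos (p.2 : ℝ)
  have hs := bracket_pos (modP p)
  have : logBracket p.2 - logBracket (modP p) - Real.log 9 =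
      Real.log (bracket p.2 / bracket (modP p) / 9) := by
    rw [Real.log_div (by positivity) (by norm_num), Real.log_div hx.ne' hs.ne', logBracket,
      logBracket]
  rw [this, eexp_log (by positivity), farWeight]
  refine ENNReal.ofReal_le_ofReal ?_
  rw [div_div]
  refine div_le_div_of_nonneg_left hx.le (by positivity) ?_
  rw [Real.sqrt_le_left (by positivity)]
  have h1 := bracket_sq (modP p)
  have h2 : bracket (p.2 : ℝ) ^ 4 ≤ (8 * bracket (modP p)) ^ 2 := by
    have := pow_le_pow_left₀ (by positivity) h 2
    rw [← pow_mul] at this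
    exact this
  nlinarith

/-- The substitution τ + ξ² = ⟨ξ⟩² y turns the integral into that of 1/(1 + y²), so its value is π
for every ξ. -/
theorem exists_lintegral_farWeight_sq_le :
    ∃ C : ℝ≥0, ∀ ξ : ℤ, ∫⁻ τ : ℝ, farWeight (τ, ξ) ^ 2 ≤ C := by
  refine ⟨Real.pi.toNNReal, fun ξ => le_of_eq ?_⟩
  have hx := bracket_pos (ξ : ℝ)
  set x := bracket (ξ : ℝ) with hxdef
  have hpt : ∀ τ : ℝ, farWeight (τ, ξ) ^ 2 =
      ENNReal.ofReal (x⁻¹ ^ 2 * (1 + ((τ + (ξ : ℝ) ^ 2) / x ^ 2) ^ 2)⁻¹) := by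
    intro τ
    simp only [farWeight, modP, ← hxdef]
    rw [← ENNReal.ofReal_pow (by positivity), div_pow, Real.sq_sqrt (by positivity)]
    congr 1
    field_simp
  simp_rw [hpt]
  have hInt : Integrable fun y : ℝ => x⁻¹ ^ 2 * (1 + (y / x ^ 2) ^ 2)⁻¹ :=
    (integrable_inv_one_add_sq.comp_div (by positivity)).const_mul _
  rw [lintegral_add_right_eq_self (μ := volume)
    (fun y : ℝ => ENNReal.ofReal (x⁻¹ ^ 2 * (1 + (y / x ^ 2) ^ 2)⁻¹)) ((ξ : ℝ) ^ 2),
    ← ofReal_integral_eq_lintegral_ofReal hInt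
      (Filter.Eventually.of_forall fun y => by positivity), integral_const_mul,
    Measure.integral_comp_div (fun y : ℝ => (1 + y ^ 2)⁻¹) (x ^ 2), integral_univ_inv_one_add_sq,
    abs_of_pos (by positivity), smul_eq_mul, ← mul_assoc, ← mul_pow, inv_mul_cancel₀ hx.ne']
  simp [ENNReal.ofReal]

theorem log_bracket_mul_le {a b c x : ℝ} (hx : 0 < x) {y z : ℝ} (h : bracket y * bracket z ≤ c * x)
    (hc : 0 < c) (hab : a = Real.log c) (hb : b = Real.log x) :
    logBracket y + logBracket z ≤ a + b := by
  rw [hab, hb, logBracket, logBracket, ← Real.log_mul (bracket_pos y).ne' (bracket_pos z).ne',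
    ← Real.log_mul hc.ne' hx.ne']
  exact Real.log_le_log (mul_pos (bracket_pos y) (bracket_pos z)) h

theorem exists_max_of_four (a b c d : ℝ) :
    (b ≤ a ∧ c ≤ a ∧ d ≤ a) ∨ (a ≤ b ∧ c ≤ b ∧ d ≤ b) ∨ (a ≤ c ∧ b ≤ c ∧ d ≤ c) ∨
      (a ≤ d ∧ b ≤ d ∧ c ≤ d) := by
  grind

/-- The weight of the `X_{1/2,b}`-norm. -/
noncomputable def wP (b : ℝ) (q : ℝ × ℤ) : ℝ≥0∞ := decay (-(1 / 2)) q.2 * decay (-b) (modP q)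

/-- The weight of the `X^-_{1/2,b}`-norm. -/
noncomputable def wM (b : ℝ) (q : ℝ × ℤ) : ℝ≥0∞ := decay (-(1 / 2)) q.2 * decay (-b) (modM q)

theorem multiplier_le (p q₁ q₂ : ℝ × ℤ) :
    decay 1 (modP p) * decay (-(1 / 2)) p.2 * ENNReal.ofReal |((p - q₁ - q₂).2 : ℝ)| ≤
      eexp (Real.log 2592) * (decay (33 / 64) (modP p) *
        (kerLow p q₁ q₂ * (wP (1 / 2) q₁ * wP (31 / 64) q₂ * wM (31 / 64) (p - q₁ - q₂)) +
        (kerOut p q₁ q₂ * (wP (1 / 2) q₁ * wP (31 / 64) q₂ * wM (31 / 64) (p - q₁ - q₂)) +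
        (kerFirst p q₁ q₂ * (wP (1 / 2) q₁ * wP (31 / 64) q₂ * wM (31 / 64) (p - q₁ - q₂)) +
        (kerSmall p q₁ q₂ * (wP (1 / 2) q₁ * wP (31 / 64) q₂ * wM (31 / 64) (p - q₁ - q₂)) +
        (kerFirst p q₂ q₁ * (wP (31 / 64) q₁ * wP (1 / 2) q₂ * wM (31 / 64) (p - q₁ - q₂)) +
        (kerSmall p q₂ q₁ * (wP (31 / 64) q₁ * wP (1 / 2) q₂ * wM (31 / 64) (p - q₁ - q₂)) +
        kerThird p q₁ q₂ * (wP (31 / 64) q₁ * wP (31 / 64) q₂ * wM (1 / 2) (p - q₁ - q₂)))))))) +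
      farWeight p *
        (kerOut p q₁ q₂ * (wP (1 / 2) q₁ * wP (31 / 64) q₂ * wM (31 / 64) (p - q₁ - q₂)))) := by
  have hres := bracket_mul_bracket_le p.2 q₁.2 q₂.2
  have hmod := modulation_identity p q₁ q₂
  have hcom : p - q₂ - q₁ = p - q₁ - q₂ := sub_right_comm _ _ _
  have hsnd : (p - q₁ - q₂).2 = p.2 - q₁.2 - q₂.2 := rfl
  rw [← hsnd] at hres
  set q₃ := p - q₁ - q₂ with hq₃
  -- In the logarithms of the eight brackets every case below is a linear inequality.
  have hX1 := logBracket_nonneg q₁.2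
  have hX2 := logBracket_nonneg q₂.2
  have hX0 := logBracket_nonneg p.2
  have hX3 := logBracket_nonneg q₃.2
  have hS0 := logBracket_nonneg (modP p)
  have hS1 := logBracket_nonneg (modP q₁)
  have hS2 := logBracket_nonneg (modP q₂)
  have hS3 := logBracket_nonneg (modM q₃)
  -- The 9 comes from `eexp_le_farWeight` and the 288 from the range where the pair is not small.
  have hκ : Real.log 2592 = Real.log 9 + Real.log 288 := by
    rw [← Real.log_mul (by norm_num) (by norm_num)]; norm_num
  have h9 : 0 ≤ Real.log 9 := Real.log_nonneg (by norm_num)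
  have h288 : Real.log 8 ≤ Real.log 288 := Real.log_le_log (by norm_num) (by norm_num)
  have h2 : Real.log 2 ≤ Real.log 288 := Real.log_le_log (by norm_num) (by norm_num)
  have h4 : Real.log 4 ≤ Real.log 288 := Real.log_le_log (by norm_num) (by norm_num)
  have h80 : 0 ≤ Real.log 8 := Real.log_nonneg (by norm_num)
  have hlog2 : Real.log (bracket q₁.2 * bracket q₂.2) = logBracket q₁.2 + logBracket q₂.2 :=
    Real.log_mul (bracket_pos _).ne' (bracket_pos _).ne'
  have hlog5 : Real.log ((bracket q₁.2 * bracket q₂.2) ^ 5) =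
      5 * (logBracket q₁.2 + logBracket q₂.2) := by
    rw [Real.log_pow, hlog2]; norm_num
  have hb12 : 0 < bracket q₁.2 * bracket q₂.2 := mul_pos (bracket_pos _) (bracket_pos _)
  refine le_trans (mul_le_mul_right (ofReal_abs_le_eexp (q₃.2 : ℝ)) _) ?_
  by_cases hlow : bracket p.2 * bracket (q₃.2 : ℝ) ≤ 4 * (bracket q₁.2 * bracket q₂.2)
  · have hJ := log_bracket_mul_le hb12 hlow (by norm_num) rfl hlog2.symm
    refine le_trans ?_ (mul_le_mul_right (le_self_add.trans' (mul_le_mul_right le_self_add _)) _)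
    simp only [kerLow, outThird, wP, wM, decay_eq_eexp, eexp_mul_eexp, ← hq₃]
    exact eexp_le_eexp (by linarith)
  push Not at hlow
  have hJ4 : bracket p.2 * bracket (q₃.2 : ℝ) ≤
      4 * |((p.2 : ℝ) - q₁.2) * (p.2 - q₂.2)| := by linarith
  have hab : ((p.2 : ℝ) - q₁.2) * (p.2 - q₂.2) ≠ 0 := by
    intro h0
    rw [h0, abs_zero, mul_zero] at hJ4
    exact absurd hJ4 (not_le.mpr (mul_pos (bracket_pos _) (bracket_pos _)))
  have hne : p.2 ≠ q₁.2 ∧ p.2 ≠ q₂.2 := by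
    constructor <;> rintro h0 <;> exact hab (by rw [h0]; ring)
  have habs : 2 * |((p.2 : ℝ) - q₁.2) * (p.2 - q₂.2)| ≤
      bracket (modP p) + bracket (modP q₁) + bracket (modP q₂) + bracket (modM q₃) := by
    have e : 2 * |((p.2 : ℝ) - q₁.2) * (p.2 - q₂.2)| =
        |modP p - modP q₁ - modP q₂ - modM q₃| := by
      rw [hmod, abs_mul 2, abs_of_pos (two_pos : (0 : ℝ) < 2)]
    rw [e]
    have e1 := abs_sub (modP p - modP q₁ - modP q₂) (modM q₃)
    have e2 := abs_sub (modP p - modP q₁) (modP q₂)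
    have e3 := abs_sub (modP p) (modP q₁)
    linarith [abs_le_bracket (modP p), abs_le_bracket (modP q₁), abs_le_bracket (modP q₂),
      abs_le_bracket (modM q₃)]
  have hmono : ∀ {y z : ℝ}, bracket y ≤ bracket z → logBracket y ≤ logBracket z :=
    fun h => Real.log_le_log (bracket_pos _) h
  have hD : ∀ {u v : ℝ≥0∞}, u ≤ v → eexp (Real.log 2592) * (decay (33 / 64) (modP p) * u) ≤
      eexp (Real.log 2592) * (decay (33 / 64) (modP p) * v + farWeight p *
        (kerOut p q₁ q₂ * (wP (1 / 2) q₁ * wP (31 / 64) q₂ * wM (31 / 64) q₃))) :=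
    fun h => mul_le_mul_right (le_self_add.trans' (mul_le_mul_right h _)) _
  have hJ5 : ¬ IsSmallPair p.2 q₁.2 q₂.2 →
      logBracket p.2 + logBracket q₃.2 ≤
        Real.log 288 + 5 * (logBracket q₁.2 + logBracket q₂.2) := fun hS =>
    log_bracket_mul_le (pow_pos hb12 5) (bracket_mul_bracket_le_of_not_isSmallPair hS)
      (by norm_num) rfl hlog5.symm
  have hJs : ∀ y : ℝ, bracket (modP p) + bracket (modP q₁) + bracket (modP q₂) +
      bracket (modM q₃) ≤ 4 * bracket y →
      logBracket p.2 + logBracket q₃.2 ≤ Real.log 8 + logBracket y := fun y hy =>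
    log_bracket_mul_le (bracket_pos y) (by linarith) (by norm_num) rfl rfl
  rcases exists_max_of_four (bracket (modP p)) (bracket (modP q₁)) (bracket (modP q₂))
    (bracket (modM q₃)) with ⟨m1, m2, m3⟩ | ⟨m1, m2, m3⟩ | ⟨m1, m2, m3⟩ | ⟨m1, m2, m3⟩
  · have hJ := hJs (modP p) (by linarith)
    -- Output modulation dominant. For a small pair |σ₀| ≳ ⟨k⟩² and ⟨l⟩ ≲ ⟨k⟩, so the multiplier is
    -- controlled by ⟨k⟩/⟨σ₀⟩, hence by `farWeight`.
    by_cases hS : IsSmallPair p.2 q₁.2 q₂.2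
    · obtain ⟨hx, hx3⟩ := hS.bracket_le
      have hfar := eexp_le_farWeight (p := p) (by linarith)
      have hx3' : logBracket q₃.2 ≤ Real.log 2 + logBracket p.2 := by
        rw [logBracket, logBracket, ← Real.log_mul (by norm_num) (bracket_pos _).ne']
        exact Real.log_le_log (bracket_pos _) hx3
      refine le_trans ?_ (mul_le_mul_right (le_add_self.trans' (mul_le_mul_left hfar _)) _)
      simp only [kerOut, if_pos hne, wP, wM, decay_eq_eexp, eexp_mul_eexp, ← hq₃]
      exact eexp_le_eexp (by linarith)
    -- Split (⟨k⟩⟨l⟩)^{1/2} into powers 31/64 and 1/64: the first is paid for by σ₀, the second by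
    -- (⟨m⟩⟨n⟩)^{5/64}, leaving 1/2 - 5/64 = 27/64.
    · have hJ' := hJ5 hS
      refine le_trans ?_ (hD (le_self_add.trans le_add_self))
      simp only [kerOut, if_pos hne, wP, wM, decay_eq_eexp, eexp_mul_eexp, ← hq₃]
      exact eexp_le_eexp (by linarith)
  · have hJ := hJs (modP q₁) (by linarith)
    by_cases hS : IsSmallPair p.2 q₁.2 q₂.2
    · refine le_trans ?_ (hD (((le_self_add.trans le_add_self).trans le_add_self).trans
        le_add_self))
      simp only [kerSmall, if_pos hS, wP, wM, decay_eq_eexp, eexp_mul_eexp, ← hq₃]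
      exact eexp_le_eexp (by linarith)
    -- Now the powers are 15/32 and 1/32, leaving 1/2 - 5/32 = 11/32 on ⟨m⟩⟨n⟩. The saved
    -- ⟨σ₁⟩^{-1/32} is at most ⟨σ₂⟩^{-1/32}, which raises 31/64 to the integrable 33/64.
    · have hJ' := hJ5 hS
      have h12 := hmono m2
      refine le_trans ?_ (hD ((le_self_add.trans le_add_self).trans le_add_self))
      simp only [kerFirst, outThird, wP, wM, decay_eq_eexp, eexp_mul_eexp, ← hq₃]
      exact eexp_le_eexp (by linarith)
  · have hJ := hJs (modP q₂) (by linarith)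
    by_cases hS : IsSmallPair p.2 q₁.2 q₂.2
    · have hS' : IsSmallPair p.2 q₂.2 q₁.2 := by
        unfold IsSmallPair at hS ⊢
        rwa [mul_comm (bracket _)]
      refine le_trans ?_ (hD (((((le_self_add.trans le_add_self).trans le_add_self).trans
        le_add_self).trans le_add_self).trans le_add_self))
      simp only [kerSmall, if_pos hS', wP, wM, decay_eq_eexp, eexp_mul_eexp, hcom]
      exact eexp_le_eexp (by linarith)
    · have hJ' := hJ5 hS
      have h12 := hmono m2
      refine le_trans ?_ (hD ((((le_self_add.trans le_add_self).trans le_add_self).trans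
        le_add_self).trans le_add_self))
      simp only [kerFirst, outThird, wP, wM, decay_eq_eexp, eexp_mul_eexp, hcom]
      exact eexp_le_eexp (by linarith)
  · have hJ := hJs (modM q₃) (by linarith)
    refine le_trans ?_ (hD (((((le_add_self.trans le_add_self).trans le_add_self).trans
        le_add_self).trans le_add_self).trans le_add_self))
    simp only [kerThird, if_pos hne, wP, wM, decay_eq_eexp, eexp_mul_eexp]
    exact eexp_le_eexp (by linarith)

/-! ### The trilinear estimate on the Fourier side. -/

theorem add_sq_le_four_mul (a b : ℝ≥0∞) : (a + b) ^ 2 ≤ 4 * (a ^ 2 + b ^ 2) := by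
  wlog h : a ≤ b generalizing a b
  · rw [add_comm a, add_comm (a ^ 2)]
    exact this b a (le_of_not_ge h)
  calc (a + b) ^ 2 ≤ (b + b) ^ 2 := by gcongr
    _ = 4 * b ^ 2 := by ring
    _ ≤ _ := by gcongr; exact le_add_self

theorem lintegral_add_sq_le {X : Type*} [MeasurableSpace X] {μ : Measure X} {f g : X → ℝ≥0∞}
    (hf : Measurable f) (hg : Measurable g) {C D : ℝ≥0} {E : ℝ≥0∞}
    (hC : ∫⁻ x, f x ^ 2 ∂μ ≤ C * E) (hD : ∫⁻ x, g x ^ 2 ∂μ ≤ D * E) :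
    ∫⁻ x, (f x + g x) ^ 2 ∂μ ≤ (4 * (C + D) : ℝ≥0) * E := by
  calc ∫⁻ x, (f x + g x) ^ 2 ∂μ ≤ ∫⁻ x, 4 * (f x ^ 2 + g x ^ 2) ∂μ :=
        lintegral_mono fun x => add_sq_le_four_mul _ _
    _ = 4 * ((∫⁻ x, f x ^ 2 ∂μ) + ∫⁻ x, g x ^ 2 ∂μ) := by
        rw [lintegral_const_mul _ (by fun_prop), lintegral_add_left (by fun_prop)]
    _ ≤ 4 * (C * E + D * E) := by gcongr
    _ = _ := by push_cast; ring

theorem lintegral_lintegral_add {X : Type*} [MeasurableSpace X] {μ : Measure X} [SFinite μ]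
    {f g : X → X → ℝ≥0∞} (hf : Measurable (Function.uncurry f)) :
    ∫⁻ x, ∫⁻ y, (f x y + g x y) ∂μ ∂μ =
      (∫⁻ x, ∫⁻ y, f x y ∂μ ∂μ) + ∫⁻ x, ∫⁻ y, g x y ∂μ ∂μ := by
  rw [← lintegral_add_left (by exact hf.lintegral_prod_right')]
  refine lintegral_congr fun x => ?_
  rw [← lintegral_add_left (by exact hf.comp (f := fun y => (x, y)) (by fun_prop))]

theorem const_mul_lintegral_lintegral {X : Type*} [MeasurableSpace X] {μ : Measure X} [SFinite μ]
    (c : ℝ≥0∞) {f : X → X → ℝ≥0∞} (hf : Measurable (Function.uncurry f)) :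
    c * ∫⁻ x, ∫⁻ y, f x y ∂μ ∂μ = ∫⁻ x, ∫⁻ y, c * f x y ∂μ ∂μ := by
  rw [← lintegral_const_mul _ (by exact hf.lintegral_prod_right')]
  refine lintegral_congr fun x => ?_
  rw [← lintegral_const_mul _ (by exact hf.comp (f := fun y => (x, y)) (by fun_prop))]

theorem IsL2Kernel.measurable_integrand {K : ℝ × ℤ → ℝ × ℤ → ℝ × ℤ → ℝ≥0∞} (hK : IsL2Kernel K)
    {f₁ f₂ f₃ : ℝ × ℤ → ℝ≥0∞} (h₁ : Measurable f₁) (h₂ : Measurable f₂) (h₃ : Measurable f₃)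
    (p : ℝ × ℤ) :
    Measurable (Function.uncurry fun q₁ q₂ => K p q₁ q₂ * (f₁ q₁ * f₂ q₂ * f₃ (p - q₁ - q₂))) :=
  (hK.1.comp (f := fun z : (ℝ × ℤ) × (ℝ × ℤ) => (p, z.1, z.2)) (by fun_prop)).mul
    (Measurable.mul (by fun_prop) (h₃.comp (by fun_prop)))

theorem measurable_wP (b : ℝ) : Measurable (wP b) :=
  (measurable_decay_freq _).mul (measurable_decay_modP _)

theorem measurable_wM (b : ℝ) : Measurable (wM b) :=
  (measurable_decay_freq _).mul (measurable_decay_modM _)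

/-- The symbol of the derivative falling on the third factor. -/
noncomputable def derivKernel (p q₁ q₂ : ℝ × ℤ) : ℝ≥0∞ :=
  ENNReal.ofReal |((p - q₁ - q₂).2 : ℝ)|

theorem measurable_derivKernel :
    Measurable fun z : (ℝ × ℤ) × (ℝ × ℤ) × (ℝ × ℤ) => derivKernel z.1 z.2.1 z.2.2 := by
  have h : Measurable fun q : ℝ × ℤ => ENNReal.ofReal |(q.2 : ℝ)| :=
    ENNReal.measurable_ofReal.comp (continuous_abs.measurable.comp measurable_freq)
  exact h.comp (f := fun z : (ℝ × ℤ) × (ℝ × ℤ) × (ℝ × ℤ) => z.1 - z.2.1 - z.2.2) (by fun_prop)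

/-- The sum of the three products of weighted `L²`-norms, two of them with a weakened weight. -/
noncomputable def energy (F₁ F₂ F₃ : ℝ × ℤ → ℝ≥0∞) : ℝ≥0∞ :=
  (∫⁻ q, (wP (1 / 2) q * F₁ q) ^ 2 ∂freqMeasure) * (∫⁻ q, (wP (31 / 64) q * F₂ q) ^ 2 ∂freqMeasure)
      * (∫⁻ q, (wM (31 / 64) q * F₃ q) ^ 2 ∂freqMeasure) +
  (∫⁻ q, (wP (31 / 64) q * F₁ q) ^ 2 ∂freqMeasure) * (∫⁻ q, (wP (1 / 2) q * F₂ q) ^ 2 ∂freqMeasure)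
      * (∫⁻ q, (wM (31 / 64) q * F₃ q) ^ 2 ∂freqMeasure) +
  (∫⁻ q, (wP (31 / 64) q * F₁ q) ^ 2 ∂freqMeasure) *
      (∫⁻ q, (wP (31 / 64) q * F₂ q) ^ 2 ∂freqMeasure)
      * (∫⁻ q, (wM (1 / 2) q * F₃ q) ^ 2 ∂freqMeasure)

/-- The pointwise bound is integrated over the inputs, giving 33/64 decay times A plus `farWeight`
times B, where A and B collect L²-bounded trilinear forms. Cauchy–Schwarz in τ for each ξ, followed
by summation, finishes. -/
theorem exists_trilinear_estimate :
    ∃ C : ℝ≥0, ∀ F₁ F₂ F₃ : ℝ × ℤ → ℝ≥0∞, Measurable F₁ → Measurable F₂ → Measurable F₃ →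
      ∑' ξ : ℤ, (∫⁻ τ : ℝ, decay 1 (modP (τ, ξ)) * decay (-(1 / 2)) ξ *
        trilin freqMeasure derivKernel F₁ F₂ F₃ (τ, ξ)) ^ 2 ≤ C * energy F₁ F₂ F₃ := by
  have kL := isL2Kernel_kerLow
  have kO := isL2Kernel_kerOut
  have kF := isL2Kernel_kerFirst
  have kS := isL2Kernel_kerSmall
  have kF' := kF.swap
  have kS' := kS.swap
  have kT := isL2Kernel_kerThird
  obtain ⟨CL, hL⟩ := kL.2
  obtain ⟨CO, hO⟩ := kO.2
  obtain ⟨CF, hF⟩ := kF.2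
  obtain ⟨CS, hS⟩ := kS.2
  obtain ⟨CF', hF'⟩ := kF'.2
  obtain ⟨CS', hS'⟩ := kS'.2
  obtain ⟨CT, hT⟩ := kT.2
  obtain ⟨W₀, hW₀⟩ := exists_lintegral_decay_le (p := 33 / 32) (by norm_num)
  obtain ⟨W₁, hW₁⟩ := exists_lintegral_farWeight_sq_le
  -- One factor 4 for each application of (a + b)² ≤ 4(a² + b²) to the seven nested terms.
  set CA : ℝ≥0 := 4 * (CL + 4 * (CO + 4 * (CF + 4 * (CS + 4 * (CF' + 4 * (CS' + CT))))))
  refine ⟨(Real.exp (Real.log 2592)).toNNReal ^ 2 * (4 * (W₀ * CA + W₁ * CO)),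
    fun F₁ F₂ F₃ h₁ h₂ h₃ => ?_⟩
  have g₁ : Measurable fun q => wP (1 / 2) q * F₁ q := (measurable_wP _).mul h₁
  have g₂ : Measurable fun q => wP (1 / 2) q * F₂ q := (measurable_wP _).mul h₂
  have g₃ : Measurable fun q => wM (1 / 2) q * F₃ q := (measurable_wM _).mul h₃
  have g₁' : Measurable fun q => wP (31 / 64) q * F₁ q := (measurable_wP _).mul h₁
  have g₂' : Measurable fun q => wP (31 / 64) q * F₂ q := (measurable_wP _).mul h₂
  have g₃' : Measurable fun q => wM (31 / 64) q * F₃ q := (measurable_wM _).mul h₃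
  set E := energy F₁ F₂ F₃ with hE
  have e₁ : ∀ {C : ℝ≥0} {x : ℝ≥0∞}, x ≤ C * _ → x ≤ C * E := fun h =>
    h.trans (mul_le_mul_right (le_self_add.trans le_self_add) _)
  have e₂ : ∀ {C : ℝ≥0} {x : ℝ≥0∞}, x ≤ C * _ → x ≤ C * E := fun h =>
    h.trans (mul_le_mul_right (le_add_self.trans le_self_add) _)
  have e₃ : ∀ {C : ℝ≥0} {x : ℝ≥0∞}, x ≤ C * _ → x ≤ C * E := fun h =>
    h.trans (mul_le_mul_right le_add_self _)
  have bL := e₁ (hL _ _ _ g₁ g₂' g₃')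
  have bO := e₁ (hO _ _ _ g₁ g₂' g₃')
  have bF := e₁ (hF _ _ _ g₁ g₂' g₃')
  have bS := e₁ (hS _ _ _ g₁ g₂' g₃')
  have bF' := e₂ (hF' _ _ _ g₁' g₂ g₃')
  have bS' := e₂ (hS' _ _ _ g₁' g₂ g₃')
  have bT := e₃ (hT _ _ _ g₁' g₂' g₃)
  have mL := measurable_trilin (μ := freqMeasure) kL.1 g₁ g₂' g₃'
  have mO := measurable_trilin (μ := freqMeasure) kO.1 g₁ g₂' g₃'
  have mF := measurable_trilin (μ := freqMeasure) kF.1 g₁ g₂' g₃'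
  have mS := measurable_trilin (μ := freqMeasure) kS.1 g₁ g₂' g₃'
  have mF' := measurable_trilin (μ := freqMeasure) (K := fun p q₁ q₂ => kerFirst p q₂ q₁) kF'.1 g₁' g₂ g₃'
  have mS' := measurable_trilin (μ := freqMeasure) (K := fun p q₁ q₂ => kerSmall p q₂ q₁) kS'.1 g₁' g₂ g₃'
  have mT := measurable_trilin (μ := freqMeasure) kT.1 g₁' g₂' g₃
  have bA := lintegral_add_sq_le mL (mO.add (mF.add (mS.add (mF'.add (mS'.add mT))))) bL
    (lintegral_add_sq_le mO (mF.add (mS.add (mF'.add (mS'.add mT)))) bO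
    (lintegral_add_sq_le mF (mS.add (mF'.add (mS'.add mT))) bF
    (lintegral_add_sq_le mS (mF'.add (mS'.add mT)) bS
    (lintegral_add_sq_le mF' (mS'.add mT) bF' (lintegral_add_sq_le mS' mT bS' bT)))))
  have mA := mL.add (mO.add (mF.add (mS.add (mF'.add (mS'.add mT)))))
  set B := trilin freqMeasure kerOut (fun q => wP (1 / 2) q * F₁ q)
    (fun q => wP (31 / 64) q * F₂ q) (fun q => wM (31 / 64) q * F₃ q) with hBdef
  obtain ⟨A, hA⟩ : ∃ A : ℝ × ℤ → ℝ≥0∞, A = fun p =>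
    trilin freqMeasure kerLow (fun q => wP (1 / 2) q * F₁ q)
      (fun q => wP (31 / 64) q * F₂ q) (fun q => wM (31 / 64) q * F₃ q) p + (B p +
    (trilin freqMeasure kerFirst (fun q => wP (1 / 2) q * F₁ q)
      (fun q => wP (31 / 64) q * F₂ q) (fun q => wM (31 / 64) q * F₃ q) p +
    (trilin freqMeasure kerSmall (fun q => wP (1 / 2) q * F₁ q)
      (fun q => wP (31 / 64) q * F₂ q) (fun q => wM (31 / 64) q * F₃ q) p +
    (trilin freqMeasure (fun p q₁ q₂ => kerFirst p q₂ q₁) (fun q => wP (31 / 64) q * F₁ q)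
      (fun q => wP (1 / 2) q * F₂ q) (fun q => wM (31 / 64) q * F₃ q) p +
    (trilin freqMeasure (fun p q₁ q₂ => kerSmall p q₂ q₁) (fun q => wP (31 / 64) q * F₁ q)
      (fun q => wP (1 / 2) q * F₂ q) (fun q => wM (31 / 64) q * F₃ q) p +
    trilin freqMeasure kerThird (fun q => wP (31 / 64) q * F₁ q)
      (fun q => wP (31 / 64) q * F₂ q) (fun q => wM (1 / 2) q * F₃ q) p))))) := ⟨_, rfl⟩
  have bA' : ∫⁻ p, A p ^ 2 ∂freqMeasure ≤ CA * E := by rw [hA]; exact bA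
  have mA' : Measurable A := by rw [hA]; exact mA
  clear bA mA
  have hpoint : ∀ p : ℝ × ℤ, decay 1 (modP p) * decay (-(1 / 2)) p.2 *
      trilin freqMeasure derivKernel F₁ F₂ F₃ p ≤
      eexp (Real.log 2592) * (decay (33 / 64) (modP p) * A p + farWeight p * B p) := by
    intro p
    have iL := kL.measurable_integrand g₁ g₂' g₃' p
    have iO := kO.measurable_integrand g₁ g₂' g₃' p
    have iF := kF.measurable_integrand g₁ g₂' g₃' p
    have iS := kS.measurable_integrand g₁ g₂' g₃' p
    have iF' := kF'.measurable_integrand g₁' g₂ g₃' p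
    have iS' := kS'.measurable_integrand g₁' g₂ g₃' p
    have iT := kT.measurable_integrand g₁' g₂' g₃ p
    rw [hA, hBdef]
    unfold trilin
    beta_reduce
    rw [← lintegral_lintegral_add iS', ← lintegral_lintegral_add iF',
      ← lintegral_lintegral_add iS, ← lintegral_lintegral_add iF, ← lintegral_lintegral_add iO,
      ← lintegral_lintegral_add iL]
    have hcm := @const_mul_lintegral_lintegral _ _ freqMeasure _
    have iA := iL.add (iO.add (iF.add (iS.add (iF'.add (iS'.add iT)))))
    rw [hcm (decay (33 / 64) (modP p)) (by exact iA), hcm (farWeight p) iO,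
      ← lintegral_lintegral_add (by exact iA.const_mul _),
      hcm (eexp _) (by exact (iA.const_mul _).add (iO.const_mul _)), hcm]
    swap
    · exact (measurable_derivKernel.comp (f := fun z : (ℝ × ℤ) × (ℝ × ℤ) => (p, z.1, z.2))
        (by fun_prop)).mul (Measurable.mul (by fun_prop) (h₃.comp (by fun_prop)))
    refine lintegral_mono fun q₁ => lintegral_mono fun q₂ => ?_
    have := mul_le_mul_left (multiplier_le p q₁ q₂) (F₁ q₁ * F₂ q₂ * F₃ (p - q₁ - q₂))
    refine le_trans (le_of_eq ?_) (this.trans (le_of_eq ?_))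
    · rw [derivKernel]; ring
    · ring
  have hξ : ∀ ξ : ℤ, (∫⁻ τ : ℝ, decay 1 (modP (τ, ξ)) * decay (-(1 / 2)) ξ *
      trilin freqMeasure derivKernel F₁ F₂ F₃ (τ, ξ)) ^ 2 ≤
      eexp (Real.log 2592) ^ 2 * (4 * (W₀ * (∫⁻ τ : ℝ, A (τ, ξ) ^ 2) +
        W₁ * ∫⁻ τ : ℝ, B (τ, ξ) ^ 2)) := by
    intro ξ
    have hs : Measurable fun τ : ℝ => ((τ, ξ) : ℝ × ℤ) := by fun_prop
    have m₀ : Measurable fun τ : ℝ => decay (33 / 64) (modP (τ, ξ)) :=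
      (measurable_decay_modP _).comp hs
    have m₁ : Measurable fun τ : ℝ => farWeight (τ, ξ) := measurable_farWeight.comp hs
    have m₂ : Measurable fun τ : ℝ => A (τ, ξ) := mA'.comp hs
    have m₃ : Measurable fun τ : ℝ => B (τ, ξ) := mO.comp hs
    calc _ ≤ (∫⁻ τ : ℝ, eexp (Real.log 2592) * (decay (33 / 64) (modP (τ, ξ)) * A (τ, ξ) +
          farWeight (τ, ξ) * B (τ, ξ))) ^ 2 := by
          exact pow_le_pow_left₀ zero_le (lintegral_mono fun τ => hpoint (τ, ξ)) 2
      _ = eexp (Real.log 2592) ^ 2 * ((∫⁻ τ : ℝ, decay (33 / 64) (modP (τ, ξ)) * A (τ, ξ)) +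
          ∫⁻ τ : ℝ, farWeight (τ, ξ) * B (τ, ξ)) ^ 2 := by
          rw [lintegral_const_mul _ (by exact (m₀.mul m₂).add (m₁.mul m₃)),
            lintegral_add_left (by exact m₀.mul m₂), mul_pow]
      _ ≤ eexp (Real.log 2592) ^ 2 * (4 *
          ((∫⁻ τ : ℝ, decay (33 / 64) (modP (τ, ξ)) ^ 2) * (∫⁻ τ : ℝ, A (τ, ξ) ^ 2) +
          (∫⁻ τ : ℝ, farWeight (τ, ξ) ^ 2) * ∫⁻ τ : ℝ, B (τ, ξ) ^ 2)) := by
          gcongr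
          refine (add_sq_le_four_mul _ _).trans ?_
          gcongr
          · exact lintegral_mul_sq_le m₀ m₂
          · exact lintegral_mul_sq_le m₁ m₃
      _ ≤ _ := by
          gcongr
          · refine le_trans (le_of_eq ?_) (hW₀ (-(ξ : ℝ) ^ 2))
            refine lintegral_congr fun τ => ?_
            rw [decay_sq, modP]
            norm_num
          · exact hW₁ ξ
  calc _ ≤ ∑' ξ : ℤ, eexp (Real.log 2592) ^ 2 * (4 * (W₀ * (∫⁻ τ : ℝ, A (τ, ξ) ^ 2) +
        W₁ * ∫⁻ τ : ℝ, B (τ, ξ) ^ 2)) := ENNReal.tsum_le_tsum hξ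
    _ = eexp (Real.log 2592) ^ 2 * (4 * (W₀ * (∫⁻ p, A p ^ 2 ∂freqMeasure) +
        W₁ * ∫⁻ p, B p ^ 2 ∂freqMeasure)) := by
        rw [ENNReal.tsum_mul_left, ENNReal.tsum_mul_left, ENNReal.tsum_add, ENNReal.tsum_mul_left,
          ENNReal.tsum_mul_left, lintegral_freqMeasure (mA'.pow_const 2),
          lintegral_freqMeasure (mO.pow_const 2)]
    _ ≤ eexp (Real.log 2592) ^ 2 * (4 * (W₀ * (CA * E) + W₁ * (CO * E))) := by
        gcongr
    _ = _ := by
        simp only [eexp, ENNReal.ofReal]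
        push_cast
        ring

/-! ### Time-localized periodic functions and their spatial Fourier coefficients. -/

open scoped ContDiff FourierTransform SchwartzMap

theorem hasDerivAt_intervalIntegral_param {F : ℝ × ℝ → ℂ} (hF : ContDiff ℝ ∞ F) (a b t₀ : ℝ) :
    HasDerivAt (fun t => ∫ x in a..b, F (t, x)) (∫ x in a..b, fderiv ℝ F (t₀, x) (1, 0)) t₀ := by
  have hF' : Continuous fun p => fderiv ℝ F p (1, 0) :=
    (hF.continuous_fderiv (by norm_num)).clm_apply continuous_const
  obtain ⟨C, hC⟩ := ((isCompact_closedBall t₀ 1).prod (isCompact_uIcc (a := a) (b := b))).exists_bound_of_continuousOn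
    hF'.continuousOn
  refine (intervalIntegral.hasDerivAt_integral_of_dominated_loc_of_deriv_le
    (F' := fun t x => fderiv ℝ F (t, x) (1, 0)) (bound := fun _ => C)
    (Metric.closedBall_mem_nhds t₀ one_pos) ?_ ?_ ?_ ?_ ?_ ?_).2
  · exact Filter.Eventually.of_forall fun t =>
      (hF.continuous.comp (by fun_prop : Continuous fun x => (t, x))).aestronglyMeasurable
  · exact (hF.continuous.comp (by fun_prop : Continuous fun x => (t₀, x))).intervalIntegrable _ _
  · exact (hF'.comp (by fun_prop : Continuous fun x => (t₀, x))).aestronglyMeasurable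
  · exact Filter.Eventually.of_forall fun x hx t ht =>
      hC (t, x) ⟨ht, Set.uIoc_subset_uIcc hx⟩
  · exact intervalIntegrable_const
  · refine Filter.Eventually.of_forall fun x _ t _ => ?_
    have h1 : HasFDerivAt F (fderiv ℝ F (t, x)) (t, x) :=
      (hF.differentiable (by norm_num) _).hasFDerivAt
    have h2 : HasDerivAt (fun s : ℝ => (s, x)) ((1 : ℝ), (0 : ℝ)) t :=
      (hasDerivAt_id t).prodMk (hasDerivAt_const t x)
    exact h1.comp_hasDerivAt t h2

theorem contDiff_intervalIntegral_param {F : ℝ × ℝ → ℂ} (hF : ContDiff ℝ ∞ F) (a b : ℝ) :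
    ContDiff ℝ ∞ fun t => ∫ x in a..b, F (t, x) := by
  rw [contDiff_infty]
  intro n
  induction n generalizing F with
  | zero =>
    refine contDiff_zero.mpr (continuous_iff_continuousAt.mpr fun t =>
      (hasDerivAt_intervalIntegral_param hF a b t).continuousAt)
  | succ n ih =>
    have hF' : ContDiff ℝ ∞ fun p => fderiv ℝ F p (1, 0) :=
      (hF.fderiv_right (by norm_num)).clm_apply contDiff_const
    push_cast
    rw [contDiff_succ_iff_deriv]
    refine ⟨fun t => (hasDerivAt_intervalIntegral_param hF a b t).differentiableAt, by simp, ?_⟩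
    have : deriv (fun t => ∫ x in a..b, F (t, x)) = fun t => ∫ x in a..b, fderiv ℝ F (t, x) (1, 0) :=
      funext fun t => (hasDerivAt_intervalIntegral_param hF a b t).deriv
    rw [this]
    exact ih hF'

/-- Smooth functions, `2π`-periodic in `x`, supported in `|t| ≤ T`. -/
structure IsTest (T : ℝ) (u : ℝ × ℝ → ℂ) : Prop where
  smooth : ContDiff ℝ ∞ u
  periodic : ∀ t x : ℝ, u (t, x + 2 * Real.pi) = u (t, x)
  eq_zero : ∀ t x : ℝ, T < |t| → u (t, x) = 0

/-- Support in a bounded time interval makes the decay condition redundant, and the resulting class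
is closed under products and ∂ₓ. -/
theorem IsSper.isTest {T : ℝ} {u : ℝ × ℝ → ℂ} (h : IsSper u)
    (hs : tsupport u ⊆ {p : ℝ × ℝ | |p.1| ≤ T}) : IsTest T u where
  smooth := h.smooth
  periodic := h.periodic
  eq_zero t x ht := by
    by_contra hne
    exact absurd (hs (subset_tsupport _ hne)) (not_le.mpr ht)

variable {T : ℝ} {u v : ℝ × ℝ → ℂ}

theorem IsTest.mul (hu : IsTest T u) (hv : IsTest T v) : IsTest T fun p => u p * v p where
  smooth := hu.smooth.mul hv.smooth
  periodic t x := by rw [hu.periodic, hv.periodic]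
  eq_zero t x ht := by rw [hu.eq_zero t x ht, zero_mul]

theorem IsTest.hasDerivAt (hu : IsTest T u) (t x : ℝ) :
    HasDerivAt (fun y => u (t, y)) (fderiv ℝ u (t, x) (0, 1)) x := by
  have h1 : HasFDerivAt u (fderiv ℝ u (t, x)) (t, x) :=
    (hu.smooth.differentiable (by norm_num) _).hasFDerivAt
  have h2 : HasDerivAt (fun s : ℝ => (t, s)) ((0 : ℝ), (1 : ℝ)) x :=
    (hasDerivAt_const x t).prodMk (hasDerivAt_id x)
  exact h1.comp_hasDerivAt x h2

theorem IsTest.partialX_eq (hu : IsTest T u) : partialX u = fun p => fderiv ℝ u p (0, 1) :=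
  funext fun p => (hu.hasDerivAt p.1 p.2).deriv

theorem IsTest.hasDerivAt_partialX (hu : IsTest T u) (t x : ℝ) :
    HasDerivAt (fun y => u (t, y)) (partialX u (t, x)) x := by
  rw [hu.partialX_eq]
  exact hu.hasDerivAt t x

theorem IsTest.partialX (hu : IsTest T u) : IsTest T (partialX u) where
  smooth := by
    rw [hu.partialX_eq]
    exact (hu.smooth.fderiv_right (by norm_num)).clm_apply contDiff_const
  periodic t x := by
    have h : (fun y => u (t, y)) = fun y => u (t, y + 2 * Real.pi) :=
      funext fun y => (hu.periodic t y).symm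
    simp only [PeriodicBourgain.partialX]
    conv_rhs => rw [h]
    exact (deriv_comp_add_const (fun y => u (t, y)) (2 * Real.pi) x).symm
  eq_zero t x ht := by
    have h : (fun y => u (t, y)) = fun _ => 0 := funext fun y => hu.eq_zero t y ht
    simp [PeriodicBourgain.partialX, h]

theorem norm_exp_neg_I_mul (x : ℝ) (n : ℤ) : ‖Complex.exp (-(Complex.I * x * n))‖ = 1 := by
  rw [Complex.norm_exp]; simp

theorem exp_neg_I_two_pi (n : ℤ) : Complex.exp (-(Complex.I * (2 * Real.pi : ℝ) * n)) = 1 := by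
  have := Complex.exp_int_mul_two_pi_mul_I (-n)
  rw [← this]
  congr 1
  push_cast; ring

theorem IsTest.fourierX_partialX (hu : IsTest T u) (t : ℝ) (ξ : ℤ) :
    fourierX (fun x => PeriodicBourgain.partialX u (t, x)) ξ =
      Complex.I * ξ * fourierX (fun x => u (t, x)) ξ := by
  have hv : ∀ x : ℝ, HasDerivAt (fun x : ℝ => Complex.exp (-(Complex.I * x * ξ)))
      (-(Complex.I * ξ) * Complex.exp (-(Complex.I * x * ξ))) x := by
    intro x
    have h1 : HasDerivAt (fun x : ℝ => -(Complex.I * x * ξ)) (-(Complex.I * 1 * ξ)) x :=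
      (((Complex.ofRealCLM.hasDerivAt (x := x)).const_mul Complex.I).mul_const (ξ : ℂ)).neg
    have := h1.cexp
    convert this using 1; ring
  have hcont := (hu.partialX.smooth.continuous.comp (by fun_prop : Continuous fun x : ℝ => (t, x)))
  have hparts := intervalIntegral.integral_mul_deriv_eq_deriv_mul (a := 0) (b := 2 * Real.pi)
    (fun x _ => hv x) (fun x _ => hu.hasDerivAt_partialX t x)
    (by apply Continuous.intervalIntegrable; fun_prop)
    (hcont.intervalIntegrable _ _)
  have hper := hu.periodic t 0
  rw [zero_add] at hper
  unfold fourierX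
  rw [hparts, exp_neg_I_two_pi, hper]
  simp only [mul_assoc (-(Complex.I * (ξ : ℂ))), intervalIntegral.integral_const_mul]
  simp
  ring

/-- The space Fourier coefficient as a function of time. -/
noncomputable def coeff (u : ℝ × ℝ → ℂ) (ξ : ℤ) (t : ℝ) : ℂ := fourierX (fun x => u (t, x)) ξ

theorem IsTest.contDiff_coeff (hu : IsTest T u) (ξ : ℤ) : ContDiff ℝ ∞ (coeff u ξ) := by
  unfold coeff fourierX
  refine contDiff_const.mul (contDiff_intervalIntegral_param
    (F := fun p => Complex.exp (-(Complex.I * p.2 * ξ)) * u p) ?_ _ _)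
  refine ContDiff.mul (ContDiff.cexp ?_) hu.smooth
  exact ((contDiff_const.mul (Complex.ofRealCLM.contDiff.comp contDiff_snd)).mul contDiff_const).neg

theorem IsTest.coeff_eq_zero (hu : IsTest T u) (ξ : ℤ) {t : ℝ} (ht : T < |t|) :
    coeff u ξ t = 0 := by
  simp [coeff, fourierX, hu.eq_zero t _ ht]

theorem IsTest.hasCompactSupport_coeff (hu : IsTest T u) (ξ : ℤ) :
    HasCompactSupport (coeff u ξ) := by
  refine HasCompactSupport.of_support_subset_isCompact (isCompact_Icc (a := -T) (b := T))
    fun t ht => ?_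
  rw [Set.mem_Icc, ← abs_le]
  by_contra hlt
  exact ht (hu.coeff_eq_zero ξ (not_le.mp hlt))

theorem IsTest.exists_bound (hu : IsTest T u) : ∃ C : ℝ, 0 ≤ C ∧ ∀ ξ t, ‖coeff u ξ t‖ ≤ C := by
  obtain ⟨C, hC⟩ := ((isCompact_Icc (a := -T) (b := T)).prod
    (isCompact_Icc (a := (0 : ℝ)) (b := 2 * Real.pi))).exists_bound_of_continuousOn
    hu.smooth.continuous.continuousOn
  refine ⟨(2 * Real.pi) ^ (-(1 / 2) : ℝ) * (|C| * (2 * Real.pi)), by positivity, fun ξ t => ?_⟩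
  by_cases ht : T < |t|
  · rw [hu.coeff_eq_zero ξ ht, norm_zero]
    positivity
  push Not at ht
  unfold coeff fourierX
  rw [norm_mul, Complex.norm_real, Real.norm_of_nonneg (by positivity)]
  gcongr
  refine (intervalIntegral.norm_integral_le_of_norm_le_const (C := |C|) fun x hx => ?_).trans
    (le_of_eq ?_)
  · rw [norm_mul, norm_exp_neg_I_mul, one_mul]
    rw [Set.uIoc_of_le (by positivity)] at hx
    exact (hC (t, x) ⟨abs_le.mp ht, hx.1.le, hx.2⟩).trans (le_abs_self C)
  · rw [sub_zero, abs_of_pos (a := 2 * Real.pi) (by positivity)]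

/-- Two spatial derivatives give the factor ξ². The resulting summability, uniform in t, is the
domination for the Fourier series arguments below. -/
theorem IsTest.exists_coeff_decay (hu : IsTest T u) :
    ∃ C : ℝ, 0 ≤ C ∧ ∀ ξ t, ‖coeff u ξ t‖ ≤ C * (1 + (ξ : ℝ) ^ 2)⁻¹ := by
  obtain ⟨C, hC0, hC⟩ := hu.exists_bound
  obtain ⟨D, hD0, hD⟩ := hu.partialX.partialX.exists_bound
  refine ⟨C + D, by positivity, fun ξ t => ?_⟩
  rw [← div_eq_mul_inv, le_div_iff₀ (by positivity)]
  have h1 := hD ξ t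
  have h2 : coeff (PeriodicBourgain.partialX (PeriodicBourgain.partialX u)) ξ t =
      Complex.I * ξ * (Complex.I * ξ * coeff u ξ t) := by
    unfold coeff
    rw [hu.partialX.fourierX_partialX, hu.fourierX_partialX]
  rw [h2] at h1
  simp only [norm_mul, Complex.norm_I, one_mul, Complex.norm_intCast] at h1
  have h3 : |(ξ : ℝ)| * (|(ξ : ℝ)| * ‖coeff u ξ t‖) = (ξ : ℝ) ^ 2 * ‖coeff u ξ t‖ := by
    rw [← mul_assoc, abs_mul_abs_self]; ring
  have h4 := hC ξ t
  nlinarith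

/-! ### The Fourier transform of a product as a convolution. -/

theorem fourierT_eq_fourier (g : ℝ → ℂ) (τ : ℝ) :
    fourierT g τ = (((2 * Real.pi) ^ (-(1 / 2) : ℝ) : ℝ) : ℂ) * 𝓕 g (τ / (2 * Real.pi)) := by
  unfold fourierT
  rw [Real.fourier_real_eq_integral_exp_smul]
  congr 2
  ext t
  rw [smul_eq_mul]
  congr 2
  have : (Real.pi : ℂ) ≠ 0 := by exact_mod_cast Real.pi_ne_zero
  push_cast
  field_simp

/-- The normalizing constant `(2π)^{-1/2}` of the Fourier transform. -/
noncomputable def normConst : ℝ := (2 * Real.pi) ^ (-(1 / 2) : ℝ)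

theorem normConst_pos : 0 < normConst := Real.rpow_pos_of_pos (by positivity) _

theorem normConst_mul_self : normConst * normConst = (2 * Real.pi)⁻¹ := by
  rw [normConst, ← Real.rpow_add (by positivity), ← Real.rpow_neg_one]
  norm_num

theorem normConst_le_one : normConst ≤ 1 :=
  Real.rpow_le_one_of_one_le_of_nonpos (by linarith [Real.pi_gt_three]) (by norm_num)

theorem fourierT_eq (g : ℝ → ℂ) (τ : ℝ) :
    fourierT g τ = normConst * 𝓕 g (τ / (2 * Real.pi)) := fourierT_eq_fourier g τ

theorem enorm_normConst_le_one : ‖(normConst : ℂ)‖ₑ ≤ 1 := by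
  rw [← ofReal_norm, Complex.norm_real, Real.norm_of_nonneg normConst_pos.le]
  exact ENNReal.ofReal_le_one.mpr normConst_le_one

/-- The inverse Fourier transform is moved across the pairing of 𝓕 g with the modulated function
e^{-2πits} h(t), whose inverse transform at y is 𝓕 h (s - y). -/
theorem fourier_mul_eq_integral {g h : ℝ → ℂ} (hg : ContDiff ℝ ∞ g) (hgc : HasCompactSupport g)
    (hh : ContDiff ℝ ∞ h) (hhc : HasCompactSupport h) (s : ℝ) :
    𝓕 (fun t => g t * h t) s = ∫ y, 𝓕 g y * 𝓕 h (s - y) := by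
  have hh' : ContDiff ℝ ∞ fun t : ℝ => Complex.exp (↑(-2 * Real.pi * t * s) * Complex.I) * h t := by
    refine ContDiff.mul (ContDiff.cexp (ContDiff.mul ?_ contDiff_const)) hh
    exact Complex.ofRealCLM.contDiff.comp ((contDiff_const.mul contDiff_id).mul contDiff_const)
  have hhc' : HasCompactSupport
      fun t : ℝ => Complex.exp (↑(-2 * Real.pi * t * s) * Complex.I) * h t := hhc.mul_left
  set G : 𝓢(ℝ, ℂ) := hgc.toSchwartzMap hg
  set H : 𝓢(ℝ, ℂ) := hhc'.toSchwartzMap hh'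
  have key := SchwartzMap.integral_fourierInv_mul_eq (𝓕 G) H
  have h1 : 𝓕 (fun t => g t * h t) s = ∫ t, 𝓕⁻ (𝓕 G) t * H t := by
    rw [Real.fourier_real_eq_integral_exp_smul]
    congr 1
    ext t
    rw [FourierTransform.fourierInv_fourier_eq]
    change _ = g t * (Complex.exp (↑(-2 * Real.pi * t * s) * Complex.I) * h t)
    rw [smul_eq_mul]; ring
  rw [h1, key]
  congr 1
  ext y
  rw [SchwartzMap.fourier_coe, SchwartzMap.fourierInv_coe]
  congr 1
  rw [Real.fourierInv_eq', Real.fourier_real_eq_integral_exp_smul]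
  congr 1
  ext t
  change Complex.exp _ • (Complex.exp (↑(-2 * Real.pi * t * s) * Complex.I) * h t) = _
  rw [smul_eq_mul, smul_eq_mul, ← mul_assoc, ← Complex.exp_add]
  congr 2
  simp
  ring

theorem fourierT_mul_eq_integral {g h : ℝ → ℂ} (hg : ContDiff ℝ ∞ g) (hgc : HasCompactSupport g)
    (hh : ContDiff ℝ ∞ h) (hhc : HasCompactSupport h) (τ : ℝ) :
    fourierT (fun t => g t * h t) τ =
      normConst * ∫ σ, fourierT g σ * fourierT h (τ - σ) := by
  have hscale := Measure.integral_comp_div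
    (fun y => 𝓕 g y * 𝓕 h (τ / (2 * Real.pi) - y)) (2 * Real.pi)
  rw [fourierT_eq, fourier_mul_eq_integral hg hgc hh hhc]
  congr 1
  have h1 : ∀ σ, fourierT g σ * fourierT h (τ - σ) = ((normConst * normConst : ℝ) : ℂ) *
      (𝓕 g (σ / (2 * Real.pi)) * 𝓕 h (τ / (2 * Real.pi) - σ / (2 * Real.pi))) := by
    intro σ
    rw [fourierT_eq, fourierT_eq, sub_div]
    push_cast; ring
  simp_rw [h1]
  rw [integral_const_mul, hscale, normConst_mul_self, abs_of_pos (by positivity), Complex.real_smul,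
    ← mul_assoc, ← Complex.ofReal_mul, inv_mul_cancel₀ (by positivity), Complex.ofReal_one, one_mul]

theorem enorm_fourierT_mul_le {g h : ℝ → ℂ} (hg : ContDiff ℝ ∞ g) (hgc : HasCompactSupport g)
    (hh : ContDiff ℝ ∞ h) (hhc : HasCompactSupport h) (τ : ℝ) :
    ‖fourierT (fun t => g t * h t) τ‖ₑ ≤ ∫⁻ σ, ‖fourierT g σ‖ₑ * ‖fourierT h (τ - σ)‖ₑ := by
  rw [fourierT_mul_eq_integral hg hgc hh hhc, enorm_mul]
  refine (mul_le_of_le_one_left zero_le enorm_normConst_le_one).trans ?_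
  refine (enorm_integral_le_lintegral_enorm _).trans (le_of_eq ?_)
  simp_rw [enorm_mul]

theorem continuous_fourierT {g : ℝ → ℂ} (hg : ContDiff ℝ ∞ g) (hgc : HasCompactSupport g) :
    Continuous (fourierT g) := by
  have h1 : Continuous (𝓕 g) := (𝓕 (hgc.toSchwartzMap hg)).continuous
  have h2 : fourierT g = fun τ => normConst * 𝓕 g (τ / (2 * Real.pi)) :=
    funext (fourierT_eq g)
  rw [h2]
  fun_prop

variable {w : ℝ × ℝ → ℂ}

theorem coeff_eq (u : ℝ × ℝ → ℂ) (ξ : ℤ) (t : ℝ) : coeff u ξ t =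
    normConst * ∫ x in (0 : ℝ)..(2 * Real.pi), Complex.exp (-(Complex.I * x * ξ)) * u (t, x) := rfl

theorem IsTest.measurable_enorm_fourierTX (hu : IsTest T u) :
    Measurable fun q : ℝ × ℤ => ‖fourierTX u q.1 q.2‖ₑ :=
  measurable_from_prod_countable_left fun ξ =>
    (continuous_fourierT (hu.contDiff_coeff ξ) (hu.hasCompactSupport_coeff ξ)).measurable.enorm

theorem summable_inv_one_add_sq_int : Summable fun m : ℤ => (1 + (m : ℝ) ^ 2)⁻¹ := by
  refine Summable.of_norm_bounded_eventually (g := fun m : ℤ => 1 / (m : ℝ) ^ 2)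
    (Real.summable_one_div_int_pow.mpr one_lt_two) ?_
  have : {(0 : ℤ)}ᶜ ∈ (Filter.cofinite : Filter ℤ) := (Set.finite_singleton 0).compl_mem_cofinite
  filter_upwards [this] with m hm
  have hm' : (m : ℝ) ≠ 0 := by exact_mod_cast hm
  rw [Real.norm_of_nonneg (by positivity), one_div]
  gcongr
  linarith

theorem IsTest.hasSum_coeff (hu : IsTest T u) (t x : ℝ) :
    HasSum (fun m : ℤ => normConst * coeff u m t * Complex.exp (Complex.I * x * m)) (u (t, x)) := by
  have : Fact (0 < 2 * Real.pi) := ⟨by positivity⟩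
  have hper : Function.Periodic (fun y => u (t, y)) (2 * Real.pi) := hu.periodic t
  have hcont : Continuous fun y => u (t, y) :=
    hu.smooth.continuous.comp (by fun_prop : Continuous fun y : ℝ => (t, y))
  let f : C(AddCircle (2 * Real.pi), ℂ) :=
    ⟨hper.lift, continuous_coinduced_dom.mpr hcont⟩
  have hf : ∀ y : ℝ, f (y : AddCircle (2 * Real.pi)) = u (t, y) := fun y => hper.lift_coe y
  have hpi : (Real.pi : ℂ) ≠ 0 := by exact_mod_cast Real.pi_ne_zero
  have hcoeff : ∀ m : ℤ, fourierCoeff f m = normConst * coeff u m t := by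
    intro m
    rw [fourierCoeff_eq_intervalIntegral f m 0, coeff_eq, ← mul_assoc, ← Complex.ofReal_mul,
      normConst_mul_self, zero_add, Complex.real_smul, one_div]
    congr 1
    refine intervalIntegral.integral_congr fun y _ => ?_
    simp only [hf, fourier_coe_apply, smul_eq_mul]
    congr 2
    push_cast
    field_simp
  obtain ⟨C, hC0, hC⟩ := hu.exists_coeff_decay
  have hsum : Summable (fourierCoeff f) := by
    refine Summable.of_norm_bounded (g := fun m : ℤ => C * (1 + (m : ℝ) ^ 2)⁻¹)
      (summable_inv_one_add_sq_int.mul_left C) fun m => ?_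
    rw [hcoeff, norm_mul, Complex.norm_real, Real.norm_of_nonneg normConst_pos.le]
    exact (mul_le_of_le_one_left (norm_nonneg _) normConst_le_one).trans (hC m t)
  have := has_pointwise_sum_fourier_series_of_summable hsum (x : AddCircle (2 * Real.pi))
  rw [hf] at this
  refine this.congr_fun fun m => ?_
  rw [hcoeff, fourier_coe_apply, smul_eq_mul]
  congr 2
  push_cast
  field_simp

/-- Expand u in its absolutely convergent Fourier series and integrate term by term against w. -/
theorem IsTest.hasSum_coeff_mul (hu : IsTest T u) (hw : IsTest T w) (ξ : ℤ) (t : ℝ) :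
    HasSum (fun m : ℤ => normConst * (coeff u m t * coeff w (ξ - m) t))
      (coeff (fun p => u p * w p) ξ t) := by
  obtain ⟨C, hC0, hC⟩ := hu.exists_coeff_decay
  have hcw : Continuous fun y => w (t, y) :=
    hw.smooth.continuous.comp (by fun_prop : Continuous fun y : ℝ => (t, y))
  have key := intervalIntegral.hasSum_integral_of_dominated_convergence (μ := volume)
    (a := 0) (b := 2 * Real.pi)
    (F := fun (m : ℤ) x => normConst * coeff u m t *
      (Complex.exp (-(Complex.I * x * (ξ - m : ℤ))) * w (t, x)))
    (f := fun x => Complex.exp (-(Complex.I * x * ξ)) * (u (t, x) * w (t, x)))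
    (fun m x => C * (1 + (m : ℝ) ^ 2)⁻¹ * ‖w (t, x)‖)
    (fun m => by
      apply Continuous.aestronglyMeasurable
      exact continuous_const.mul (Continuous.mul (by fun_prop) hcw))
    (fun m => Filter.Eventually.of_forall fun x _ => by
      rw [norm_mul, norm_mul, norm_mul, norm_exp_neg_I_mul, one_mul, Complex.norm_real,
        Real.norm_of_nonneg normConst_pos.le]
      exact mul_le_mul_of_nonneg_right
        ((mul_le_of_le_one_left (norm_nonneg _) normConst_le_one).trans (hC m t)) (norm_nonneg _))
    (Filter.Eventually.of_forall fun x _ =>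
      (summable_inv_one_add_sq_int.mul_left C).mul_right _)
    (by
      simp_rw [tsum_mul_right]
      exact (continuous_const.mul hcw.norm).intervalIntegrable _ _)
    (Filter.Eventually.of_forall fun x _ => by
      have h := ((hu.hasSum_coeff t x).mul_left (Complex.exp (-(Complex.I * x * ξ)))).mul_right
        (w (t, x))
      rw [mul_assoc _ (u (t, x))] at h
      refine h.congr_fun fun m => ?_
      have : Complex.exp (-(Complex.I * x * (ξ - m : ℤ))) =
          Complex.exp (-(Complex.I * x * ξ)) * Complex.exp (Complex.I * x * m) := by
        rw [← Complex.exp_add]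
        congr 1
        push_cast; ring
      rw [this]; ring)
  have := key.mul_left (normConst : ℂ)
  rw [coeff_eq]
  refine this.congr_fun fun m => ?_
  rw [intervalIntegral.integral_const_mul, coeff_eq w]
  ring

theorem norm_exp_neg_I_mul_real (x y : ℝ) : ‖Complex.exp (-(Complex.I * x * y))‖ = 1 := by
  rw [Complex.norm_exp]; simp

theorem IsTest.hasSum_fourierTX_mul (hu : IsTest T u) (hw : IsTest T w) (τ : ℝ) (ξ : ℤ) :
    HasSum (fun m : ℤ => normConst * fourierT (fun t => coeff u m t * coeff w (ξ - m) t) τ)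
      (fourierTX (fun p => u p * w p) τ ξ) := by
  obtain ⟨C, hC0, hC⟩ := hu.exists_coeff_decay
  obtain ⟨D, hD0, hD⟩ := hw.exists_bound
  have key := hasSum_integral_of_dominated_convergence (μ := (volume : Measure ℝ))
    (F := fun (m : ℤ) (t : ℝ) => normConst * (Complex.exp (-(Complex.I * t * τ)) *
      (coeff u m t * coeff w (ξ - m) t)))
    (f := fun t => Complex.exp (-(Complex.I * t * τ)) * coeff (fun p => u p * w p) ξ t)
    (fun m t => C * (1 + (m : ℝ) ^ 2)⁻¹ * (Set.Icc (-T) T).indicator (fun _ => D) t)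
    (fun m => by
      have h1 := (hu.contDiff_coeff m).continuous
      have h2 := (hw.contDiff_coeff (ξ - m)).continuous
      apply Continuous.aestronglyMeasurable
      fun_prop)
    (fun m => Filter.Eventually.of_forall fun t => by
      rw [norm_mul, norm_mul, norm_mul, norm_exp_neg_I_mul_real, one_mul, Complex.norm_real,
        Real.norm_of_nonneg normConst_pos.le]
      refine (mul_le_of_le_one_left (by positivity) normConst_le_one).trans ?_
      refine mul_le_mul (hC m t) ?_ (norm_nonneg _) (by positivity)
      by_cases ht : t ∈ Set.Icc (-T) T
      · rw [Set.indicator_of_mem ht]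
        exact hD _ _
      · rw [Set.indicator_of_notMem ht, hw.coeff_eq_zero _ (by
          rw [Set.mem_Icc, ← abs_le] at ht
          exact not_le.mp ht), norm_zero])
    (Filter.Eventually.of_forall fun t =>
      (summable_inv_one_add_sq_int.mul_left C).mul_right _)
    (by
      simp_rw [tsum_mul_right]
      refine Integrable.const_mul ?_ _
      rw [integrable_indicator_iff measurableSet_Icc]
      exact integrableOn_const (by simp))
    (Filter.Eventually.of_forall fun t => by
      have h := (hu.hasSum_coeff_mul hw ξ t).mul_left (Complex.exp (-(Complex.I * t * τ)))
      refine h.congr_fun fun m => ?_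
      ring)
  have := key.mul_left (normConst : ℂ)
  refine this.congr_fun fun m => ?_
  rw [integral_const_mul]
  rfl

/-- The normalizing constants of both convolutions are at most 1 and are discarded. -/
theorem IsTest.enorm_fourierTX_mul_le (hu : IsTest T u) (hw : IsTest T w) (p : ℝ × ℤ) :
    ‖fourierTX (fun p => u p * w p) p.1 p.2‖ₑ ≤
      ∫⁻ q, ‖fourierTX u q.1 q.2‖ₑ * ‖fourierTX w (p - q).1 (p - q).2‖ₑ ∂freqMeasure := by
  rw [lintegral_freqMeasure (by
    exact hu.measurable_enorm_fourierTX.mul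
      (hw.measurable_enorm_fourierTX.comp (measurable_const.sub measurable_id))),
    ← (hu.hasSum_fourierTX_mul hw p.1 p.2).tsum_eq]
  refine enorm_tsum_le_tsum_enorm.trans (ENNReal.tsum_le_tsum fun m => ?_)
  rw [enorm_mul]
  refine (mul_le_of_le_one_left zero_le enorm_normConst_le_one).trans ?_
  exact enorm_fourierT_mul_le (hu.contDiff_coeff m) (hu.hasCompactSupport_coeff m)
    (hw.contDiff_coeff _) (hw.hasCompactSupport_coeff _) p.1

theorem IsTest.enorm_fourierTX_partialX (hu : IsTest T u) (τ : ℝ) (ξ : ℤ) :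
    ‖fourierTX (PeriodicBourgain.partialX u) τ ξ‖ₑ =
      ENNReal.ofReal |(ξ : ℝ)| * ‖fourierTX u τ ξ‖ₑ := by
  have h : fourierTX (PeriodicBourgain.partialX u) τ ξ = Complex.I * ξ * fourierTX u τ ξ := by
    unfold fourierTX fourierT
    simp_rw [hu.fourierX_partialX]
    simp_rw [mul_left_comm _ (Complex.I * (ξ : ℂ))]
    rw [integral_const_mul]
    ring
  rw [h, enorm_mul, ← ofReal_norm (Complex.I * (ξ : ℂ))]
  simp

theorem IsTest.enorm_fourierTX_product_le {v : ℝ × ℝ → ℂ} (hu : IsTest T u) (hv : IsTest T v)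
    (hw : IsTest T w) (p : ℝ × ℤ) :
    ‖fourierTX (fun p => u p * v p * PeriodicBourgain.partialX w p) p.1 p.2‖ₑ ≤
      trilin freqMeasure derivKernel (fun q => ‖fourierTX u q.1 q.2‖ₑ)
        (fun q => ‖fourierTX v q.1 q.2‖ₑ) (fun q => ‖fourierTX w q.1 q.2‖ₑ) p := by
  simp_rw [mul_assoc]
  refine (hu.enorm_fourierTX_mul_le (hv.mul hw.partialX) p).trans ?_
  unfold trilin
  refine lintegral_mono fun q₁ => ?_
  refine (mul_le_mul_right (hv.enorm_fourierTX_mul_le hw.partialX (p - q₁)) _).trans ?_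
  rw [← lintegral_const_mul _ (by
    exact hv.measurable_enorm_fourierTX.mul
      (hw.partialX.measurable_enorm_fourierTX.comp (measurable_const.sub measurable_id)))]
  refine lintegral_mono fun q₂ => le_of_eq ?_
  rw [hw.enorm_fourierTX_partialX]
  unfold derivKernel
  ring

/-! ### Plancherel and the gain of a power of T. -/

theorem lintegral_enorm_sq_eq_ofReal_integral {g : ℝ → ℂ} (hg : Integrable fun t => ‖g t‖ ^ 2) :
    ∫⁻ t, ‖g t‖ₑ ^ 2 = ENNReal.ofReal (∫ t, ‖g t‖ ^ 2) := by
  rw [ofReal_integral_eq_lintegral_ofReal hg (Filter.Eventually.of_forall fun t => by positivity)]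
  refine lintegral_congr fun t => ?_
  rw [ENNReal.ofReal_pow (norm_nonneg _), ofReal_norm]

theorem integrable_norm_sq_schwartz (φ : 𝓢(ℝ, ℂ)) : Integrable fun t => ‖φ t‖ ^ 2 :=
  (memLp_two_iff_integrable_sq_norm φ.continuous.aestronglyMeasurable).1 (φ.memLp 2)

theorem integrable_norm_fourierT_sq {g : ℝ → ℂ} (hg : ContDiff ℝ ∞ g) (hgc : HasCompactSupport g) :
    Integrable fun τ => ‖fourierT g τ‖ ^ 2 := by
  have h1 := ((integrable_norm_sq_schwartz (𝓕 (hgc.toSchwartzMap hg))).comp_div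
    (R := 2 * Real.pi) (by positivity)).const_mul (normConst ^ 2)
  refine h1.congr (Filter.Eventually.of_forall fun τ => ?_)
  simp only [fourierT_eq, norm_mul, mul_pow, Complex.norm_real, Real.norm_of_nonneg normConst_pos.le]
  rfl

theorem lintegral_enorm_fourierT_sq {g : ℝ → ℂ} (hg : ContDiff ℝ ∞ g) (hgc : HasCompactSupport g) :
    ∫⁻ τ, ‖fourierT g τ‖ₑ ^ 2 = ∫⁻ t, ‖g t‖ₑ ^ 2 := by
  have hInt : Integrable fun t => ‖g t‖ ^ 2 := integrable_norm_sq_schwartz (hgc.toSchwartzMap hg)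
  rw [lintegral_enorm_sq_eq_ofReal_integral (integrable_norm_fourierT_sq hg hgc),
    lintegral_enorm_sq_eq_ofReal_integral hInt]
  congr 1
  have h1 := Measure.integral_comp_div (fun y => ‖𝓕 g y‖ ^ 2) (2 * Real.pi)
  have h2 : ∫ y, ‖𝓕 g y‖ ^ 2 = ∫ t, ‖g t‖ ^ 2 :=
    SchwartzMap.integral_norm_sq_fourier (hgc.toSchwartzMap hg)
  simp only [fourierT_eq, norm_mul, mul_pow, Complex.norm_real, Real.norm_of_nonneg normConst_pos.le]
  rw [integral_const_mul, h1, h2, abs_of_pos (by positivity), sq, normConst_mul_self, smul_eq_mul,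
    inv_mul_cancel_left₀ (by positivity)]

/-- Cauchy–Schwarz on [-T, T]: the length 2T times the squared normalization 1/(2π). -/
theorem enorm_fourierT_sq_le {g : ℝ → ℂ} {T : ℝ} (hT : 0 < T) (hg : Continuous g)
    (h0 : ∀ t, T < |t| → g t = 0) (τ : ℝ) :
    ‖fourierT g τ‖ₑ ^ 2 ≤ ENNReal.ofReal (T / Real.pi) * ∫⁻ t, ‖g t‖ₑ ^ 2 := by
  have h1 : ‖fourierT g τ‖ₑ ≤ ENNReal.ofReal normConst *
      ∫⁻ t, (Set.Icc (-T) T).indicator 1 t * ‖g t‖ₑ := by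
    change ‖(normConst : ℂ) * ∫ t : ℝ, Complex.exp (-(Complex.I * t * τ)) * g t‖ₑ ≤ _
    rw [enorm_mul, ← ofReal_norm (normConst : ℂ), Complex.norm_real,
      Real.norm_of_nonneg normConst_pos.le]
    gcongr
    refine (enorm_integral_le_lintegral_enorm _).trans (lintegral_mono fun t => ?_)
    rw [enorm_mul, ← ofReal_norm, norm_exp_neg_I_mul_real, ENNReal.ofReal_one, one_mul]
    by_cases ht : t ∈ Set.Icc (-T) T
    · simp [Set.indicator_of_mem ht]
    · rw [Set.mem_Icc, ← abs_le, not_le] at ht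
      simp [h0 t ht]
  have h2 := lintegral_mul_sq_le (μ := volume)
    (f := (Set.Icc (-T) T).indicator (1 : ℝ → ℝ≥0∞)) (g := fun t => ‖g t‖ₑ)
    (measurable_one.indicator measurableSet_Icc) hg.measurable.enorm
  have h3 : ∫⁻ t, (Set.Icc (-T) T).indicator (1 : ℝ → ℝ≥0∞) t ^ 2 = ENNReal.ofReal (2 * T) := by
    have : ∀ t, (Set.Icc (-T) T).indicator (1 : ℝ → ℝ≥0∞) t ^ 2 =
        (Set.Icc (-T) T).indicator 1 t := fun t => by
      by_cases ht : t ∈ Set.Icc (-T) T <;> simp [ht]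
    simp_rw [this]
    rw [lintegral_indicator_one measurableSet_Icc, Real.volume_Icc]
    congr 1; ring
  rw [h3] at h2
  calc ‖fourierT g τ‖ₑ ^ 2 ≤ _ := pow_le_pow_left₀ zero_le h1 2
    _ ≤ ENNReal.ofReal normConst ^ 2 * (ENNReal.ofReal (2 * T) * ∫⁻ t, ‖g t‖ₑ ^ 2) := by
        rw [mul_pow]; gcongr
    _ = _ := by
        rw [← mul_assoc, ← ENNReal.ofReal_pow normConst_pos.le,
          ← ENNReal.ofReal_mul (by positivity), sq, normConst_mul_self]
        congr 2
        field_simp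

theorem decay_neg_le_decay_neg {p x y : ℝ} (hp : 0 ≤ p) (h : |x| ≤ |y|) :
    decay (-p) x ≤ decay (-p) y := by
  unfold decay
  rw [neg_neg]
  exact ENNReal.ofReal_le_ofReal
    (Real.rpow_le_rpow (bracket_pos x).le (bracket_le_bracket h) hp)

/-- If at least half of the mass of `G` lies at distance more than `R` from `c`, then lowering the
weight exponent from `1` to `θ` gains `⟨R⟩^{θ - 1}`. -/
theorem lintegral_decay_le_of_tail {G : ℝ → ℝ≥0∞} (hG : Measurable G) {c R θ : ℝ} (hR : 0 ≤ R)
    (hθ : 0 ≤ θ) (hθ1 : θ ≤ 1)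
    (h : ∫⁻ τ in {τ | |τ - c| ≤ R}, G τ ≤ ∫⁻ τ in {τ | |τ - c| ≤ R}ᶜ, G τ) :
    ∫⁻ τ, decay (-θ) (τ - c) * G τ ≤
      2 * decay (1 - θ) R * ∫⁻ τ, decay (-1) (τ - c) * G τ := by
  have hS : MeasurableSet {τ | |τ - c| ≤ R} :=
    measurableSet_le (by fun_prop) measurable_const
  have hmeas : ∀ p, Measurable fun τ => decay p (τ - c) := fun p =>
    (measurable_decay p).comp (measurable_id.sub_const c)
  have hout : ∀ τ ∈ {τ | |τ - c| ≤ R}ᶜ, |R| ≤ |τ - c| := fun τ hτ => by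
    rw [abs_of_nonneg hR]
    exact (lt_of_not_ge fun h => hτ h).le
  have htail : ∫⁻ τ in {τ | |τ - c| ≤ R}ᶜ, decay (1 - θ) R * (decay (-1) (τ - c) * G τ) ≤
      decay (1 - θ) R * ∫⁻ τ, decay (-1) (τ - c) * G τ := by
    rw [lintegral_const_mul _ (by exact (hmeas _).mul hG)]
    gcongr
    exact Measure.restrict_le_self
  have h1 : ∫⁻ τ in {τ | |τ - c| ≤ R}, decay (-θ) (τ - c) * G τ ≤
      decay (1 - θ) R * ∫⁻ τ, decay (-1) (τ - c) * G τ := by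
    calc ∫⁻ τ in {τ | |τ - c| ≤ R}, decay (-θ) (τ - c) * G τ
        ≤ ∫⁻ τ in {τ | |τ - c| ≤ R}, decay (-θ) R * G τ := by
          refine setLIntegral_mono (hG.const_mul _) fun τ hτ => mul_le_mul_left ?_ _
          exact decay_neg_le_decay_neg hθ (by rwa [abs_of_nonneg hR])
      _ = decay (-θ) R * ∫⁻ τ in {τ | |τ - c| ≤ R}, G τ := lintegral_const_mul _ hG
      _ ≤ decay (-θ) R * ∫⁻ τ in {τ | |τ - c| ≤ R}ᶜ, G τ := by gcongr
      _ = ∫⁻ τ in {τ | |τ - c| ≤ R}ᶜ, decay (-θ) R * G τ := (lintegral_const_mul _ hG).symm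
      _ ≤ ∫⁻ τ in {τ | |τ - c| ≤ R}ᶜ, decay (1 - θ) R * (decay (-1) (τ - c) * G τ) := by
          refine setLIntegral_mono (((hmeas _).mul hG).const_mul _) fun τ hτ => ?_
          rw [← mul_assoc]
          refine mul_le_mul_left ?_ _
          calc decay (-θ) R = decay (1 - θ) R * decay (-1) R := by
                rw [decay_mul_decay]; ring_nf
            _ ≤ _ := mul_le_mul_right (decay_neg_le_decay_neg zero_le_one (hout τ hτ)) _
      _ ≤ _ := htail
  have h2 : ∫⁻ τ in {τ | |τ - c| ≤ R}ᶜ, decay (-θ) (τ - c) * G τ ≤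
      decay (1 - θ) R * ∫⁻ τ, decay (-1) (τ - c) * G τ := by
    refine le_trans ?_ htail
    refine setLIntegral_mono (((hmeas _).mul hG).const_mul _) fun τ hτ => ?_
    rw [← mul_assoc]
    refine mul_le_mul_left ?_ _
    calc decay (-θ) (τ - c) = decay (1 - θ) (τ - c) * decay (-1) (τ - c) := by
          rw [decay_mul_decay]; ring_nf
      _ ≤ _ := mul_le_mul_left (decay_le_of_abs_le (by linarith) (hout τ hτ)) _
  rw [← lintegral_add_compl _ hS]
  calc _ ≤ _ := add_le_add h1 h2
    _ = _ := by ring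

theorem decay_one_div_two_mul_le {p T : ℝ} (hp : 0 ≤ p) (hT : 0 < T) :
    decay p (1 / (2 * T)) ≤ ENNReal.ofReal ((2 * T) ^ p) := by
  refine ENNReal.ofReal_le_ofReal ?_
  have h1 : 1 / (2 * T) ≤ bracket (1 / (2 * T)) := (le_abs_self _).trans (abs_le_bracket _)
  calc bracket (1 / (2 * T)) ^ (-p) ≤ (1 / (2 * T)) ^ (-p) :=
        Real.rpow_le_rpow_of_nonpos (by positivity) h1 (by linarith)
    _ = _ := by rw [one_div, Real.inv_rpow (by positivity), Real.rpow_neg (by positivity), inv_inv]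

/-- For functions of time supported in `[-T, T]`, lowering the modulation weight gains a power
of `T`. -/
theorem lintegral_decay_fourierT_le {g : ℝ → ℂ} {T : ℝ} (hT : 0 < T) (hg : ContDiff ℝ ∞ g)
    (h0 : ∀ t, T < |t| → g t = 0) (c : ℝ) {θ : ℝ} (hθ : 0 ≤ θ) (hθ1 : θ ≤ 1) :
    ∫⁻ τ, decay (-θ) (τ - c) * ‖fourierT g τ‖ₑ ^ 2 ≤
      2 * ENNReal.ofReal ((2 * T) ^ (1 - θ)) *
        ∫⁻ τ, decay (-1) (τ - c) * ‖fourierT g τ‖ₑ ^ 2 := by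
  have hgc : HasCompactSupport g := by
    refine HasCompactSupport.of_support_subset_isCompact (isCompact_Icc (a := -T) (b := T))
      fun t ht => ?_
    rw [Set.mem_Icc, ← abs_le]
    by_contra hlt
    exact ht (h0 t (not_le.mp hlt))
  have hmeas : Measurable fun τ => ‖fourierT g τ‖ₑ ^ 2 :=
    (continuous_fourierT hg hgc).measurable.enorm.pow_const 2
  set E := ∫⁻ τ, ‖fourierT g τ‖ₑ ^ 2 with hE
  have hEfin : E ≠ ⊤ := by
    rw [hE, lintegral_enorm_sq_eq_ofReal_integral (integrable_norm_fourierT_sq hg hgc)]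
    exact ENNReal.ofReal_ne_top
  -- The pointwise bound (T/π)E on an interval of length 1/T gives the fraction 1/π < 1/2.
  have hin : ∫⁻ τ in {τ | |τ - c| ≤ 1 / (2 * T)}, ‖fourierT g τ‖ₑ ^ 2 ≤ E / 2 := by
    have hset : {τ | |τ - c| ≤ 1 / (2 * T)} = Metric.closedBall c (1 / (2 * T)) := rfl
    calc ∫⁻ τ in {τ | |τ - c| ≤ 1 / (2 * T)}, ‖fourierT g τ‖ₑ ^ 2
        ≤ ∫⁻ _ in {τ | |τ - c| ≤ 1 / (2 * T)}, ENNReal.ofReal (T / Real.pi) * E := by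
          refine lintegral_mono fun τ => ?_
          rw [hE, lintegral_enorm_fourierT_sq hg hgc]
          exact enorm_fourierT_sq_le hT hg.continuous h0 τ
      _ = ENNReal.ofReal (1 / Real.pi) * E := by
          rw [setLIntegral_const, hset, Real.volume_closedBall, mul_right_comm,
            ← ENNReal.ofReal_mul (by positivity)]
          congr 2
          field_simp
      _ ≤ ENNReal.ofReal (1 / 2) * E := by
          gcongr
          linarith [Real.pi_gt_three]
      _ = E / 2 := by
          rw [one_div, ENNReal.ofReal_inv_of_pos two_pos, mul_comm, div_eq_mul_inv]
          norm_num
  have hS : MeasurableSet {τ | |τ - c| ≤ 1 / (2 * T)} :=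
    measurableSet_le (by fun_prop) measurable_const
  have hsplit := lintegral_add_compl (μ := volume) (fun τ => ‖fourierT g τ‖ₑ ^ 2) hS
  have hout : E / 2 ≤ ∫⁻ τ in {τ | |τ - c| ≤ 1 / (2 * T)}ᶜ, ‖fourierT g τ‖ₑ ^ 2 := by
    have hfin : E / 2 ≠ ⊤ := ENNReal.div_ne_top hEfin two_ne_zero
    refine (ENNReal.add_le_add_iff_left hfin).mp ?_
    rw [ENNReal.add_halves, hE, ← hsplit]
    gcongr
    rwa [hsplit]
  refine (lintegral_decay_le_of_tail hmeas (by positivity) hθ hθ1 (hin.trans hout)).trans ?_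
  gcongr
  exact decay_one_div_two_mul_le (by linarith) hT

/-- Applied at each ξ with θ = 31/32, twice 31/64 because the norms are squared. The free centre c
covers both signs of the dispersion. -/
theorem IsTest.tsum_lintegral_weight_le (hu : IsTest T u) (hT : 0 < T) (c : ℤ → ℝ) :
    ∑' ξ : ℤ, ∫⁻ τ : ℝ, (decay (-(1 / 2)) ξ * decay (-(31 / 64)) (τ - c ξ) *
        ‖fourierTX u τ ξ‖ₑ) ^ 2 ≤
      2 * ENNReal.ofReal ((2 * T) ^ (1 / 32 : ℝ)) *
        ∑' ξ : ℤ, ∫⁻ τ : ℝ, (decay (-(1 / 2)) ξ * decay (-(1 / 2)) (τ - c ξ) *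
          ‖fourierTX u τ ξ‖ₑ) ^ 2 := by
  rw [← ENNReal.tsum_mul_left]
  refine ENNReal.tsum_le_tsum fun ξ => ?_
  have hcd := hu.contDiff_coeff ξ
  have hcs := hu.hasCompactSupport_coeff ξ
  have hmeas : ∀ p, Measurable fun τ => decay p (τ - c ξ) * ‖fourierTX u τ ξ‖ₑ ^ 2 := fun p =>
    ((measurable_decay p).comp (measurable_id.sub_const _)).mul
      ((continuous_fourierT hcd hcs).measurable.enorm.pow_const 2)
  have hexp : ∀ b : ℝ, ∫⁻ τ : ℝ, (decay (-(1 / 2)) ξ * decay (-b) (τ - c ξ) *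
      ‖fourierTX u τ ξ‖ₑ) ^ 2 =
      decay (-(1 / 2)) ξ ^ 2 * ∫⁻ τ : ℝ, decay (-(2 * b)) (τ - c ξ) * ‖fourierTX u τ ξ‖ₑ ^ 2 := by
    intro b
    rw [← lintegral_const_mul _ (hmeas _)]
    refine lintegral_congr fun τ => ?_
    have : decay (-(2 * b)) (τ - c ξ) = decay (-b) (τ - c ξ) ^ 2 := by
      rw [sq, decay_mul_decay]; ring_nf
    rw [this]; ring
  rw [hexp, hexp, mul_left_comm]
  refine mul_le_mul_right ?_ _
  have h := lintegral_decay_fourierT_le hT hcd (fun t ht => hu.coeff_eq_zero ξ ht) (c ξ)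
    (θ := 31 / 32) (by norm_num) (by norm_num)
  norm_num at h ⊢
  exact h

theorem IsTest.measurable_weighted_sq (hu : IsTest T u) {w : ℝ × ℤ → ℝ≥0∞} (hw : Measurable w) :
    Measurable fun q : ℝ × ℤ => (w q * ‖fourierTX u q.1 q.2‖ₑ) ^ 2 :=
  (hw.mul hu.measurable_enorm_fourierTX).pow_const 2

theorem IsTest.lintegral_wP_le (hu : IsTest T u) (hT : 0 < T) :
    ∫⁻ q, (wP (31 / 64) q * ‖fourierTX u q.1 q.2‖ₑ) ^ 2 ∂freqMeasure ≤
      2 * ENNReal.ofReal ((2 * T) ^ (1 / 32 : ℝ)) *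
        ∫⁻ q, (wP (1 / 2) q * ‖fourierTX u q.1 q.2‖ₑ) ^ 2 ∂freqMeasure := by
  rw [lintegral_freqMeasure (hu.measurable_weighted_sq (measurable_wP _)),
    lintegral_freqMeasure (hu.measurable_weighted_sq (measurable_wP _))]
  have h := hu.tsum_lintegral_weight_le hT fun ξ => -(ξ : ℝ) ^ 2
  simp only [sub_neg_eq_add] at h
  exact h

theorem IsTest.lintegral_wM_le (hu : IsTest T u) (hT : 0 < T) :
    ∫⁻ q, (wM (31 / 64) q * ‖fourierTX u q.1 q.2‖ₑ) ^ 2 ∂freqMeasure ≤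
      2 * ENNReal.ofReal ((2 * T) ^ (1 / 32 : ℝ)) *
        ∫⁻ q, (wM (1 / 2) q * ‖fourierTX u q.1 q.2‖ₑ) ^ 2 ∂freqMeasure := by
  rw [lintegral_freqMeasure (hu.measurable_weighted_sq (measurable_wM _)),
    lintegral_freqMeasure (hu.measurable_weighted_sq (measurable_wM _))]
  exact hu.tsum_lintegral_weight_le hT fun ξ => (ξ : ℝ) ^ 2

/-! ### Translation of the norms and conclusion. -/

theorem ofReal_weight_sq (x y : ℝ) (z : ℂ) :
    ENNReal.ofReal (bracket x ^ (2 * (1 / 2) : ℝ) * bracket y ^ (2 * (1 / 2) : ℝ) * ‖z‖ ^ 2) =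
      (decay (-(1 / 2)) x * decay (-(1 / 2)) y * ‖z‖ₑ) ^ 2 := by
  have h : ∀ y, bracket y ^ (2 * (1 / 2) : ℝ) = (bracket y ^ (1 / 2 : ℝ)) ^ 2 := fun y => by
    rw [← Real.rpow_natCast, ← Real.rpow_mul (bracket_pos y).le]; norm_num
  have hx := Real.rpow_nonneg (bracket_pos x).le (1 / 2)
  have hy := Real.rpow_nonneg (bracket_pos y).le (1 / 2)
  unfold decay
  rw [h, h, neg_neg, ← mul_pow, ← mul_pow, ENNReal.ofReal_pow (by positivity),
    ENNReal.ofReal_mul (by positivity), ENNReal.ofReal_mul hx, ofReal_norm]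

theorem IsTest.normX_eq (hu : IsTest T u) : normX (1 / 2) (1 / 2) u =
    (∫⁻ q, (wP (1 / 2) q * ‖fourierTX u q.1 q.2‖ₑ) ^ 2 ∂freqMeasure) ^ (1 / 2 : ℝ) := by
  rw [lintegral_freqMeasure (hu.measurable_weighted_sq (measurable_wP _))]
  unfold normX
  simp_rw [ofReal_weight_sq]
  rfl

theorem IsTest.normXminus_eq (hu : IsTest T u) : normXminus (1 / 2) (1 / 2) u =
    (∫⁻ q, (wM (1 / 2) q * ‖fourierTX u q.1 q.2‖ₑ) ^ 2 ∂freqMeasure) ^ (1 / 2 : ℝ) := by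
  rw [lintegral_freqMeasure (hu.measurable_weighted_sq (measurable_wM _))]
  unfold normXminus
  simp_rw [ofReal_weight_sq]
  rfl

theorem normY_le {f : ℝ × ℝ → ℂ} {g : ℝ × ℤ → ℝ≥0∞}
    (h : ∀ p : ℝ × ℤ, ‖fourierTX f p.1 p.2‖ₑ ≤ g p) :
    normY (1 / 2) (-1) f ≤ (∑' ξ : ℤ, (∫⁻ τ : ℝ, decay 1 (modP (τ, ξ)) * decay (-(1 / 2)) ξ *
      g (τ, ξ)) ^ 2) ^ (1 / 2 : ℝ) := by
  unfold normY
  gcongr with ξ τ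
  have h1 := Real.rpow_nonneg (bracket_pos (τ + (ξ : ℝ) ^ 2)).le (-1)
  have h2 := Real.rpow_nonneg (bracket_pos (ξ : ℝ)).le (1 / 2)
  rw [ENNReal.ofReal_mul (by positivity), ENNReal.ofReal_mul h1, ofReal_norm]
  unfold decay
  rw [neg_neg]
  exact mul_le_mul_right (h (τ, ξ)) _

/-- Each of the three products has exactly two weakened weights, hence the squared gain and the
factor 3. -/
theorem IsTest.energy_le {u₁ u₂ u₃ : ℝ × ℝ → ℂ} (h₁ : IsTest T u₁) (h₂ : IsTest T u₂)
    (h₃ : IsTest T u₃) (hT : 0 < T) :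
    energy (fun q => ‖fourierTX u₁ q.1 q.2‖ₑ) (fun q => ‖fourierTX u₂ q.1 q.2‖ₑ)
        (fun q => ‖fourierTX u₃ q.1 q.2‖ₑ) ≤
      3 * (2 * ENNReal.ofReal ((2 * T) ^ (1 / 32 : ℝ))) ^ 2 *
        ((∫⁻ q, (wP (1 / 2) q * ‖fourierTX u₁ q.1 q.2‖ₑ) ^ 2 ∂freqMeasure) *
        (∫⁻ q, (wP (1 / 2) q * ‖fourierTX u₂ q.1 q.2‖ₑ) ^ 2 ∂freqMeasure) *
        ∫⁻ q, (wM (1 / 2) q * ‖fourierTX u₃ q.1 q.2‖ₑ) ^ 2 ∂freqMeasure) := by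
  have e₁ := h₁.lintegral_wP_le hT
  have e₂ := h₂.lintegral_wP_le hT
  have e₃ := h₃.lintegral_wM_le hT
  unfold energy
  set K := 2 * ENNReal.ofReal ((2 * T) ^ (1 / 32 : ℝ))
  set E₁ := ∫⁻ q, (wP (1 / 2) q * ‖fourierTX u₁ q.1 q.2‖ₑ) ^ 2 ∂freqMeasure
  set E₂ := ∫⁻ q, (wP (1 / 2) q * ‖fourierTX u₂ q.1 q.2‖ₑ) ^ 2 ∂freqMeasure
  set E₃ := ∫⁻ q, (wM (1 / 2) q * ‖fourierTX u₃ q.1 q.2‖ₑ) ^ 2 ∂freqMeasure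
  calc _ ≤ E₁ * (K * E₂) * (K * E₃) + K * E₁ * E₂ * (K * E₃) + K * E₁ * (K * E₂) * E₃ := by gcongr
    _ = _ := by ring

end PeriodicBourgain

open PeriodicBourgain

theorem theorem3 :
    ∃ c ε : ℝ, 0 < c ∧ 0 < ε ∧
      ∀ T : ℝ, 0 < T → T ≤ 1 →
      ∀ u₁ u₂ u₃ : ℝ × ℝ → ℂ,
        PeriodicBourgain.IsSper u₁ → PeriodicBourgain.IsSper u₂ → PeriodicBourgain.IsSper u₃ →
        tsupport u₁ ⊆ {p : ℝ × ℝ | |p.1| ≤ T} →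
        tsupport u₂ ⊆ {p : ℝ × ℝ | |p.1| ≤ T} →
        tsupport u₃ ⊆ {p : ℝ × ℝ | |p.1| ≤ T} →
        PeriodicBourgain.normY (1 / 2) (-1)
            (fun p => u₁ p * u₂ p * PeriodicBourgain.partialX u₃ p) ≤
          ENNReal.ofReal (c * T ^ ε) *
            PeriodicBourgain.normX (1 / 2) (1 / 2) u₁ *
            PeriodicBourgain.normX (1 / 2) (1 / 2) u₂ *
            PeriodicBourgain.normXminus (1 / 2) (1 / 2) u₃ := by
  obtain ⟨C, hC⟩ := exists_trilinear_estimate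
  -- The square root of 3C(2(2T)^{1/32})², with C + 1 in place of C so that the constant is
  -- positive.
  refine ⟨Real.sqrt (3 * (C + 1)) * (2 * 2 ^ (1 / 32 : ℝ)), 1 / 32, by positivity, by norm_num,
    fun T hT _ u₁ u₂ u₃ s₁ s₂ s₃ t₁ t₂ t₃ => ?_⟩
  have h₁ := s₁.isTest t₁
  have h₂ := s₂.isTest t₂
  have h₃ := s₃.isTest t₃
  rw [h₁.normX_eq, h₂.normX_eq, h₃.normXminus_eq]
  refine (normY_le (h₁.enorm_fourierTX_product_le h₂ h₃)).trans ?_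
  have hE := (hC _ _ _ h₁.measurable_enorm_fourierTX h₂.measurable_enorm_fourierTX
    h₃.measurable_enorm_fourierTX).trans (mul_le_mul_right (h₁.energy_le h₂ h₃ hT) _)
  refine (ENNReal.rpow_le_rpow hE (by norm_num : (0 : ℝ) ≤ 1 / 2)).trans ?_
  set E₁ := ∫⁻ q, (wP (1 / 2) q * ‖fourierTX u₁ q.1 q.2‖ₑ) ^ 2 ∂freqMeasure
  set E₂ := ∫⁻ q, (wP (1 / 2) q * ‖fourierTX u₂ q.1 q.2‖ₑ) ^ 2 ∂freqMeasure
  set E₃ := ∫⁻ q, (wM (1 / 2) q * ‖fourierTX u₃ q.1 q.2‖ₑ) ^ 2 ∂freqMeasure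
  set A : ℝ := Real.sqrt (3 * (C + 1)) * (2 * 2 ^ (1 / 32 : ℝ)) * T ^ (1 / 32 : ℝ) with hA
  have hconst : (C : ℝ≥0∞) * (3 * (2 * ENNReal.ofReal ((2 * T) ^ (1 / 32 : ℝ))) ^ 2) ≤
      ENNReal.ofReal A ^ 2 := by
    have hAsq : A ^ 2 = (C + 1) * (3 * (2 * (2 * T) ^ (1 / 32 : ℝ)) ^ 2) := by
      rw [hA, Real.mul_rpow two_pos.le hT.le, mul_pow, mul_pow, Real.sq_sqrt (by positivity)]
      ring
    have h2T : 0 ≤ (2 * T) ^ (1 / 32 : ℝ) := by positivity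
    rw [← ENNReal.ofReal_pow (by positivity), hAsq, ENNReal.ofReal_mul (by positivity),
      ENNReal.ofReal_mul (by norm_num), ENNReal.ofReal_pow (by positivity),
      ENNReal.ofReal_mul (by norm_num), ENNReal.ofReal_ofNat, ENNReal.ofReal_ofNat]
    refine mul_le_mul_left ?_ _
    rw [ENNReal.ofReal_add (by positivity) (by norm_num), ENNReal.ofReal_coe_nnreal]
    exact le_self_add
  calc _ ≤ (ENNReal.ofReal A ^ 2 * (E₁ * E₂ * E₃)) ^ (1 / 2 : ℝ) := by
        rw [← mul_assoc]
        gcongr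
    _ = _ := by
        rw [ENNReal.mul_rpow_of_nonneg _ _ (by norm_num), ENNReal.mul_rpow_of_nonneg _ _ (by norm_num),
          ENNReal.mul_rpow_of_nonneg _ _ (by norm_num), ← ENNReal.rpow_natCast, ← ENNReal.rpow_mul]
        norm_num
        ring
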